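/- **Setting.** Let $d\ge 2$ be an integer. For a real $\ell$ consider two families of parameters $(r,\sigma_2,c_+,c_-,\lambda_-,\mu_+)$. *Family $*$:* $$r=\frac{d+\ell}{\ell+\sqrt d},\quad \sigma_2=\frac{\sqrt d}{\ell+\sqrt d},\quad c_+=\ell,\quad c_-=-\frac{2\ell\sqrt d}{d(\sqrt d-1)+\ell(\sqrt d+1)},$$ $$\lambda_-=-\frac{d(d-\sqrt d)+2d+\ell(d+\sqrt d)}{(\ell+\sqrt d)^2},\quad \mu_+=-\frac{4d}{-d+d^{3/2}+\ell+\sqrt d(2+\ell)} .$$ *Family $+$:* $$r=1+\frac{d-1}{(1+\sqrt\ell)^2},\quad \sigma_2=\frac1{1+\sqrt\ell},\quad c_+=\frac{\sqrt\ell(d+\sqrt\ell)}{1+\sqrt\ell},\quad c_-=-1,$$ $$\lambda_-=-\frac{2[\ell+(d+1)\sqrt\ell+1]}{(1+\sqrt\ell)^3},\quad \mu_+=-\frac{2\sqrt{d-1}\,(\ell-d)}{(1+\sqrt\ell)\,\ell^{1/4}\,(1+(d+1)\sqrt\ell+\ell)} .$$ In both families put $w_2=1-\sigma_2$, $w_e=\ell(r-1)/d$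 and $$\Delta_1=w(w-1)(w-r)-d(w-w_e)\sigma^2,\qquad \Delta_2=\frac{\sigma}{\ell}\left[(\ell+d-1)w^2-w(\ell+d+\ell r-r)+\ell r-\ell\sigma^2\right].$$ For $i+j\in\{2,3\}$ let $\tilde d_{ij}$ and $\tilde e_{ij}$ be the coefficients of $W^i\Sigma^j$ in $-\Delta_1+c_+\Delta_2$ and in $\Delta_1-c_-\Delta_2$ respectively, evaluated at $w=w_2+c_-W+c_+\Sigma$, $\sigma=\sigma_2+W+\Sigma$. Put $$\tilde w=\frac{(c_+-c_-)\mu_+}{\tilde d_{20}},\quad \tilde\psi=-\frac{\tilde e_{20}\mu_+}{\tilde d_{20}\lambda_-},\quad D_{ij}=\frac{\tilde d_{ij}\tilde\psi^{j}\tilde w^{\,i+j-1}}{(-\mu_+)(c_+-c_-)},\quad E_{ij}=\frac{\tilde e_{ij}\tilde\psi^{j-1}\tilde w^{\,i+j-1}}{(-\lambda_-)(c_+-c_-)},$$ $$a=\frac{\lambda_-}{\mu_+},\qquad \nu=-a\,(D_{11}+D_{30}-E_{11}).$$ Define the polynomials in $x$ $$H_1=-(E_{11}+E_{30})+(E_{02}+E_{21})x-E_{12}x^2+E_{03}x^3,\quad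 H_2=(D_{11}+D_{30})x-(D_{02}+D_{21})x^2+D_{12}x^3-D_{03}x^4,$$ $$G_1=E_{11}x-(2E_{02}+E_{21})x^2+2E_{12}x^3-3E_{03}x^4,\quad G_2=-D_{11}x+(2D_{02}+D_{21})x^2-2D_{12}x^3+3D_{03}x^4,$$ $$M_{11}=-E_{02}x+E_{12}x^2-3E_{03}x^3,\quad M_{12}=-E_{03}x^2,\quad M_{21}=D_{02}x-D_{12}x^2+3D_{03}x^3,\quad M_{22}=D_{03}x^2,$$ and $N_i=-xM_{i1}\Psi^2+x^2M_{i2}\Psi^3$ for $i=1,2$. The limiting equation is $$[1+H_2+G_2\Psi+N_2](-x^2)\Psi'+\left[-2x(1+H_2+G_2\Psi+N_2)-a(1+G_1)+2xG_2\right]\Psi=x\left[aH_1-2(1+H_2)+\tfrac{aN_1}{x}-2N_2\right].$$ Let $$\xi=\frac{a}{x^2}(1+E_{11}x)\left[\frac1{1+H_2}-1+(D_{11}+D_{30})x\right]-aE_{11}(D_{11}+D_{30})+\frac{a(G_1-E_{11}x)-2xG_2}{x^2(1+H_2)},\qquad M=e^{-\int_0^x\xi},$$ $$G=-\frac{aH_1-2(1+H_2)+\frac{aN_1}{x}-2N_2+(G_2\Psi+N_2)(2\Psi+x\Psi')}{M(1+H_2)}.$$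 With $\Psi=xM\Theta$ the limiting equation becomes $x^2\Theta'+[a+(\nu+3)x]\Theta=G$, which has a unique formal power series solution $\Theta=\sum_k\theta_kx^k$. Let $g_k$ be the coefficients of the corresponding series $G=\sum_k g_kx^k$ and define $$S_\infty=\frac1a\sum_{j=0}^{\infty}\frac{(-1)^ja^jg_j}{\Gamma(\nu+j+3)},$$ where $1/\Gamma$ is the entire function that vanishes at $0,-1,-2,\dots$. Write $S^*_\infty(d,\ell)$, $\nu^*(d,\ell)$ for the values given by the family $*$, and $S^+_\infty(d,\ell)$ for those given by the family $+$. Let $\mathcal O_d^*=\{\ell\in(0,d):\nu^*(d,\ell)>0\}$. For complex $\ell$ the same formulas are used, with the principal determinations of $\sqrt\ell$ and $\ell^{1/4}$. **Lemma 1.4.** 1. For every $d\ge4$ there is an open set $\Omega\subset\mathbb C$ containing $\mathcal O_d^*$ to which $\ell\mapsto S_\infty^*(d,\ell)$ extends holomorphically. 2. For every $d\ge4$ there is an open set $\Omega\subset\mathbb C$ containing $(d,\infty)$ to which $\ell\mapsto S_\infty^+(d,\ell)$ extends holomorphically. 3. For $d=2,3$ there is an open set $\Omega\subset\mathbb C$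 containing $(0,d)$ to which $\ell\mapsto S_\infty^*(d,\ell)$ extends holomorphically. 4. For $d=2,3$ there is an open set $\Omega\subset\mathbb C$ containing $(0,\infty)\setminus\{d\}$ to which $\ell\mapsto S_\infty^+(d,\ell)$ extends holomorphically, and $(0,d)$ and $(d,\infty)$ lie in the same connected component of $\Omega$. In each case the extension is given by the explicit formulas above: the series defining $S_\infty$ converges absolutely at every real $\ell$ in the set considered and at every $\ell\in\Omega$, its sum is holomorphic on $\Omega$, and the sum computed with complex parameters agrees with the real one at the real points in question. -/

import Mathlib

namespace Implosion

open PowerSeries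

noncomputable section

/-- The numbers attached to the critical point `P₂ = (w₂, σ₂)` at a critical speed `r`:
dimension `d`, parameter `ℓ`, speed `r`, coordinate `σ₂` (with `w₂ = 1 - σ₂`), slopes
`c₊, c₋`, eigenvalue `λ₋`, and first order variation `μ₊` of the degenerate eigenvalue.
The same formulas are used over `ℝ` and over `ℂ`. -/
structure Params (𝕜 : Type) where
  d : 𝕜
  l : 𝕜
  r : 𝕜
  sig : 𝕜
  cp : 𝕜
  cm : 𝕜
  lam : 𝕜
  mu : 𝕜

section Generic

variable {𝕜 : Type} [Field 𝕜]

/-- The values at the speed `r_* = (d + ℓ) / (ℓ + √d)`; here `q = √d`. -/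
def starParams (d q l : 𝕜) : Params 𝕜 where
  d := d
  l := l
  r := (d + l) / (l + q)
  sig := q / (l + q)
  cp := l
  cm := -(2 * l * q) / (d * (q - 1) + l * (q + 1))
  lam := -(d * (d - q) + 2 * d + l * (d + q)) / (l + q) ^ 2
  mu := -(4 * d) / (-d + d * q + l + q * (2 + l))

/-- The values at the speed `r^+ = 1 + (d - 1) / (1 + √ℓ) ^ 2`; here `m = √(d - 1)`,
`s = √ℓ` and `t = ℓ ^ (1 / 4)`. -/
def plusParams (d m l s t : 𝕜) : Params 𝕜 where
  d := d
  l := l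
  r := 1 + (d - 1) / (1 + s) ^ 2
  sig := 1 / (1 + s)
  cp := s * (d + s) / (1 + s)
  cm := -1
  lam := -(2 * (l + (d + 1) * s + 1)) / (1 + s) ^ 3
  mu := -(2 * m * (l - d)) / ((1 + s) * t * (1 + (d + 1) * s + l))

namespace Params

variable (p : Params 𝕜)

/-! Taylor coefficients at `P₂` of `Δ₁, Δ₂` in the original variables `(w, σ)`; with
`W = w - w₂`, `S = σ - σ₂`, the quadratic part of `Δ₁` is `d₂₀ W² + d₁₁ W S + d₀₂ S²`, that of
`Δ₂` is `e₂₀ W² + e₁₁ W S + e₀₂ S²`, and the cubic parts are `W³ - d W S²` and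
`e₂₁ W² S - S³`. -/

def w2 : 𝕜 := 1 - p.sig
def d20 : 𝕜 := 3 * p.w2 - (p.r + 1)
def d11 : 𝕜 := -(2 * p.d * p.sig)
def d02 : 𝕜 := p.l * (p.r - 1) - p.d * p.w2
def e20 : 𝕜 := p.sig * (p.l + p.d - 1) / p.l
def e11 : 𝕜 := (2 * p.w2 * (p.l + p.d - 1) - (p.l + p.d + p.l * p.r - p.r)) / p.l
def e02 : 𝕜 := -(3 * p.sig)
def e21 : 𝕜 := (p.l + p.d - 1) / p.l

/-! With the coordinates `(W, Σ)` along the two slopes, `w = w₂ + c₋ W + c₊ Σ` and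
`σ = σ₂ + W + Σ`, the coefficient of `W ^ i Σ ^ j` (with `i + j = 2, 3`) in
`Δ₁` is `A i j`, and in `Δ₂` it is `B i j`. -/

def A20 : 𝕜 := p.d20 * p.cm ^ 2 + p.d11 * p.cm + p.d02
def A11 : 𝕜 := 2 * p.cm * p.cp * p.d20 + (p.cm + p.cp) * p.d11 + 2 * p.d02
def A02 : 𝕜 := p.d20 * p.cp ^ 2 + p.d11 * p.cp + p.d02
def A30 : 𝕜 := p.cm ^ 3 - p.d * p.cm
def A21 : 𝕜 := 3 * p.cm ^ 2 * p.cp - 2 * p.d * p.cm - p.d * p.cp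
def A12 : 𝕜 := 3 * p.cm * p.cp ^ 2 - p.d * p.cm - 2 * p.d * p.cp
def A03 : 𝕜 := p.cp ^ 3 - p.d * p.cp
def B20 : 𝕜 := p.e20 * p.cm ^ 2 + p.e11 * p.cm + p.e02
def B11 : 𝕜 := 2 * p.cm * p.cp * p.e20 + (p.cm + p.cp) * p.e11 + 2 * p.e02
def B02 : 𝕜 := p.e20 * p.cp ^ 2 + p.e11 * p.cp + p.e02
def B30 : 𝕜 := p.e21 * p.cm ^ 2 - 1
def B21 : 𝕜 := p.e21 * (p.cm ^ 2 + 2 * p.cm * p.cp) - 3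
def B12 : 𝕜 := p.e21 * (2 * p.cm * p.cp + p.cp ^ 2) - 3
def B03 : 𝕜 := p.e21 * p.cp ^ 2 - 1

/-- From the coefficients of `Δ₁` and `Δ₂` to that of `-Δ₁ + c₊ Δ₂` (these are the `d̃ i j`). -/
def dt (A B : 𝕜) : 𝕜 := -A + p.cp * B

/-- From the coefficients of `Δ₁` and `Δ₂` to that of `Δ₁ - c₋ Δ₂` (these are the `ẽ i j`). -/
def et (A B : 𝕜) : 𝕜 := A - p.cm * B

def dt20 : 𝕜 := p.dt p.A20 p.B20
def et20 : 𝕜 := p.et p.A20 p.B20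

/-- The scales `w̃` and `ψ̃` of the renormalized unknowns. -/
def wInf : 𝕜 := (p.cp - p.cm) * p.mu / p.dt20
def psiInf : 𝕜 := -(p.et20 * p.mu) / (p.dt20 * p.lam)

/-! Renormalized coefficients
`D i j = d̃ i j ψ̃ ^ j w̃ ^ (i + j - 1) / (|μ₊| (c₊ - c₋))` and
`E i j = ẽ i j ψ̃ ^ (j - 1) w̃ ^ (i + j - 1) / (|λ₋| (c₊ - c₋))`,
where `|μ₊| = -μ₊` and `|λ₋| = -λ₋`. -/

def D11 : 𝕜 := p.dt p.A11 p.B11 * p.psiInf * p.wInf / (-p.mu * (p.cp - p.cm))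
def D02 : 𝕜 := p.dt p.A02 p.B02 * p.psiInf ^ 2 * p.wInf / (-p.mu * (p.cp - p.cm))
def D30 : 𝕜 := p.dt p.A30 p.B30 * p.wInf ^ 2 / (-p.mu * (p.cp - p.cm))
def D21 : 𝕜 := p.dt p.A21 p.B21 * p.psiInf * p.wInf ^ 2 / (-p.mu * (p.cp - p.cm))
def D12 : 𝕜 := p.dt p.A12 p.B12 * p.psiInf ^ 2 * p.wInf ^ 2 / (-p.mu * (p.cp - p.cm))
def D03 : 𝕜 := p.dt p.A03 p.B03 * p.psiInf ^ 3 * p.wInf ^ 2 / (-p.mu * (p.cp - p.cm))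
def E11 : 𝕜 := p.et p.A11 p.B11 * p.wInf / ((p.cp - p.cm) * -p.lam)
def E02 : 𝕜 := p.et p.A02 p.B02 * p.psiInf * p.wInf / ((p.cp - p.cm) * -p.lam)
def E30 : 𝕜 := p.et p.A30 p.B30 * p.wInf ^ 2 / ((p.cp - p.cm) * -p.lam * p.psiInf)
def E21 : 𝕜 := p.et p.A21 p.B21 * p.wInf ^ 2 / ((p.cp - p.cm) * -p.lam)
def E12 : 𝕜 := p.et p.A12 p.B12 * p.psiInf * p.wInf ^ 2 / ((p.cp - p.cm) * -p.lam)
def E03 : 𝕜 := p.et p.A03 p.B03 * p.psiInf ^ 2 * p.wInf ^ 2 / ((p.cp - p.cm) * -p.lam)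

/-- `a = |λ₋| / |μ₊|`. -/
def a : 𝕜 := p.lam / p.mu

def nu : 𝕜 := -p.a * (p.D11 + p.D30 - p.E11)

/-! The polynomial coefficients of the limiting equation

`[1 + H₂ + G₂ Ψ + N₂] (-x²) Ψ' + [-2x (1 + H₂ + G₂ Ψ + N₂) - a (1 + G₁) + 2x G₂] Ψ`
`  = x [a H₁ - 2 (1 + H₂) + a N₁ / x - 2 N₂]`,

with `N₁ = -x M₁₁ Ψ² + x² M₁₂ Ψ³` and `N₂ = -x M₂₁ Ψ² + x² M₂₂ Ψ³`,
as formal power series in `x`. -/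

def H1 : PowerSeries 𝕜 :=
  C (-(p.E11 + p.E30)) + C (p.E02 + p.E21) * X - C p.E12 * X ^ 2 + C p.E03 * X ^ 3
def H2 : PowerSeries 𝕜 :=
  C (p.D11 + p.D30) * X - C (p.D02 + p.D21) * X ^ 2 + C p.D12 * X ^ 3 - C p.D03 * X ^ 4
def G1 : PowerSeries 𝕜 :=
  C p.E11 * X - C (2 * p.E02 + p.E21) * X ^ 2 + C (2 * p.E12) * X ^ 3 - C (3 * p.E03) * X ^ 4
def G2 : PowerSeries 𝕜 :=
  -(C p.D11 * X) + C (2 * p.D02 + p.D21) * X ^ 2 - C (2 * p.D12) * X ^ 3 + C (3 * p.D03) * X ^ 4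
def M11 : PowerSeries 𝕜 := -(C p.E02 * X) + C p.E12 * X ^ 2 - C (3 * p.E03) * X ^ 3
def M12 : PowerSeries 𝕜 := -(C p.E03 * X ^ 2)
def M21 : PowerSeries 𝕜 := C p.D02 * X - C p.D12 * X ^ 2 + C (3 * p.D03) * X ^ 3
def M22 : PowerSeries 𝕜 := C p.D03 * X ^ 2

/-- `N₁ / x`. -/
def N1divX (Ψ : PowerSeries 𝕜) : PowerSeries 𝕜 := -(p.M11 * Ψ ^ 2) + X * p.M12 * Ψ ^ 3

def N2 (Ψ : PowerSeries 𝕜) : PowerSeries 𝕜 := -(X * p.M21 * Ψ ^ 2) + X ^ 2 * p.M22 * Ψ ^ 3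

/-- `x² ξ(x) + a E₁₁ (D₁₁ + D₃₀) x²`, a power series divisible by `x²`. -/
def xiNum : PowerSeries 𝕜 :=
  C p.a * (1 + C p.E11 * X) * ((1 + p.H2)⁻¹ - 1 + C (p.D11 + p.D30) * X)
    + (C p.a * (p.G1 - C p.E11 * X) - 2 * X * p.G2) * (1 + p.H2)⁻¹

/-- The regular part of the linearized equation:
`ξ = (a / x²) (1 + E₁₁ x) (1 / (1 + H₂) - 1 + (D₁₁ + D₃₀) x) - a E₁₁ (D₁₁ + D₃₀)`
`    + (a (G₁ - E₁₁ x) - 2x G₂) / (x² (1 + H₂))`. -/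
def xi : PowerSeries 𝕜 :=
  PowerSeries.mk (fun n => coeff (n + 2) p.xiNum) - C (p.a * p.E11 * (p.D11 + p.D30))

/-- Coefficients of `M = exp (-∫₀ˣ ξ)`, that is of the solution of `M' = -ξ M`, `M(0) = 1`. -/
def mCoeff : ℕ → 𝕜
  | 0 => 1
  | k + 1 => -(∑ i : Fin (k + 1), coeff (k - i) p.xi * mCoeff i) / ((k : 𝕜) + 1)
decreasing_by exact i.2

def M : PowerSeries 𝕜 := PowerSeries.mk p.mCoeff

def F0 : PowerSeries 𝕜 := C p.a * p.H1 - 2 * (1 + p.H2)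

/-- The nonlinear terms `a N₁ / x - 2 N₂ + (G₂ Ψ + N₂) (2 Ψ + x Ψ')`. -/
def F (Ψ : PowerSeries 𝕜) : PowerSeries 𝕜 :=
  C p.a * p.N1divX Ψ - 2 * p.N2 Ψ + (p.G2 * Ψ + p.N2 Ψ) * (2 * Ψ + X * derivative 𝕜 Ψ)

/-- `G = -(F₀ + F) / (M (1 + H₂))`, where `Ψ = x M Θ`. -/
def source (Θ : PowerSeries 𝕜) : PowerSeries 𝕜 :=
  -(p.F0 + p.F (X * p.M * Θ)) * (p.M * (1 + p.H2))⁻¹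

/-- The map whose fixed points are the solutions of `x² Θ' + (a + (ν + 3) x) Θ = G`. The
coefficient of order `k` of its value depends only on the coefficients of order `< k` of `Θ`. -/
def step (Θ : PowerSeries 𝕜) : PowerSeries 𝕜 :=
  C p.a⁻¹ * (p.source Θ - X ^ 2 * derivative 𝕜 Θ - C (p.nu + 3) * X * Θ)

/-- The formal power series solution `Θ` of `x² Θ' + (a + (ν + 3) x) Θ = G`, its coefficients
being computed by the induction relation (`k + 1` iterations determine the coefficient of
order `k`). -/
def theta : PowerSeries 𝕜 :=
  PowerSeries.mk fun k => coeff k (p.step^[k + 1] 0)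

/-- The coefficients `g_k` of `G` along the solution `Θ`. -/
def g (k : ℕ) : 𝕜 := coeff k (p.source p.theta)

theorem map_F_congr {S : Type} [CommRing S] (φ : PowerSeries 𝕜 →+* S) {f g : PowerSeries 𝕜}
    (h : φ f = φ g) (h' : φ (X * derivative 𝕜 f) = φ (X * derivative 𝕜 g)) :
    φ (p.F f) = φ (p.F g) := by
  rw [map_mul, map_mul] at h'
  simp only [F, N1divX, N2, map_add, map_sub, map_neg, map_mul, map_pow, h, h']

theorem map_step_congr {S : Type} [CommRing S] (φ : PowerSeries 𝕜 →+* S) {f g : PowerSeries 𝕜}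
    (h : φ (p.source f) = φ (p.source g))
    (h3 : φ (X ^ 2 * derivative 𝕜 f) = φ (X ^ 2 * derivative 𝕜 g))
    (h4 : φ (C (p.nu + 3) * X * f) = φ (C (p.nu + 3) * X * g)) :
    φ (p.step f) = φ (p.step g) := by
  rw [step, step, map_mul, map_mul, map_sub, map_sub, map_sub, map_sub, h, h3, h4]

theorem step_congr {n : ℕ} {Θ₁ Θ₂ : PowerSeries 𝕜} (h : X ^ n ∣ Θ₁ - Θ₂) :
    X ^ (n + 1) ∣ p.step Θ₁ - p.step Θ₂ := by
  obtain ⟨A, hA⟩ := h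
  obtain rfl : Θ₁ = Θ₂ + X ^ n * A := by rw [← hA]; ring
  have key : ∀ f g : PowerSeries 𝕜, X ^ (n + 1) ∣ f - g ↔
      Ideal.Quotient.mk (Ideal.span {(X : PowerSeries 𝕜) ^ (n + 1)}) f =
      Ideal.Quotient.mk (Ideal.span {(X : PowerSeries 𝕜) ^ (n + 1)}) g := by
    intro f g
    rw [Ideal.Quotient.eq, Ideal.mem_span_singleton]
  have hd : ∀ B : PowerSeries 𝕜, X ^ (n + 1) ∣ X * derivative 𝕜 (X ^ (n + 1) * B) := by
    intro B
    refine ⟨((n : PowerSeries 𝕜) + 1) * B + X * derivative 𝕜 B, ?_⟩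
    rw [Derivation.leibniz, Derivation.leibniz_pow, derivative_X]
    simp only [smul_eq_mul, nsmul_eq_mul, Nat.add_sub_cancel]
    push_cast
    ring
  have h1 := (key (X * p.M * (Θ₂ + X ^ n * A)) (X * p.M * Θ₂)).1 ⟨p.M * A, by ring⟩
  have h2 := (key (X * derivative 𝕜 (X * p.M * (Θ₂ + X ^ n * A)))
      (X * derivative 𝕜 (X * p.M * Θ₂))).1 (by
    have := hd (p.M * A)
    rwa [← mul_sub, ← map_sub, show X * p.M * (Θ₂ + X ^ n * A) - X * p.M * Θ₂
      = X ^ (n + 1) * (p.M * A) by ring])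
  have h3 := (key (X ^ 2 * derivative 𝕜 (Θ₂ + X ^ n * A)) (X ^ 2 * derivative 𝕜 Θ₂)).1 (by
    rw [← mul_sub, ← map_sub, add_sub_cancel_left]
    have := hd A
    rw [show (X : PowerSeries 𝕜) ^ (n + 1) * A = X * (X ^ n * A) by ring, Derivation.leibniz,
      derivative_X] at this
    simp only [smul_eq_mul, mul_one] at this
    rw [mul_add] at this
    have h' := (dvd_add_left (a := (X : PowerSeries 𝕜) ^ (n + 1)) (b := X * (X * derivative 𝕜 (X ^ n * A)))
      (c := X * (X ^ n * A)) ⟨A, by ring⟩).1 this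
    rwa [show X ^ 2 * derivative 𝕜 (X ^ n * A) = X * (X * derivative 𝕜 (X ^ n * A)) by ring])
  have h4 := (key (C (p.nu + 3) * X * (Θ₂ + X ^ n * A)) (C (p.nu + 3) * X * Θ₂)).1
    ⟨C (p.nu + 3) * A, by ring⟩
  rw [key]
  refine p.map_step_congr _ ?_ h3 h4
  rw [source, source, map_mul, map_mul, map_neg, map_neg, map_add, map_add,
    p.map_F_congr _ h1 h2]

theorem coeff_iterate {k m n : ℕ} (hm : k < m) (hn : k < n) :
    coeff k (p.step^[m] 0) = coeff k (p.step^[n] 0) := by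
  have main : ∀ i j : ℕ, X ^ i ∣ p.step^[i + j] 0 - p.step^[i] 0 := by
    intro i
    induction i with
    | zero => intro j; simp
    | succ i ih =>
      intro j
      rw [show i + 1 + j = (i + j) + 1 by ring, Function.iterate_succ_apply',
        Function.iterate_succ_apply']
      exact p.step_congr (ih j)
  have aux : ∀ i, k < i → coeff k (p.step^[i] 0) = coeff k (p.step^[k + 1] 0) := by
    intro i hi
    obtain ⟨j, rfl⟩ := Nat.exists_eq_add_of_le (Nat.succ_le_of_lt hi)
    have := X_pow_dvd_iff.1 (main (k + 1) j) k (Nat.lt_succ_self k)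
    rw [map_sub, sub_eq_zero] at this
    exact this
  rw [aux m hm, aux n hn]

theorem step_theta : p.step p.theta = p.theta := by
  ext k
  have h : X ^ k ∣ p.theta - p.step^[k] 0 := by
    rw [X_pow_dvd_iff]
    intro i hi
    rw [map_sub, sub_eq_zero, theta, coeff_mk]
    exact p.coeff_iterate (Nat.lt_succ_self i) hi
  have := X_pow_dvd_iff.1 (p.step_congr h) k (Nat.lt_succ_self k)
  rw [map_sub, sub_eq_zero, ← Function.iterate_succ_apply' p.step] at this
  rw [this, theta, coeff_mk]

/-- `theta` solves the nonlinear equation `x² Θ' + (a + (ν + 3) x) Θ = G`. -/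
theorem theta_equation (ha : p.a ≠ 0) :
    X ^ 2 * derivative 𝕜 p.theta + (C p.a + C (p.nu + 3) * X) * p.theta = p.source p.theta := by
  have h := p.step_theta
  have h' : C p.a * p.step p.theta = C p.a * p.theta := by rw [h]
  rw [step, ← mul_assoc, ← map_mul, mul_inv_cancel₀ ha, map_one, one_mul] at h'
  linear_combination -h'

/-- `M' = -ξ M`. -/
theorem derivative_M [CharZero 𝕜] : derivative 𝕜 p.M = -(p.xi * p.M) := by
  ext k
  rw [mul_comm p.xi p.M, coeff_derivative, M, coeff_mk, map_neg, coeff_mul, mCoeff]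
  have hk : (k : 𝕜) + 1 ≠ 0 := by exact_mod_cast Nat.succ_ne_zero k
  have := Finset.Nat.sum_antidiagonal_eq_sum_range_succ
    (fun i j => p.mCoeff i * coeff j p.xi) k
  rw [div_mul_cancel₀ _ hk]
  simp only [coeff_mk]
  rw [this, ← Fin.sum_univ_eq_sum_range (fun i => p.mCoeff i * coeff (k - i) p.xi)]
  simp only [mul_comm]

theorem constantCoeff_one_add_H2 : constantCoeff (1 + p.H2) = 1 := by
  simp [H2]

/-- The series `xi` is the one displayed in its definition. -/
theorem xi_spec : X ^ 2 * (p.xi + C (p.a * p.E11 * (p.D11 + p.D30))) = p.xiNum := by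
  have h1 : (1 + p.H2) * (1 + p.H2)⁻¹ = 1 := PowerSeries.mul_inv_cancel _ (by rw [constantCoeff_one_add_H2]; simp)
  have : X ^ 2 ∣ p.xiNum := by
    have : p.xiNum * (1 + p.H2) = X ^ 2 * (C p.a * (1 + C p.E11 * X) * (C (p.D11 + p.D30)^2 + (1 - C (p.D11 + p.D30) * X) * (C (p.D02+p.D21) -  C p.D12 * X + C p.D03 * X ^2)) + C p.a * (-C (2 * p.E02 + p.E21) + C (2 * p.E12) * X - C (3 * p.E03) * X ^ 2) - 2 * (-(C p.D11) + C (2 * p.D02 + p.D21) * X - C (2 * p.D12) * X ^ 2 + C (3 * p.D03) * X ^ 3)) := by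
      have e1 : p.xiNum * (1 + p.H2) = C p.a * (1 + C p.E11 * X) * (1 - (1 + p.H2) + C (p.D11 + p.D30) * X * (1 + p.H2))
    + (C p.a * (p.G1 - C p.E11 * X) - 2 * X * p.G2) := by
        rw [xiNum]; linear_combination (C p.a * (1 + C p.E11 * X) + (C p.a * (p.G1 - C p.E11 * X) - 2 * X * p.G2)) * h1
      rw [e1, H2, G1, G2]; simp only [map_add]; ring
    rw [show p.xiNum = p.xiNum * (1 + p.H2) * (1 + p.H2)⁻¹ by linear_combination -p.xiNum * h1, this, mul_assoc]
    exact Dvd.intro _ rfl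
  obtain ⟨A, hA⟩ := this
  rw [xi, sub_add_cancel, hA]
  congr 1
  ext n
  rw [coeff_mk, add_comm n 2, coeff_X_pow_mul' ]; simp

/-- `Ψ = x M Θ` is a formal power series solution of the limiting equation. -/
theorem psi_equation [CharZero 𝕜] (ha : p.a ≠ 0) (Ψ : PowerSeries 𝕜) (hΨ : Ψ = X * p.M * p.theta) :
    (1 + p.H2 + p.G2 * Ψ + p.N2 Ψ) * (-X ^ 2) * derivative 𝕜 Ψ +
      (-2 * X * (1 + p.H2 + p.G2 * Ψ + p.N2 Ψ) - C p.a * (1 + p.G1) + 2 * X * p.G2) * Ψ =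
    X * (C p.a * p.H1 - 2 * (1 + p.H2) + C p.a * p.N1divX Ψ - 2 * p.N2 Ψ) := by
  have h1 : (1 + p.H2) * (1 + p.H2)⁻¹ = 1 := PowerSeries.mul_inv_cancel _ (by rw [constantCoeff_one_add_H2]; simp)
  have hJ : p.M * (1 + p.H2) * (p.M * (1 + p.H2))⁻¹ = 1 := PowerSeries.mul_inv_cancel _ (by
    rw [map_mul, constantCoeff_one_add_H2]; simp [M, mCoeff])
  have hT := p.theta_equation ha
  rw [source, ← hΨ] at hT
  have hd : derivative 𝕜 Ψ = p.M * p.theta + X * derivative 𝕜 p.M * p.theta + X * p.M * derivative 𝕜 p.theta := by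
    rw [hΨ, Derivation.leibniz, Derivation.leibniz, derivative_X]; simp only [smul_eq_mul]; ring
  have hx := p.xi_spec
  have hM := p.derivative_M
  have hn : C p.nu = -C p.a * (C p.D11 + C p.D30 - C p.E11) := by rw [nu]; simp
  have lin : (1 + p.H2) * (X ^ 2) * derivative 𝕜 Ψ + (2 * X * (1 + p.H2) + C p.a * (1 + p.G1) - 2 * X * p.G2) * Ψ = -X * (p.F0 + p.F Ψ) := by
    have e1 : (1 + p.H2) * p.xiNum = C p.a * (1 + C p.E11 * X) * (1 - (1 + p.H2) + C (p.D11 + p.D30) * X * (1 + p.H2))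
    + (C p.a * (p.G1 - C p.E11 * X) - 2 * X * p.G2) := by
        rw [xiNum]; linear_combination (C p.a * (1 + C p.E11 * X) + (C p.a * (p.G1 - C p.E11 * X) - 2 * X * p.G2)) * h1
    rw [← hx] at e1
    rw [hd, hM]
    have e2 : (p.M * (1 + p.H2)) * (X ^ 2 * derivative 𝕜 p.theta + (C p.a + C (p.nu + 3) * X) * p.theta) = -(p.F0 + p.F Ψ) := by
      rw [hT]; linear_combination -(p.F0 + p.F Ψ) * hJ
    have h3 : C (3:𝕜) = (3 : PowerSeries 𝕜) := map_ofNat C 3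
    simp only [map_add, map_mul, h3] at e1 e2
    rw [hn] at e2
    linear_combination X * e2 - X * p.M * p.theta * e1 + (2 * X * (1 + p.H2) + C p.a * (1 + p.G1) - 2 * X * p.G2) * hΨ
  have : p.F Ψ = C p.a * p.N1divX Ψ - 2 * p.N2 Ψ + (p.G2 * Ψ + p.N2 Ψ) * (2 * Ψ + X * derivative 𝕜 Ψ) := rfl
  rw [this, F0] at lin
  linear_combination -lin

end Params

end Generic

/-! The two functions, for a real `ℓ` and, by the same formulas with the principal
determinations of `√ℓ` and `ℓ ^ (1 / 4)`, for a complex `ℓ`. -/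

def starR (d : ℕ) (l : ℝ) : Params ℝ := starParams (d : ℝ) (√(d : ℝ)) l

def plusR (d : ℕ) (l : ℝ) : Params ℝ :=
  plusParams (d : ℝ) (√((d : ℝ) - 1)) l (√l) (l ^ (1 / 4 : ℝ))

def starC (d : ℕ) (z : ℂ) : Params ℂ := starParams (d : ℂ) ((√(d : ℝ) : ℝ) : ℂ) z

def plusC (d : ℕ) (z : ℂ) : Params ℂ :=
  plusParams (d : ℂ) ((√((d : ℝ) - 1) : ℝ) : ℂ) z (z ^ (1 / 2 : ℂ)) (z ^ (1 / 4 : ℂ))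

/-- The general term of the series `S_∞ = (1 / a) ∑ (-1) ^ j a ^ j g_j / Γ(ν + j + 3)`. -/
def termR (p : Params ℝ) (j : ℕ) : ℝ :=
  1 / p.a * ((-1) ^ j * p.a ^ j * p.g j / Real.Gamma (p.nu + j + 3))

/-- The same general term for complex parameters. -/
def termC (p : Params ℂ) (j : ℕ) : ℂ :=
  1 / p.a * ((-1) ^ j * p.a ^ j * p.g j / Complex.Gamma (p.nu + j + 3))

def SStar (d : ℕ) (l : ℝ) : ℝ := ∑' j, termR (starR d l) j

def SPlus (d : ℕ) (l : ℝ) : ℝ := ∑' j, termR (plusR d l) j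

def SStarC (d : ℕ) (z : ℂ) : ℂ := ∑' j, termC (starC d z) j

def SPlusC (d : ℕ) (z : ℂ) : ℂ := ∑' j, termC (plusC d z) j

/-- The set of `ℓ ∈ (0, d)` with `ν^*(d, ℓ) > 0`. -/
def OStar (d : ℕ) : Set ℝ := {l | l ∈ Set.Ioo 0 (d : ℝ) ∧ 0 < (starR d l).nu}

end

end Implosion

/-!
The formal solution `Θ = ∑ θ_k x ^ k` is divergent, and `S_∞` converges thanks to a gain of two
powers of the order. The equation `x² Θ' + [a + (ν + 3) x] Θ = G` reads
`a θ_k = g_k - (k + ν + 2) θ_{k-1}`, so the solutions of its homogeneous part grow like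
`k! k ^ (re ν + 2) / |a| ^ k`. The part of `G` that depends on `Θ` is divisible by `x³` and is of
first order in `x d/dx` (`Params.source_eq`). For coefficients of factorial growth, a factor `x³`
gains three powers of the order and `x d/dx` loses one, so `g_k` is smaller than `θ_k` by two powers
of `k` (`exists_norm_g_le`). Since `1 / Γ(ν + j + 3)` is of size `1 / (j! j ^ (re ν + 2))`, the
general term of `S_∞` is `O(j ^ (-3 / 2))`, with a loss of `1 / 2` in the exponent that pays for
local uniformity in the parameter (`exists_norm_termC_le`).

The growth of `θ_k` is obtained in two rounds. First, the equation is solved by a majorant argument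
with the weights `(L + 1) ⋯ (L + k) / (k + 1)²`: for large `L` the linear part of the recursion has
norm less than `1` and the nonlinearity is as small as desired, because it has to climb three orders
(`exists_norm_coeff_theta_le`). This gives `k! k ^ L / |a| ^ k`. Then the exponent is lowered by `1`
at a time, as the gain on `g_k` permits, until it is any prescribed number above `re ν + 2`
(`weightBound_theta`). All bounds are stated for families of parameters, eventually along a filter,
so they are locally uniform from the outset.

Each `g_k` is obtained from the renormalized coefficients by finitely many algebraic operations and
is therefore holomorphic (`differentiableAt_g`), `1 / Γ` is entire, and a locally uniformly
convergent series of holomorphic functions is holomorphic (`summable_and_differentiableOn`). The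
renormalized coefficients are holomorphic where the quantities `d̃₂₀`, `ẽ₂₀`, `c₊ - c₋`, `λ₋`, `μ₊`,
`ℓ` by which one divides do not vanish. These factor explicitly. For the family `+` they have no
zero in the slit plane except `ℓ = d`. For the family `*` they are rational in `ℓ` without zeros or
poles in `(0, d)`. Finally, every construction commutes with the embedding of `ℝ` into `ℂ`, so the
real sum is the complex one at real parameters (`summable_and_tsum_of_complex`).
-/

namespace Implosion

open PowerSeries Filter Topology

noncomputable section

variable {ι : Type}

/-! ### Families of power series and the shape of the nonlinearity -/

/-- A class of families of complex power series, indexed by `ι`, that is closed under the ring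
operations and contains the constant polynomial families `z` and `X`. -/
structure SeriesClass (𝒞 : (ι → PowerSeries ℂ) → Prop) : Prop where
  add : ∀ {f g : ι → PowerSeries ℂ}, 𝒞 f → 𝒞 g → 𝒞 (fun i => f i + g i)
  mul : ∀ {f g : ι → PowerSeries ℂ}, 𝒞 f → 𝒞 g → 𝒞 (fun i => f i * g i)
  neg : ∀ {f : ι → PowerSeries ℂ}, 𝒞 f → 𝒞 (fun i => -f i)
  C : ∀ z : ℂ, 𝒞 (fun _ => PowerSeries.C z)
  X : 𝒞 (fun _ => PowerSeries.X)

/-- A `SeriesClass` that is moreover closed under all the operations by which the coefficients of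
the equation for `Θ` are built, in particular under the passage from `ξ` to `M = exp (-∫ ξ)`. -/
structure CoeffClass (𝒞 : (ι → PowerSeries ℂ) → Prop) : Prop extends SeriesClass 𝒞 where
  inv : ∀ {f : ι → PowerSeries ℂ}, (∀ i, constantCoeff (f i) = 1) → 𝒞 f → 𝒞 (fun i => (f i)⁻¹)
  tail : ∀ {f : ι → PowerSeries ℂ}, 𝒞 f → 𝒞 (fun i => PowerSeries.mk fun n => coeff (n + 2) (f i))
  deriv : ∀ {f : ι → PowerSeries ℂ}, 𝒞 f → 𝒞 (fun i => derivative ℂ (f i))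
  exp : ∀ {p : ι → Params ℂ}, 𝒞 (fun i => (p i).xi) → 𝒞 (fun i => (p i).M)

namespace SeriesClass

variable {𝒞 : (ι → PowerSeries ℂ) → Prop} (h : SeriesClass 𝒞)

include h

theorem sub {f g : ι → PowerSeries ℂ} (hf : 𝒞 f) (hg : 𝒞 g) : 𝒞 (fun i => f i - g i) := by
  simp only [sub_eq_add_neg]
  exact h.add hf (h.neg hg)

theorem pow {f : ι → PowerSeries ℂ} (hf : 𝒞 f) (n : ℕ) : 𝒞 (fun i => f i ^ n) := by
  induction n with
  | zero => simpa using h.C 1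
  | succ n ih => simpa only [pow_succ] using h.mul ih hf

theorem one : 𝒞 (fun _ => 1) := by simpa using h.C 1

theorem ofNat (n : ℕ) [n.AtLeastTwo] : 𝒞 (fun _ => (OfNat.ofNat n : PowerSeries ℂ)) := by
  simpa only [map_ofNat] using h.C (OfNat.ofNat n)

theorem C_add {c e : ι → ℂ} (hc : 𝒞 (fun i => PowerSeries.C (c i)))
    (he : 𝒞 (fun i => PowerSeries.C (e i))) : 𝒞 (fun i => PowerSeries.C (c i + e i)) := by
  simp only [map_add]
  exact h.add hc he

theorem C_mul {c e : ι → ℂ} (hc : 𝒞 (fun i => PowerSeries.C (c i)))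
    (he : 𝒞 (fun i => PowerSeries.C (e i))) : 𝒞 (fun i => PowerSeries.C (c i * e i)) := by
  simp only [map_mul]
  exact h.mul hc he

theorem C_neg {c : ι → ℂ} (hc : 𝒞 (fun i => PowerSeries.C (c i))) :
    𝒞 (fun i => PowerSeries.C (-c i)) := by
  simp only [map_neg]
  exact h.neg hc

end SeriesClass

/-- The renormalized coefficients of the limiting equation, as constant series, belong to `𝒞`. -/
structure ScalarsIn (𝒞 : (ι → PowerSeries ℂ) → Prop) (p : ι → Params ℂ) : Prop where
  D11 : 𝒞 fun i => C (p i).D11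
  D02 : 𝒞 fun i => C (p i).D02
  D30 : 𝒞 fun i => C (p i).D30
  D21 : 𝒞 fun i => C (p i).D21
  D12 : 𝒞 fun i => C (p i).D12
  D03 : 𝒞 fun i => C (p i).D03
  E11 : 𝒞 fun i => C (p i).E11
  E02 : 𝒞 fun i => C (p i).E02
  E30 : 𝒞 fun i => C (p i).E30
  E21 : 𝒞 fun i => C (p i).E21
  E12 : 𝒞 fun i => C (p i).E12
  E03 : 𝒞 fun i => C (p i).E03
  a : 𝒞 fun i => C (p i).a
  nu : 𝒞 fun i => C (p i).nu

namespace Params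

variable {𝕜 : Type} [Field 𝕜] (p : Params 𝕜)

/-- The inverse of the integrating factor `M (1 + H₂)`. -/
def J : PowerSeries 𝕜 := (p.M * (1 + p.H2))⁻¹

/-- The part of `source` that does not depend on `Θ`. -/
def source0 : PowerSeries 𝕜 := -p.F0 * p.J

/-- `M₁₁ / x`. -/
def m11 : PowerSeries 𝕜 := -C p.E02 + C p.E12 * X - C (3 * p.E03) * X ^ 2

/-- `M₂₁ / x`. -/
def m21 : PowerSeries 𝕜 := C p.D02 - C p.D12 * X + C (3 * p.D03) * X ^ 2

/-- `G₂ / x`. -/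
def g2 : PowerSeries 𝕜 :=
  -C p.D11 + C (2 * p.D02 + p.D21) * X - C (2 * p.D12) * X ^ 2 + C (3 * p.D03) * X ^ 3

/-- `(G₂ Ψ + N₂) / x²`, in terms of `P = M Θ = Ψ / x`. -/
def V (P : PowerSeries 𝕜) : PowerSeries 𝕜 :=
  p.g2 * P - X ^ 2 * p.m21 * P ^ 2 + X ^ 5 * C p.D03 * P ^ 3

/-- The part of the nonlinearity, divided by `x³`, that does not contain the derivative of `Θ`. -/
def R0 (T : PowerSeries 𝕜) : PowerSeries 𝕜 :=
  -p.J * (C p.a * (-(p.m11 * (p.M * T) ^ 2) - X ^ 3 * C p.E03 * (p.M * T) ^ 3)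
    - 2 * X * (-(p.m21 * (p.M * T) ^ 2) + X ^ 3 * C p.D03 * (p.M * T) ^ 3)
    + p.V (p.M * T) * (3 * (p.M * T) + X * derivative 𝕜 p.M * T))

/-- The coefficient of `x Θ'` in the nonlinearity divided by `x³`. -/
def R1 (T : PowerSeries 𝕜) : PowerSeries 𝕜 := -p.J * p.V (p.M * T) * p.M

/-- The nonlinearity is divisible by `x³`, and it is of first order in the derivative of `Θ`.
The factor `x³` is what makes the series defining `S_∞` converge. -/
theorem source_eq (T : PowerSeries 𝕜) :
    p.source T = p.source0 + X ^ 3 * (p.R0 T + p.R1 T * (X * derivative 𝕜 T)) := by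
  have hd : derivative 𝕜 (X * p.M * T) =
      p.M * T + X * derivative 𝕜 p.M * T + X * p.M * derivative 𝕜 T := by
    rw [Derivation.leibniz, Derivation.leibniz, derivative_X]
    simp only [smul_eq_mul]
    ring
  rw [source, F, hd, source0, R0, R1, N1divX, N2, V, J, M11, M12, M21, M22, G2, m11, m21, g2]
  ring

theorem constantCoeff_M : constantCoeff p.M = 1 := by
  simp [M, mCoeff]

theorem constantCoeff_M_mul : constantCoeff (p.M * (1 + p.H2)) = 1 := by
  rw [map_mul, constantCoeff_one_add_H2, constantCoeff_M, mul_one]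

end Params

namespace ScalarsIn

variable {𝒞 : (ι → PowerSeries ℂ) → Prop} {p : ι → Params ℂ} (hp : ScalarsIn 𝒞 p)

include hp

section Ring

variable (h : SeriesClass 𝒞)

include h

theorem H1 : 𝒞 fun i => (p i).H1 := by
  have h0 := hp.E11; have h1 := hp.E30; have h2 := hp.E02; have h3 := hp.E21
  have h4 := hp.E12; have h5 := hp.E03
  unfold Params.H1
  repeat' first | assumption | exact h.C _ | exact h.X | apply h.C_neg | apply h.C_add |
    apply h.C_mul | apply h.add | apply h.sub | apply h.mul

theorem H2 : 𝒞 fun i => (p i).H2 := by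
  have h0 := hp.D11; have h1 := hp.D30; have h2 := hp.D02; have h3 := hp.D21
  have h4 := hp.D12; have h5 := hp.D03
  unfold Params.H2
  repeat' first | assumption | exact h.C _ | exact h.X | apply h.C_neg | apply h.C_add |
    apply h.C_mul | apply h.add | apply h.sub | apply h.mul

theorem G1 : 𝒞 fun i => (p i).G1 := by
  have h0 := hp.E11; have h2 := hp.E02; have h3 := hp.E21
  have h4 := hp.E12; have h5 := hp.E03
  unfold Params.G1
  repeat' first | assumption | exact h.C _ | exact h.X | apply h.C_neg | apply h.C_add |
    apply h.C_mul | apply h.add | apply h.sub | apply h.mul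

theorem g2 : 𝒞 fun i => (p i).g2 := by
  have h0 := hp.D11; have h2 := hp.D02; have h3 := hp.D21
  have h4 := hp.D12; have h5 := hp.D03
  unfold Params.g2
  repeat' first | assumption | exact h.C _ | exact h.X | apply h.C_neg | apply h.C_add |
    apply h.C_mul | apply h.add | apply h.sub | apply h.mul | apply h.pow | apply h.neg

theorem G2 : 𝒞 fun i => (p i).G2 := by
  have : ∀ i, (p i).G2 = PowerSeries.X * (p i).g2 := by
    intro i
    rw [Params.G2, Params.g2]
    ring
  simp only [this]
  exact h.mul h.X (hp.g2 h)

theorem m11 : 𝒞 fun i => (p i).m11 := by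
  have h2 := hp.E02; have h4 := hp.E12; have h5 := hp.E03
  unfold Params.m11
  repeat' first | assumption | exact h.C _ | exact h.X | apply h.C_neg | apply h.C_add |
    apply h.C_mul | apply h.add | apply h.sub | apply h.mul | apply h.pow | apply h.neg

theorem m21 : 𝒞 fun i => (p i).m21 := by
  have h2 := hp.D02; have h4 := hp.D12; have h5 := hp.D03
  unfold Params.m21
  repeat' first | assumption | exact h.C _ | exact h.X | apply h.C_neg | apply h.C_add |
    apply h.C_mul | apply h.add | apply h.sub | apply h.mul

theorem F0 : 𝒞 fun i => (p i).F0 :=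
  h.sub (h.mul hp.a (hp.H1 h)) (h.mul (h.ofNat 2) (h.add h.one (hp.H2 h)))

theorem V {P : ι → PowerSeries ℂ} (hP : 𝒞 P) : 𝒞 fun i => (p i).V (P i) :=
  h.add (h.sub (h.mul (hp.g2 h) hP) (h.mul (h.mul (h.pow h.X 2) (hp.m21 h)) (h.pow hP 2)))
    (h.mul (h.mul (h.pow h.X 5) hp.D03) (h.pow hP 3))

theorem R0 (hJ : 𝒞 fun i => (p i).J) (hM : 𝒞 fun i => (p i).M)
    (hM' : 𝒞 fun i => derivative ℂ (p i).M) {T : ι → PowerSeries ℂ} (hT : 𝒞 T) :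
    𝒞 fun i => (p i).R0 (T i) := by
  have hP := h.mul hM hT
  have hV := hp.V h hP
  have h1 := hp.m11 h
  have h2 := hp.m21 h
  exact h.mul (h.neg hJ) (h.add (h.sub (h.mul hp.a (h.sub (h.neg (h.mul h1 (h.pow hP 2)))
    (h.mul (h.mul (h.pow h.X 3) hp.E03) (h.pow hP 3))))
    (h.mul (h.mul (h.ofNat 2) h.X) (h.add (h.neg (h.mul h2 (h.pow hP 2)))
      (h.mul (h.mul (h.pow h.X 3) hp.D03) (h.pow hP 3)))))
    (h.mul hV (h.add (h.mul (h.ofNat 3) hP) (h.mul (h.mul h.X hM') hT))))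

theorem R1 (hJ : 𝒞 fun i => (p i).J) (hM : 𝒞 fun i => (p i).M)
    {T : ι → PowerSeries ℂ} (hT : 𝒞 T) : 𝒞 fun i => (p i).R1 (T i) :=
  h.mul (h.mul (h.neg hJ) (hp.V h (h.mul hM hT))) hM

end Ring

variable (h : CoeffClass 𝒞)

include h

theorem xi : 𝒞 fun i => (p i).xi := by
  have h' := h.toSeriesClass
  have hI : 𝒞 fun i => (1 + (p i).H2)⁻¹ :=
    h.inv (fun i => (p i).constantCoeff_one_add_H2) (h.add h'.one (hp.H2 h'))
  have hD := h'.C_add hp.D11 hp.D30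
  refine h'.sub (h.tail ?_) (h'.C_mul (h'.C_mul hp.a hp.E11) hD)
  exact h.add (h.mul (h.mul hp.a (h.add h'.one (h.mul hp.E11 h.X)))
    (h.add (h'.sub hI h'.one) (h.mul hD h.X)))
    (h.mul (h'.sub (h.mul hp.a (h'.sub (hp.G1 h') (h.mul hp.E11 h.X)))
      (h.mul (h.mul (h'.ofNat 2) h.X) (hp.G2 h'))) hI)

theorem M : 𝒞 fun i => (p i).M := h.exp (hp.xi h)

theorem J : 𝒞 fun i => (p i).J :=
  h.inv (fun i => (p i).constantCoeff_M_mul)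
    (h.mul (hp.M h) (h.add h.toSeriesClass.one (hp.H2 h.toSeriesClass)))

theorem source0 : 𝒞 fun i => (p i).source0 := h.mul (h.neg (hp.F0 h.toSeriesClass)) (hp.J h)

theorem source {T : ι → PowerSeries ℂ} (hT : 𝒞 T) : 𝒞 fun i => (p i).source (T i) := by
  have h' := h.toSeriesClass
  simp only [Params.source_eq]
  exact h.add (hp.source0 h) (h.mul (h'.pow h.X 3)
    (h.add (hp.R0 h' (hp.J h) (hp.M h) (h.deriv (hp.M h)) hT)
      (h.mul (hp.R1 h' (hp.J h) (hp.M h) hT) (h.mul h.X (h.deriv hT)))))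

theorem step (ha : 𝒞 fun i => C (p i).a⁻¹) {T : ι → PowerSeries ℂ} (hT : 𝒞 T) :
    𝒞 fun i => (p i).step (T i) := by
  have h' := h.toSeriesClass
  exact h.mul ha (h'.sub (h'.sub (hp.source h hT) (h.mul (h'.pow h.X 2) (h.deriv hT)))
    (h.mul (h.mul (h'.C_add hp.nu (h.C 3)) h.X) hT))

end ScalarsIn

/-! ### Geometric growth and holomorphic dependence of the coefficients -/

/-- The coefficients grow at most geometrically, uniformly for `i` eventually along `l`. -/
def GeoBound (l : Filter ι) (f : ι → PowerSeries ℂ) : Prop :=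
  ∃ B : ℝ, 1 ≤ B ∧ ∀ᶠ i in l, ∀ k, ‖coeff k (f i)‖ ≤ B ^ (k + 1)

theorem GeoBound.C {l : Filter ι} {c : ι → ℂ} (hc : ∃ B : ℝ, ∀ᶠ i in l, ‖c i‖ ≤ B) :
    GeoBound l fun i => C (c i) := by
  obtain ⟨B, hB⟩ := hc
  refine ⟨max B 1, le_max_right _ _, hB.mono fun i hi k => ?_⟩
  rw [coeff_C]
  split_ifs with hk
  · subst hk
    simp [hi]
  · simp

theorem add_one_le_two_pow (k : ℕ) : (k : ℝ) + 1 ≤ 2 ^ k := by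
  exact_mod_cast Nat.lt_two_pow_self (n := k)

theorem norm_coeff_mul_le (f g : PowerSeries ℂ) (n : ℕ) :
    ‖coeff n (f * g)‖ ≤
      ∑ x ∈ Finset.HasAntidiagonal.antidiagonal n, ‖coeff x.1 f‖ * ‖coeff x.2 g‖ := by
  rw [coeff_mul]
  exact (norm_sum_le _ _).trans_eq (Finset.sum_congr rfl fun x _ => norm_mul _ _)

theorem geoBound_seriesClass (l : Filter ι) : SeriesClass (GeoBound l) where
  add := by
    rintro f g ⟨B, hB, hf⟩ ⟨D, hD, hg⟩
    refine ⟨B + D, by linarith, ?_⟩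
    filter_upwards [hf, hg] with i hf hg k
    rw [map_add]
    calc _ ≤ B ^ (k + 1) + D ^ (k + 1) := (norm_add_le _ _).trans (add_le_add (hf k) (hg k))
      _ ≤ (B + D) ^ (k + 1) := pow_add_pow_le (by linarith) (by linarith) (by simp)
  mul := by
    rintro f g ⟨B, hB, hf⟩ ⟨D, hD, hg⟩
    set m := max B D
    have hm : 1 ≤ m := hB.trans (le_max_left _ _)
    refine ⟨2 * m ^ 2, by nlinarith, ?_⟩
    filter_upwards [hf, hg] with i hf hg k
    calc _ ≤ ∑ x ∈ Finset.HasAntidiagonal.antidiagonal k, ‖coeff x.1 (f i)‖ * ‖coeff x.2 (g i)‖ :=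
          norm_coeff_mul_le _ _ _
      _ ≤ ∑ x ∈ Finset.HasAntidiagonal.antidiagonal k, m ^ (k + 2) := by
          refine Finset.sum_le_sum fun x hx => ?_
          rw [Finset.HasAntidiagonal.mem_antidiagonal] at hx
          calc _ ≤ m ^ (x.1 + 1) * m ^ (x.2 + 1) := by
                refine mul_le_mul ((hf _).trans ?_) ((hg _).trans ?_) (norm_nonneg _)
                  (by positivity)
                · exact pow_le_pow_left₀ (by linarith) (le_max_left _ _) _
                · exact pow_le_pow_left₀ (by linarith) (le_max_right _ _) _
            _ = m ^ (k + 2) := by rw [← pow_add, ← hx]; congr 1; ring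
      _ = ((k : ℝ) + 1) * m ^ (k + 2) := by simp
      _ ≤ 2 ^ (k + 1) * m ^ (2 * (k + 1)) := by
          refine mul_le_mul ((add_one_le_two_pow k).trans ?_) ?_ (by positivity) (by positivity)
          · exact pow_le_pow_right₀ (by norm_num) (by lia)
          · exact pow_le_pow_right₀ hm (by lia)
      _ = (2 * m ^ 2) ^ (k + 1) := by rw [mul_pow, pow_mul]
  neg := by
    rintro f ⟨B, hB, hf⟩
    exact ⟨B, hB, by simpa using hf⟩
  C := fun z => GeoBound.C ⟨‖z‖, Eventually.of_forall fun _ => le_rfl⟩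
  X := by
    refine ⟨1, le_rfl, Eventually.of_forall fun i k => ?_⟩
    rw [coeff_X]
    split_ifs <;> simp

theorem norm_coeff_inv_le {f : PowerSeries ℂ} (h1 : constantCoeff f = 1) {B : ℝ} (hB : 1 ≤ B)
    (hf : ∀ k, ‖coeff k f‖ ≤ B ^ (k + 1)) (n : ℕ) : ‖coeff n f⁻¹‖ ≤ (2 * B ^ 2) ^ n := by
  induction n using Nat.strong_induction_on with
  | _ n ih =>
    rcases Nat.eq_zero_or_pos n with rfl | hn
    · simp [coeff_inv, h1]
    rw [coeff_inv, if_neg hn.ne', h1, inv_one, neg_mul, one_mul, norm_neg]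
    have hB2 : ∀ j : ℕ, 0 < j → B ^ (j + 1) ≤ (B ^ 2) ^ j := fun j hj => by
      rw [← pow_mul]
      exact pow_le_pow_right₀ hB (by lia)
    calc _ ≤ ∑ x ∈ Finset.HasAntidiagonal.antidiagonal n,
          if x.2 < n then (B ^ 2) ^ n * 2 ^ x.2 else 0 := by
          refine (norm_sum_le _ _).trans (Finset.sum_le_sum fun x hx => ?_)
          rw [Finset.HasAntidiagonal.mem_antidiagonal] at hx
          split_ifs with hlt
          · rw [norm_mul]
            calc _ ≤ (B ^ 2) ^ x.1 * (2 * B ^ 2) ^ x.2 :=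
                  mul_le_mul ((hf _).trans (hB2 _ (by lia))) (ih _ hlt) (norm_nonneg _)
                    (by positivity)
              _ = (B ^ 2) ^ n * 2 ^ x.2 := by rw [← hx, mul_pow, pow_add]; ring
          · simp
      _ = ∑ j ∈ Finset.range n, (B ^ 2) ^ n * 2 ^ j := by
          rw [← Finset.Nat.sum_antidiagonal_swap, Finset.Nat.sum_antidiagonal_eq_sum_range_succ_mk,
            Finset.sum_range_succ]
          simp only [Prod.snd_swap, lt_irrefl, if_false, add_zero]
          exact Finset.sum_congr rfl fun j hj => if_pos (Finset.mem_range.1 hj)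
      _ = (B ^ 2) ^ n * (2 ^ n - 1) := by
          rw [← Finset.mul_sum, geom_sum_eq (by norm_num)]
          norm_num
      _ ≤ (2 * B ^ 2) ^ n := by
          rw [mul_pow, mul_comm]
          exact mul_le_mul_of_nonneg_right (by linarith) (by positivity)

theorem Params.norm_mCoeff_le {p : Params ℂ} {B : ℝ} (hB : 1 ≤ B)
    (hf : ∀ k, ‖coeff k p.xi‖ ≤ B ^ (k + 1)) (n : ℕ) : ‖p.mCoeff n‖ ≤ B ^ n := by
  induction n using Nat.strong_induction_on with
  | _ n ih =>
    rcases n with _ | n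
    · simp [mCoeff]
    have hn : ‖(n : ℂ) + 1‖ = (n : ℝ) + 1 := by
      exact_mod_cast Complex.norm_natCast (n + 1)
    rw [mCoeff, norm_div, norm_neg, hn, div_le_iff₀ (by positivity)]
    calc _ ≤ ∑ i : Fin (n + 1), B ^ (n + 1) := by
          refine (norm_sum_le _ _).trans (Finset.sum_le_sum fun i _ => ?_)
          rw [norm_mul]
          calc _ ≤ B ^ (n - i + 1) * B ^ (i : ℕ) :=
                mul_le_mul (hf _) (ih _ i.2) (norm_nonneg _) (by positivity)
            _ = B ^ (n + 1) := by
                rw [← pow_add]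
                congr 1
                have := i.2
                lia
      _ = _ := by simp [mul_comm]

theorem geoBound_coeffClass (l : Filter ι) : CoeffClass (GeoBound l) where
  toSeriesClass := geoBound_seriesClass l
  inv := by
    rintro f h1 ⟨B, hB, hf⟩
    have h2 : 1 ≤ 2 * B ^ 2 := by nlinarith
    refine ⟨2 * B ^ 2, h2, hf.mono fun i hi k => (norm_coeff_inv_le (h1 i) hB hi k).trans ?_⟩
    exact pow_le_pow_right₀ h2 (by lia)
  tail := by
    rintro f ⟨B, hB, hf⟩
    refine ⟨B ^ 3, one_le_pow₀ hB, hf.mono fun i hi k => ?_⟩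
    rw [coeff_mk, ← pow_mul]
    exact (hi _).trans (pow_le_pow_right₀ hB (by lia))
  deriv := by
    rintro f ⟨B, hB, hf⟩
    refine ⟨2 * B ^ 2, by nlinarith, hf.mono fun i hi k => ?_⟩
    have hn : ‖(k : ℂ) + 1‖ = (k : ℝ) + 1 := by
      exact_mod_cast Complex.norm_natCast (k + 1)
    rw [coeff_derivative, norm_mul, hn, mul_comm, mul_pow, ← pow_mul]
    refine mul_le_mul ((add_one_le_two_pow k).trans ?_) ((hi _).trans ?_) (norm_nonneg _)
      (by positivity)
    · exact pow_le_pow_right₀ (by norm_num) (by lia)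
    · exact pow_le_pow_right₀ hB (by lia)
  exp := by
    rintro p ⟨B, hB, hf⟩
    refine ⟨B, hB, hf.mono fun i hi k => ?_⟩
    change ‖coeff k (PowerSeries.mk (p i).mCoeff)‖ ≤ _
    rw [coeff_mk]
    exact (Params.norm_mCoeff_le hB hi k).trans (pow_le_pow_right₀ hB (by lia))

/-- Every coefficient depends on the parameter in a complex differentiable way at `z₀`. -/
def HolAt (z₀ : ℂ) (f : ℂ → PowerSeries ℂ) : Prop :=
  ∀ k, DifferentiableAt ℂ (fun z => coeff k (f z)) z₀

theorem HolAt.C {z₀ : ℂ} {c : ℂ → ℂ} (hc : DifferentiableAt ℂ c z₀) :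
    HolAt z₀ fun z => C (c z) := by
  intro k
  simp only [coeff_C]
  split_ifs
  · exact hc
  · exact differentiableAt_const _

theorem holAt_seriesClass (z₀ : ℂ) : SeriesClass (HolAt z₀) where
  add := fun hf hg k => by simpa only [map_add] using (hf k).fun_add (hg k)
  mul := fun hf hg k => by
    simp only [coeff_mul]
    exact DifferentiableAt.fun_sum fun x _ => (hf x.1).fun_mul (hg x.2)
  neg := fun hf k => by simpa only [map_neg] using (hf k).fun_neg
  C := fun z => HolAt.C (differentiableAt_const z)
  X := fun k => differentiableAt_const _

theorem holAt_coeffClass (z₀ : ℂ) : CoeffClass (HolAt z₀) where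
  toSeriesClass := holAt_seriesClass z₀
  inv := by
    intro f h1 hf n
    induction n using Nat.strong_induction_on with
    | _ n ih =>
      conv in coeff n _ => rw [coeff_inv, h1, inv_one, neg_mul, one_mul]
      split_ifs with hn
      · exact differentiableAt_const _
      · refine (DifferentiableAt.fun_sum fun x _ => ?_).fun_neg
        split_ifs with hx
        · exact (hf x.1).fun_mul (ih x.2 hx)
        · exact differentiableAt_const _
  tail := fun hf k => by simpa only [coeff_mk] using hf (k + 2)
  deriv := fun hf k => by
    simpa only [coeff_derivative] using (hf (k + 1)).fun_mul (differentiableAt_const _)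
  exp := by
    intro p hf n
    simp only [Params.M, coeff_mk]
    induction n using Nat.strong_induction_on with
    | _ n ih =>
      rcases n with _ | n
      · simp [Params.mCoeff]
      · simp only [Params.mCoeff]
        exact (DifferentiableAt.fun_sum fun i _ => (hf _).fun_mul (ih _ i.2)).fun_neg.div_const _

/-- The coefficients `g_k` depend holomorphically on the parameters. -/
theorem differentiableAt_g {p : ℂ → Params ℂ} {z₀ : ℂ} (hp : ScalarsIn (HolAt z₀) p)
    (ha : DifferentiableAt ℂ (fun z => (p z).a⁻¹) z₀) (k : ℕ) :
    DifferentiableAt ℂ (fun z => (p z).g k) z₀ := by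
  have h := holAt_coeffClass z₀
  have hstep : ∀ n, HolAt z₀ fun z => (p z).step^[n] 0 := by
    intro n
    induction n with
    | zero => simpa using h.C 0
    | succ n ih =>
      simp only [Function.iterate_succ_apply']
      exact hp.step h (HolAt.C ha) ih
  have hθ : HolAt z₀ fun z => (p z).theta := fun k => by
    simpa only [Params.theta, coeff_mk] using hstep (k + 1) k
  exact hp.source h hθ k

/-! ### Weighted bounds and the recursion for `Θ` -/

/-- The coefficient of order `k`, multiplied by `α ^ k`, is `O(ω k)`, uniformly for `i` eventually
along `l`. -/
def WeightBound (l : Filter ι) (α : ι → ℝ) (ω : ι → ℕ → ℝ) (f : ι → PowerSeries ℂ) : Prop :=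
  ∃ C : ℝ, 0 ≤ C ∧ ∀ᶠ i in l, ∀ k, ‖coeff k (f i)‖ * α i ^ k ≤ C * ω i k

/-- The conditions on the weights under which `WeightBound` defines a class of families of series
that is closed under multiplication and contains the series with geometric growth. -/
structure IsWeight (l : Filter ι) (α : ι → ℝ) (ω : ι → ℕ → ℝ) : Prop where
  nonneg : ∀ i, 0 ≤ α i
  weight_nonneg : ∀ i k, 0 ≤ ω i k
  conv : ∃ K : ℝ, 0 ≤ K ∧ ∀ᶠ i in l, ∀ n,
    ∑ x ∈ Finset.HasAntidiagonal.antidiagonal n, ω i x.1 * ω i x.2 ≤ K * ω i n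
  geom : ∀ B : ℝ, 1 ≤ B → ∃ C : ℝ, 0 ≤ C ∧ ∀ᶠ i in l, ∀ k, (B * α i) ^ k ≤ C * ω i k

namespace IsWeight

variable {l : Filter ι} {α : ι → ℝ} {ω : ι → ℕ → ℝ} (hω : IsWeight l α ω)

include hω

theorem of_geoBound {f : ι → PowerSeries ℂ} (hf : GeoBound l f) : WeightBound l α ω f := by
  obtain ⟨B, hB, hf⟩ := hf
  obtain ⟨C, hC, hg⟩ := hω.geom B hB
  refine ⟨B * C, by positivity, ?_⟩
  filter_upwards [hf, hg] with i hf hg k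
  calc _ ≤ B ^ (k + 1) * α i ^ k :=
        mul_le_mul_of_nonneg_right (hf k) (pow_nonneg (hω.nonneg i) k)
    _ = B * (B * α i) ^ k := by rw [mul_pow]; ring
    _ ≤ B * (C * ω i k) := mul_le_mul_of_nonneg_left (hg k) (by linarith)
    _ = _ := by ring

/-- If the coefficients of `f` and `g` are bounded in terms of the weights `ω` and `m ω`, where `m`
is nondecreasing in the order, then so are those of `f g` in terms of `m ω`. -/
theorem norm_coeff_mul_le_of_monotone {i : ι} {K C D : ℝ} (hC : 0 ≤ C) (hD : 0 ≤ D) {m : ℕ → ℝ}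
    (hm : Monotone m) {f g : PowerSeries ℂ}
    (hK : ∀ n, ∑ x ∈ Finset.HasAntidiagonal.antidiagonal n, ω i x.1 * ω i x.2 ≤ K * ω i n)
    (hm0 : ∀ n, 0 ≤ m n)
    (hf : ∀ k, ‖coeff k f‖ * α i ^ k ≤ C * ω i k)
    (hg : ∀ k, ‖coeff k g‖ * α i ^ k ≤ D * (m k * ω i k)) (n : ℕ) :
    ‖coeff n (f * g)‖ * α i ^ n ≤ C * D * K * (m n * ω i n) := by
  calc _ ≤ (∑ x ∈ Finset.HasAntidiagonal.antidiagonal n, ‖coeff x.1 f‖ * ‖coeff x.2 g‖) * α i ^ n :=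
        mul_le_mul_of_nonneg_right (norm_coeff_mul_le _ _ _) (pow_nonneg (hω.nonneg i) n)
    _ ≤ ∑ x ∈ Finset.HasAntidiagonal.antidiagonal n, C * D * m n * (ω i x.1 * ω i x.2) := by
        rw [Finset.sum_mul]
        refine Finset.sum_le_sum fun x hx => ?_
        rw [Finset.HasAntidiagonal.mem_antidiagonal] at hx
        calc _ = (‖coeff x.1 f‖ * α i ^ x.1) * (‖coeff x.2 g‖ * α i ^ x.2) := by
              rw [← hx, pow_add]
              ring
          _ ≤ (C * ω i x.1) * (D * (m x.2 * ω i x.2)) :=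
              mul_le_mul (hf _) (hg _)
                (mul_nonneg (norm_nonneg _) (pow_nonneg (hω.nonneg i) _))
                (mul_nonneg hC (hω.weight_nonneg i _))
          _ ≤ (C * ω i x.1) * (D * (m n * ω i x.2)) := by
              have h1 := hω.weight_nonneg i x.1
              have h2 := hω.weight_nonneg i x.2
              have h3 : m x.2 ≤ m n := hm (by lia)
              gcongr
          _ = _ := by ring
    _ = C * D * m n * ∑ x ∈ Finset.HasAntidiagonal.antidiagonal n, ω i x.1 * ω i x.2 := by
        rw [Finset.mul_sum]
    _ ≤ C * D * m n * (K * ω i n) :=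
        mul_le_mul_of_nonneg_left (hK n) (mul_nonneg (mul_nonneg hC hD) (hm0 n))
    _ = _ := by ring

theorem seriesClass : SeriesClass (WeightBound l α ω) where
  add := by
    rintro f g ⟨C, hC, hf⟩ ⟨D, hD, hg⟩
    refine ⟨C + D, by linarith, ?_⟩
    filter_upwards [hf, hg] with i hf hg k
    rw [map_add]
    calc _ ≤ (‖coeff k (f i)‖ + ‖coeff k (g i)‖) * α i ^ k :=
          mul_le_mul_of_nonneg_right (norm_add_le _ _) (pow_nonneg (hω.nonneg i) k)
      _ ≤ _ := by linarith [hf k, hg k]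
  mul := by
    rintro f g ⟨C, hC, hf⟩ ⟨D, hD, hg⟩
    obtain ⟨K, hK0, hK⟩ := hω.conv
    refine ⟨C * D * K, by positivity, ?_⟩
    filter_upwards [hf, hg, hK] with i hf hg hK k
    simpa using hω.norm_coeff_mul_le_of_monotone hC hD (m := fun _ => 1) monotone_const hK
      (by simp) hf (by simpa using hg) k
  neg := by
    rintro f ⟨C, hC, hf⟩
    exact ⟨C, hC, by simpa using hf⟩
  C := fun z => hω.of_geoBound ((geoBound_seriesClass l).C z)
  X := hω.of_geoBound (geoBound_seriesClass l).X

end IsWeight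

theorem ScalarsIn.imp {𝒞 : (ι → PowerSeries ℂ) → Prop} {κ : Type} {𝒟 : (κ → PowerSeries ℂ) → Prop}
    {p : ι → Params ℂ} (φ : κ → ι) (h : ∀ f : ι → PowerSeries ℂ, 𝒞 f → 𝒟 fun k => f (φ k))
    (hp : ScalarsIn 𝒞 p) : ScalarsIn 𝒟 fun k => p (φ k) :=
  ⟨h _ hp.D11, h _ hp.D02, h _ hp.D30, h _ hp.D21, h _ hp.D12, h _ hp.D03, h _ hp.E11, h _ hp.E02,
    h _ hp.E30, h _ hp.E21, h _ hp.E12, h _ hp.E03, h _ hp.a, h _ hp.nu⟩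

namespace Params

variable {𝕜 : Type} [Field 𝕜] (p : Params 𝕜)

/-- The nonlinear part of `source`, divided by `x³`. -/
def Q (T : PowerSeries 𝕜) : PowerSeries 𝕜 := p.R0 T + p.R1 T * (X * derivative 𝕜 T)

theorem coeff_source_of_lt {n : ℕ} (hn : n < 3) (T : PowerSeries 𝕜) :
    coeff n (p.source T) = coeff n p.source0 := by
  rw [source_eq, map_add, coeff_X_pow_mul', if_neg (by lia), add_zero]

theorem coeff_source_add_three (n : ℕ) (T : PowerSeries 𝕜) :
    coeff (n + 3) (p.source T) = coeff (n + 3) p.source0 + coeff n (p.Q T) := by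
  rw [source_eq, map_add, add_comm n 3, coeff_X_pow_mul', if_pos (by lia), Nat.add_sub_cancel_left,
    Q]

end Params

theorem coeff_X_mul_derivative {𝕜 : Type} [Field 𝕜] (T : PowerSeries 𝕜) (k : ℕ) :
    coeff k (X * derivative 𝕜 T) = k * coeff k T := by
  rcases k with _ | k
  · simp
  · rw [coeff_succ_X_mul, coeff_derivative]
    push_cast
    ring

/-- The derivative in the nonlinearity costs one factor `k`. -/
theorem norm_coeff_Q_le {l : Filter ι} {α : ι → ℝ} {ω : ι → ℕ → ℝ} (hω : IsWeight l α ω)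
    {p : ι → Params ℂ} (hp : ScalarsIn (GeoBound l) p) {T : ι → PowerSeries ℂ}
    (hT : WeightBound l α ω T) :
    ∃ C : ℝ, 0 ≤ C ∧ ∀ᶠ i in l, ∀ k,
      ‖coeff k ((p i).Q (T i))‖ * α i ^ k ≤ C * (((k : ℝ) + 1) * ω i k) := by
  have hg := geoBound_coeffClass l
  have hpw : ScalarsIn (WeightBound l α ω) p := hp.imp id fun f => hω.of_geoBound
  have hJ := hω.of_geoBound (hp.J hg)
  have hM := hω.of_geoBound (hp.M hg)
  have hM' := hω.of_geoBound (hg.deriv (hp.M hg))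
  obtain ⟨C0, hC0, h0⟩ := hpw.R0 hω.seriesClass hJ hM hM' hT
  obtain ⟨C1, hC1, h1⟩ := hpw.R1 hω.seriesClass hJ hM hT
  obtain ⟨C2, hC2, h2⟩ := hT
  obtain ⟨K, hK0, hK⟩ := hω.conv
  refine ⟨C0 + C1 * C2 * K, by positivity, ?_⟩
  filter_upwards [h0, h1, h2, hK] with i h0 h1 h2 hK k
  have hm : Monotone fun n : ℕ => (n : ℝ) + 1 := fun a b hab => by
    have : (a : ℝ) ≤ b := by exact_mod_cast hab
    simpa using this
  have h3 := hω.norm_coeff_mul_le_of_monotone hC1 hC2 hm hK (fun n => by positivity) h1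
    (g := X * derivative ℂ (T i)) (fun n => by
      rw [coeff_X_mul_derivative, norm_mul, Complex.norm_natCast]
      have h4 := h2 n
      have h5 : 0 ≤ C2 * ω i n := mul_nonneg hC2 (hω.weight_nonneg i n)
      calc _ = (n : ℝ) * (‖coeff n (T i)‖ * α i ^ n) := by ring
        _ ≤ n * (C2 * ω i n) := by gcongr
        _ ≤ _ := by linarith) k
  rw [Params.Q, map_add]
  have h5 : 0 ≤ C0 * ω i k := mul_nonneg hC0 (hω.weight_nonneg i k)
  have h6 : (0 : ℝ) ≤ k := Nat.cast_nonneg k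
  calc _ ≤ (‖coeff k ((p i).R0 (T i))‖ + ‖coeff k ((p i).R1 (T i) * (X * derivative ℂ (T i)))‖)
        * α i ^ k := mul_le_mul_of_nonneg_right (norm_add_le _ _) (pow_nonneg (hω.nonneg i) k)
    _ ≤ _ := by nlinarith [h0 k]

/-- The series obtained by dropping the terms of order at least `n`. -/
def truncate (n : ℕ) (f : PowerSeries ℂ) : PowerSeries ℂ :=
  PowerSeries.mk fun k => if k < n then coeff k f else 0

theorem coeff_truncate (n k : ℕ) (f : PowerSeries ℂ) :
    coeff k (truncate n f) = if k < n then coeff k f else 0 :=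
  coeff_mk _ _

theorem X_pow_dvd_sub_truncate (n : ℕ) (f : PowerSeries ℂ) : X ^ n ∣ f - truncate n f := by
  rw [X_pow_dvd_iff]
  intro m hm
  rw [map_sub, coeff_truncate, if_pos hm, sub_self]

namespace Params

variable {p : Params ℂ}

theorem coeff_theta_eq (n : ℕ) : coeff n p.theta = coeff n (p.step (truncate n p.theta)) := by
  have h := X_pow_dvd_iff.1 (p.step_congr (X_pow_dvd_sub_truncate n p.theta)) n (Nat.lt_succ_self n)
  rwa [map_sub, step_theta, sub_eq_zero] at h

theorem coeff_theta_zero : coeff 0 p.theta = p.a⁻¹ * coeff 0 p.source0 := by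
  rw [coeff_theta_eq, step, coeff_C_mul, map_sub, map_sub, coeff_source_of_lt _ (by norm_num)]
  simp

theorem coeff_step_succ (n : ℕ) (T : PowerSeries ℂ) :
    coeff (n + 1) (p.step T) =
      p.a⁻¹ * (coeff (n + 1) (p.source T) - (n + p.nu + 3) * coeff n T) := by
  have h : (X : PowerSeries ℂ) ^ 2 * derivative ℂ T = X * (X * derivative ℂ T) := by ring
  rw [step, coeff_C_mul, map_sub, map_sub, h, coeff_succ_X_mul, coeff_X_mul_derivative,
    mul_assoc (C (p.nu + 3)), coeff_C_mul, coeff_succ_X_mul]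
  ring

/-- The coefficient of order `n + 1` is determined by those of order at most `n`: the truncation
makes this explicit. -/
theorem coeff_theta_succ (n : ℕ) : coeff (n + 1) p.theta =
    p.a⁻¹ * (coeff (n + 1) (p.source (truncate (n + 1) p.theta)) -
      (n + p.nu + 3) * coeff n p.theta) := by
  rw [coeff_theta_eq, coeff_step_succ]
  congr 3
  rw [coeff_truncate, if_pos (Nat.lt_succ_self n)]

theorem coeff_theta_succ' (n : ℕ) : coeff (n + 1) p.theta =
    p.a⁻¹ * (p.g (n + 1) - (n + p.nu + 3) * coeff n p.theta) := by
  conv_lhs => rw [← p.step_theta]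
  rw [coeff_step_succ, g]

end Params

/-! ### Shifted factorial weights -/

/-- The weights `(L + 1) (L + 2) ⋯ (L + k) / (k + 1)²`. -/
def shiftedWeight (L k : ℕ) : ℝ := ((L + 1).ascFactorial k : ℝ) / ((k : ℝ) + 1) ^ 2

theorem shiftedWeight_nonneg (L k : ℕ) : 0 ≤ shiftedWeight L k := by
  unfold shiftedWeight
  positivity

theorem sum_one_div_sq_le (n : ℕ) :
    ∑ i ∈ Finset.range (n + 1), 1 / ((i : ℝ) + 1) ^ 2 ≤ 2 - 1 / ((n : ℝ) + 1) := by
  induction n with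
  | zero => norm_num
  | succ n ih =>
    rw [Finset.sum_range_succ]
    push_cast
    have h : 1 / ((n : ℝ) + 1 + 1) ^ 2 ≤ 1 / ((n : ℝ) + 1) - 1 / ((n : ℝ) + 1 + 1) := by
      rw [div_sub_div _ _ (by positivity) (by positivity), div_le_div_iff₀ (by positivity)
        (by positivity)]
      nlinarith [Nat.cast_nonneg (α := ℝ) n]
    linarith

theorem sum_antidiagonal_one_div_sq_le (n : ℕ) :
    ∑ x ∈ Finset.HasAntidiagonal.antidiagonal n,
      1 / ((x.1 : ℝ) + 1) ^ 2 * (1 / ((x.2 : ℝ) + 1) ^ 2) ≤ 8 * (1 / ((n : ℝ) + 1) ^ 2) := by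
  have h2 : ∑ i ∈ Finset.range (n + 1), 1 / ((i : ℝ) + 1) ^ 2 ≤ 2 :=
    (sum_one_div_sq_le n).trans (by have : 0 ≤ 1 / ((n : ℝ) + 1) := by positivity
                                    linarith)
  have e1 : ∑ x ∈ Finset.HasAntidiagonal.antidiagonal n, 1 / ((x.1 : ℝ) + 1) ^ 2 =
      ∑ i ∈ Finset.range (n + 1), 1 / ((i : ℝ) + 1) ^ 2 := by
    rw [Finset.Nat.sum_antidiagonal_eq_sum_range_succ_mk]
  have e2 : ∑ x ∈ Finset.HasAntidiagonal.antidiagonal n, 1 / ((x.2 : ℝ) + 1) ^ 2 =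
      ∑ i ∈ Finset.range (n + 1), 1 / ((i : ℝ) + 1) ^ 2 := by
    rw [← Finset.Nat.sum_antidiagonal_swap, ← e1]
    simp
  calc _ ≤ ∑ x ∈ Finset.HasAntidiagonal.antidiagonal n,
        2 / ((n : ℝ) + 1) ^ 2 * (1 / ((x.1 : ℝ) + 1) ^ 2 + 1 / ((x.2 : ℝ) + 1) ^ 2) := by
        refine Finset.sum_le_sum fun x hx => ?_
        rw [Finset.HasAntidiagonal.mem_antidiagonal] at hx
        have hx' : (n : ℝ) = x.1 + x.2 := by exact_mod_cast hx.symm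
        rw [hx', div_add_div _ _ (by positivity) (by positivity), div_mul_div_comm,
          div_mul_div_comm, div_le_div_iff₀ (by positivity) (by positivity)]
        have h1 : (0 : ℝ) ≤ x.1 := Nat.cast_nonneg _
        have h2 : (0 : ℝ) ≤ x.2 := Nat.cast_nonneg _
        have key : ((x.1 : ℝ) + x.2 + 1) ^ 2 ≤ 2 * (((x.2 : ℝ) + 1) ^ 2 + ((x.1 : ℝ) + 1) ^ 2) := by
          nlinarith [sq_nonneg ((x.1 : ℝ) - x.2)]
        have := mul_le_mul_of_nonneg_right key
          (show 0 ≤ ((x.1 : ℝ) + 1) ^ 2 * ((x.2 : ℝ) + 1) ^ 2 by positivity)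
        linarith
    _ = 2 / ((n : ℝ) + 1) ^ 2 * (2 * ∑ i ∈ Finset.range (n + 1), 1 / ((i : ℝ) + 1) ^ 2) := by
        rw [← Finset.mul_sum, Finset.sum_add_distrib, e1, e2, two_mul]
    _ ≤ 2 / ((n : ℝ) + 1) ^ 2 * (2 * 2) := by gcongr
    _ = _ := by ring

theorem ascFactorial_mul_le (m i j : ℕ) :
    m.ascFactorial i * m.ascFactorial j ≤ m.ascFactorial (i + j) := by
  induction j with
  | zero => simp
  | succ j ih =>
    rw [← Nat.add_assoc, Nat.ascFactorial_succ, Nat.ascFactorial_succ]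
    calc _ = (m + j) * (m.ascFactorial i * m.ascFactorial j) := by ring
      _ ≤ (m + (i + j)) * m.ascFactorial (i + j) := Nat.mul_le_mul (by lia) ih

theorem sum_shiftedWeight_mul_le (L n : ℕ) :
    ∑ x ∈ Finset.HasAntidiagonal.antidiagonal n, shiftedWeight L x.1 * shiftedWeight L x.2 ≤
      8 * shiftedWeight L n := by
  calc _ ≤ ∑ x ∈ Finset.HasAntidiagonal.antidiagonal n, ((L + 1).ascFactorial n : ℝ) *
        (1 / ((x.1 : ℝ) + 1) ^ 2 * (1 / ((x.2 : ℝ) + 1) ^ 2)) := by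
        refine Finset.sum_le_sum fun x hx => ?_
        rw [Finset.HasAntidiagonal.mem_antidiagonal] at hx
        have h : ((L + 1).ascFactorial x.1 : ℝ) * (L + 1).ascFactorial x.2 ≤
            (L + 1).ascFactorial n := by
          rw [← hx]
          exact_mod_cast ascFactorial_mul_le (L + 1) x.1 x.2
        calc _ = ((L + 1).ascFactorial x.1 : ℝ) * (L + 1).ascFactorial x.2 *
              (1 / ((x.1 : ℝ) + 1) ^ 2 * (1 / ((x.2 : ℝ) + 1) ^ 2)) := by
              unfold shiftedWeight
              ring
          _ ≤ _ := by gcongr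
    _ ≤ ((L + 1).ascFactorial n : ℝ) * (8 * (1 / ((n : ℝ) + 1) ^ 2)) := by
        rw [← Finset.mul_sum]
        exact mul_le_mul_of_nonneg_left (sum_antidiagonal_one_div_sq_le n) (by positivity)
    _ = _ := by
        unfold shiftedWeight
        ring

theorem add_one_sq_le_four_pow (k : ℕ) : ((k : ℝ) + 1) ^ 2 ≤ 4 ^ k := by
  calc ((k : ℝ) + 1) ^ 2 ≤ (2 ^ k) ^ 2 := pow_le_pow_left₀ (by positivity) (add_one_le_two_pow k) 2
    _ = 4 ^ k := by rw [← pow_mul, mul_comm, pow_mul]; norm_num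

theorem pow_le_ascFactorial (L k : ℕ) : (L : ℝ) ^ k ≤ (L + 1).ascFactorial k := by
  have h := Nat.pow_succ_le_ascFactorial (L + 1) k
  calc (L : ℝ) ^ k ≤ ((L + 1 : ℕ) : ℝ) ^ k := by gcongr; simp
    _ ≤ _ := by exact_mod_cast h

theorem pow_le_shiftedWeight {L : ℕ} {x : ℝ} (hx : 0 ≤ x) (h : 4 * x ≤ L) (k : ℕ) :
    x ^ k ≤ shiftedWeight L k := by
  rw [shiftedWeight, le_div_iff₀ (by positivity)]
  calc x ^ k * ((k : ℝ) + 1) ^ 2 ≤ x ^ k * 4 ^ k := by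
        gcongr
        exact add_one_sq_le_four_pow k
    _ = (4 * x) ^ k := by rw [mul_pow]; ring
    _ ≤ (L : ℝ) ^ k := by gcongr
    _ ≤ _ := pow_le_ascFactorial L k

theorem shiftedWeight_succ (L n : ℕ) : ((n : ℝ) + 2) ^ 2 * shiftedWeight L (n + 1) =
    ((L : ℝ) + n + 1) * (((n : ℝ) + 1) ^ 2 * shiftedWeight L n) := by
  have h1 : ((n : ℝ) + 1 + 1) ^ 2 ≠ 0 := by positivity
  have h2 : ((n : ℝ) + 1) ^ 2 ≠ 0 := by positivity
  rw [shiftedWeight, shiftedWeight, Nat.ascFactorial_succ]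
  push_cast
  field_simp
  ring

/-- For large `L`, the linear part of the recursion has norm less than `1` for the shifted
weights. -/
theorem shiftedWeight_linear {N : ℝ} (hN : 0 ≤ N) (L n : ℕ) :
    ((L : ℝ) + n + 1) * (((n : ℝ) + N + 3) * shiftedWeight L n) ≤
      ((n : ℝ) + 4 * N + 12) * shiftedWeight L (n + 1) := by
  have h := shiftedWeight_succ L n
  have hn : (0 : ℝ) ≤ n := Nat.cast_nonneg n
  have h2 : (0 : ℝ) < ((n : ℝ) + 1) ^ 2 := by positivity
  refine le_of_mul_le_mul_left ?_ h2
  calc _ = ((n : ℝ) + N + 3) * (((n : ℝ) + 2) ^ 2 * shiftedWeight L (n + 1)) := by rw [h]; ring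
    _ = (((n : ℝ) + N + 3) * ((n : ℝ) + 2) ^ 2) * shiftedWeight L (n + 1) := by ring
    _ ≤ (((n : ℝ) + 1) ^ 2 * ((n : ℝ) + 4 * N + 12)) * shiftedWeight L (n + 1) := by
        refine mul_le_mul_of_nonneg_right ?_ (shiftedWeight_nonneg _ _)
        nlinarith [mul_nonneg hN hn, mul_nonneg hN (mul_nonneg hn hn), mul_nonneg hn hn]
    _ = _ := by ring

/-- Three powers of `x` compensate the derivative, with a gain proportional to `L`. -/
theorem shiftedWeight_cubic (L n : ℕ) :
    ((L : ℝ) + n + 3) * (((n : ℝ) + 1) * ((L : ℝ) * shiftedWeight L n)) ≤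
      16 * shiftedWeight L (n + 3) := by
  have h0 := shiftedWeight_succ L n
  have h1 := shiftedWeight_succ L (n + 1)
  have h2 := shiftedWeight_succ L (n + 2)
  push_cast at h1 h2
  have hn : (0 : ℝ) ≤ n := Nat.cast_nonneg n
  have hL : (0 : ℝ) ≤ L := Nat.cast_nonneg L
  have e : ((n : ℝ) + 4) ^ 2 * shiftedWeight L (n + 3) =
      ((L : ℝ) + n + 3) * (((L : ℝ) + n + 2) * (((L : ℝ) + n + 1) *
        (((n : ℝ) + 1) ^ 2 * shiftedWeight L n))) := by
    rw [← h0]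
    have : (n : ℝ) + 1 + 2 = n + 2 + 1 := by ring
    rw [this] at h1
    have h1' : ((n : ℝ) + 2 + 1) ^ 2 * shiftedWeight L (n + 2) =
      ((L : ℝ) + n + 2) * (((n : ℝ) + 2) ^ 2 * shiftedWeight L (n + 1)) := by
      rw [h1]; ring
    rw [← h1']
    have h2' : ((n : ℝ) + 4) ^ 2 * shiftedWeight L (n + 3) =
      ((L : ℝ) + n + 3) * (((n : ℝ) + 2 + 1) ^ 2 * shiftedWeight L (n + 2)) := by
      rw [show (n : ℝ) + 4 = n + 2 + 2 by ring, h2]; ring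
    exact h2'
  have hw := shiftedWeight_nonneg L n
  have h3 : (0 : ℝ) < ((n : ℝ) + 4) ^ 2 := by positivity
  refine le_of_mul_le_mul_left ?_ h3
  calc _ = ((L : ℝ) + n + 3) * (((n : ℝ) + 1) * shiftedWeight L n) * (((n : ℝ) + 4) ^ 2 * L) := by
        ring
    _ ≤ ((L : ℝ) + n + 3) * (((n : ℝ) + 1) * shiftedWeight L n) *
        (16 * (((L : ℝ) + n + 2) * (((L : ℝ) + n + 1) * ((n : ℝ) + 1)))) := by
        refine mul_le_mul_of_nonneg_left ?_ (by positivity)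
        nlinarith [mul_nonneg hL hn, mul_nonneg hL (mul_nonneg hn hn), mul_nonneg hn hn,
          mul_nonneg (mul_nonneg hL hL) hn, mul_nonneg hL hL, mul_nonneg hn (mul_nonneg hn hn)]
    _ = 16 * (((n : ℝ) + 4) ^ 2 * shiftedWeight L (n + 3)) := by rw [e]; ring
    _ = _ := by ring

/-- Geometric sequences are small with respect to the shifted weights when `L` is large. -/
theorem shiftedWeight_geom {L : ℕ} {x : ℝ} (hx : 0 ≤ x) (h : 16 * x ≤ L) (n : ℕ) :
    ((L : ℝ) + n + 1) * (4 * x ^ (n + 1)) ≤ L * shiftedWeight L (n + 1) := by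
  have hL : (0 : ℝ) ≤ L := Nat.cast_nonneg L
  rw [shiftedWeight, mul_div_assoc', le_div_iff₀ (by positivity), Nat.ascFactorial_succ]
  push_cast
  have h1 := add_one_sq_le_four_pow (n + 1)
  push_cast at h1
  have h2 := pow_le_ascFactorial L n
  have h3 : (1 : ℝ) ≤ 4 ^ n := one_le_pow₀ (by norm_num)
  have h4 : 4 * x ^ (n + 1) * 4 ^ (n + 1) ≤ L * L ^ n := by
    calc _ ≤ (4 * x ^ (n + 1) * 4 ^ (n + 1)) * 4 ^ n := le_mul_of_one_le_right (by positivity) h3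
      _ = (16 * x) ^ (n + 1) := by
          rw [mul_pow, pow_succ, pow_succ, pow_succ, show (16 : ℝ) = 4 * 4 by norm_num, mul_pow]
          ring
      _ ≤ (L : ℝ) ^ (n + 1) := by gcongr
      _ = _ := by rw [pow_succ]; ring
  calc _ = ((L : ℝ) + n + 1) * (4 * x ^ (n + 1) * ((n : ℝ) + 1 + 1) ^ 2) := by ring
    _ ≤ ((L : ℝ) + n + 1) * (4 * x ^ (n + 1) * 4 ^ (n + 1)) := by gcongr
    _ ≤ ((L : ℝ) + n + 1) * (L * L ^ n) := by gcongr
    _ ≤ ((L : ℝ) + n + 1) * (L * (L + 1).ascFactorial n) := by gcongr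
    _ = _ := by ring

/-! ### The a priori bound -/

/-- Multiplied by `|a| ^ (n + 1)`, the recursion for the coefficients of `Θ` no longer involves
the size of `a`. -/
theorem norm_coeff_theta_succ_le {p : Params ℂ} (ha : p.a ≠ 0) {N : ℝ} (hN : ‖p.nu‖ ≤ N) (n : ℕ) :
    ‖coeff (n + 1) p.theta‖ * ‖p.a‖ ^ (n + 1) ≤
      ‖p.a⁻¹‖ * (‖coeff (n + 1) (p.source (truncate (n + 1) p.theta))‖ * ‖p.a‖ ^ (n + 1)) +
        (n + N + 3) * (‖coeff n p.theta‖ * ‖p.a‖ ^ n) := by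
  have h0 : ‖p.a⁻¹‖ * ‖p.a‖ = 1 := by rw [← norm_mul, inv_mul_cancel₀ ha, norm_one]
  have h1 : ‖(n : ℂ) + p.nu + 3‖ ≤ n + N + 3 := by
    refine (norm_add_le _ _).trans (add_le_add ((norm_add_le _ _).trans (add_le_add ?_ hN)) ?_)
    · rw [Complex.norm_natCast]
    · simp
  rw [Params.coeff_theta_succ, norm_mul]
  set S := coeff (n + 1) (p.source (truncate (n + 1) p.theta))
  set t := coeff n p.theta
  calc _ ≤ ‖p.a⁻¹‖ * (‖S‖ + ‖(n : ℂ) + p.nu + 3‖ * ‖t‖) * ‖p.a‖ ^ (n + 1) := by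
        gcongr
        exact (norm_sub_le _ _).trans_eq (by rw [norm_mul])
    _ = ‖p.a⁻¹‖ * (‖S‖ * ‖p.a‖ ^ (n + 1)) +
        (‖p.a⁻¹‖ * ‖p.a‖) * (‖(n : ℂ) + p.nu + 3‖ * (‖t‖ * ‖p.a‖ ^ n)) := by
        rw [pow_succ]
        ring
    _ ≤ _ := by
        rw [h0, one_mul]
        gcongr

/-- The shifted weights satisfy `IsWeight` as `L → ∞`, with constants that do not depend on `L`. -/
theorem isWeight_shiftedWeight {l : Filter (ι × ℕ)} {α : ι → ℝ} (hα : ∀ i, 0 ≤ α i) {A : ℝ}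
    (h : ∀ᶠ x in l, α x.1 ≤ A) (hl : Tendsto Prod.snd l atTop) (s : Set ((ι × ℕ) × ℕ)) :
    IsWeight (comap Prod.fst l ⊓ 𝓟 s) (fun x => α x.1.1) (fun x => shiftedWeight x.1.2) where
  nonneg := fun x => hα _
  weight_nonneg := fun x => shiftedWeight_nonneg _
  conv := ⟨8, by norm_num, Eventually.of_forall fun x n => sum_shiftedWeight_mul_le x.1.2 n⟩
  geom := by
    intro B hB
    have h2 : ∀ᶠ x in l, 4 * (B * A) ≤ (x.2 : ℝ) :=
      (tendsto_natCast_atTop_atTop.comp hl).eventually_ge_atTop _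
    have h3 : ∀ᶠ x in l, ∀ k, (B * α x.1) ^ k ≤ 1 * shiftedWeight x.2 k := by
      filter_upwards [h, h2] with x hx hx2 k
      rw [one_mul]
      refine pow_le_shiftedWeight (mul_nonneg (by linarith) (hα _)) (le_trans ?_ hx2) k
      have := mul_le_mul_of_nonneg_left hx (show 0 ≤ B by linarith)
      linarith
    exact ⟨1, zero_le_one, (tendsto_comap.eventually h3).filter_mono inf_le_left⟩

/-- A first bound on the coefficients of `Θ`. The nonlinear equation is of Volterra type: with
weights whose first ratios are of size `L`, the constant `U` is dictated by the affine part of the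
equation alone, and the bound propagates once `L` is large. -/
theorem exists_norm_coeff_theta_le {l : Filter ι} {p : ι → Params ℂ}
    (hp : ScalarsIn (GeoBound l) p) (ha : ∀ᶠ i in l, (p i).a ≠ 0)
    {A A' N : ℝ} (hA : ∀ᶠ i in l, ‖(p i).a‖ ≤ A) (hA' : ∀ᶠ i in l, ‖(p i).a⁻¹‖ ≤ A')
    (hN : ∀ᶠ i in l, ‖(p i).nu‖ ≤ N) (hN0 : 0 ≤ N) (hA0 : 0 ≤ A) (hA'0 : 0 ≤ A') :
    ∃ L : ℕ, ∃ U : ℝ, 0 ≤ U ∧ ∀ᶠ i in l, ∀ k,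
      ‖coeff k (p i).theta‖ * ‖(p i).a‖ ^ k ≤ U * shiftedWeight L k := by
  -- `U` may depend on the affine part of the equation, but it is chosen before `L`.
  obtain ⟨B, hB, hS⟩ := hp.source0 (geoBound_coeffClass l)
  set U := A' * B + 1 with hU
  have hU0 : 0 < U := by positivity
  -- The index set carries `L` and the truncation order along with `i`; on `s` the bound holds
  -- below the truncation order, so that the constant `C` obtained below for the nonlinearity is
  -- uniform in `L` and in the order, and serves at every step of the induction.
  let s : Set ((ι × ℕ) × ℕ) := {x | ∀ k < x.2,
    ‖coeff k (p x.1.1).theta‖ * ‖(p x.1.1).a‖ ^ k ≤ U * shiftedWeight x.1.2 k}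
  set m : Filter (ι × ℕ) := l ×ˢ atTop
  have hfst : Tendsto Prod.fst m l := tendsto_fst
  have hw := isWeight_shiftedWeight (α := fun i => ‖(p i).a‖) (l := m) (fun i => norm_nonneg _)
    (hfst.eventually hA) tendsto_snd s
  have hφ : Tendsto (fun x : (ι × ℕ) × ℕ => x.1.1) (comap Prod.fst m ⊓ 𝓟 s) l :=
    (hfst.comp tendsto_comap).mono_left inf_le_left
  have hp' : ScalarsIn (GeoBound (comap Prod.fst m ⊓ 𝓟 s)) fun x : (ι × ℕ) × ℕ => p x.1.1 := by
    refine hp.imp (fun x : (ι × ℕ) × ℕ => x.1.1) ?_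
    rintro f ⟨D, hD, hf⟩
    exact ⟨D, hD, hφ.eventually hf⟩
  have hT : WeightBound (comap Prod.fst m ⊓ 𝓟 s) (fun x => ‖(p x.1.1).a‖)
      (fun x => shiftedWeight x.1.2) fun x => truncate x.2 (p x.1.1).theta := by
    refine ⟨U, hU0.le, ?_⟩
    rw [eventually_inf_principal]
    refine Eventually.of_forall fun x hx k => ?_
    rw [coeff_truncate]
    split_ifs with hk
    · exact hx k hk
    · rw [norm_zero, zero_mul]
      exact mul_nonneg hU0.le (shiftedWeight_nonneg _ _)
  obtain ⟨C, hC, hQ⟩ := norm_coeff_Q_le hw hp' hT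
  rw [eventually_inf_principal, eventually_comap] at hQ
  have hL : ∀ᶠ x in m, 8 * N + 22 + 16 * (B * A) + 64 * (A' * A ^ 3 * C / U) + 1 ≤ (x.2 : ℝ) :=
    (tendsto_natCast_atTop_atTop.comp tendsto_snd).eventually_ge_atTop _
  have hall : ∀ᶠ x in m, ∀ k, ‖coeff k (p x.1).theta‖ * ‖(p x.1).a‖ ^ k ≤
      U * shiftedWeight x.2 k := by
    filter_upwards [hQ, hL, hfst.eventually ha, hfst.eventually hA, hfst.eventually hA',
      hfst.eventually hN, hfst.eventually hS] with x hQ hL ha hA hA' hN hS k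
    obtain ⟨i, L⟩ := x
    simp only at hL ha hA hA' hN hS ⊢
    have hBA : 0 ≤ B * A := mul_nonneg (by linarith) hA0
    have hCU : 0 ≤ A' * A ^ 3 * C / U := by positivity
    have hL1 : (1 : ℝ) ≤ L := by linarith
    induction k using Nat.strong_induction_on with
    | _ k ih =>
      rcases k with _ | n
      · rw [Params.coeff_theta_zero, norm_mul, pow_zero, mul_one]
        have := hS 0
        calc _ ≤ A' * B := by
              refine mul_le_mul hA' (by simpa using this) (norm_nonneg _) hA'0
          _ ≤ U * shiftedWeight L 0 := by
              simp [shiftedWeight, hU]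
      -- The nonlinearity at order `n + 1` involves only the coefficients below `n - 1`; the gain
      -- `16 / L` absorbs its constant.
      have hsrc : ((L : ℝ) + n + 1) *
          (‖coeff (n + 1) ((p i).source (truncate (n + 1) (p i).theta))‖ * ‖(p i).a‖ ^ (n + 1)) ≤
          ((L : ℝ) + n + 1) * (B * (B * A) ^ (n + 1)) +
            A ^ 3 * C * (16 / L) * shiftedWeight L (n + 1) := by
        have hpos : 0 ≤ A ^ 3 * C * (16 / L) * shiftedWeight L (n + 1) :=
          mul_nonneg (by positivity) (shiftedWeight_nonneg _ _)
        have h0 : ‖coeff (n + 1) (p i).source0‖ * ‖(p i).a‖ ^ (n + 1) ≤ B * (B * A) ^ (n + 1) := by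
          calc _ ≤ B ^ (n + 1 + 1) * A ^ (n + 1) := by
                have := hS (n + 1)
                gcongr
            _ = _ := by rw [mul_pow]; ring
        rcases lt_or_ge n 2 with hn | hn
        · rw [(p i).coeff_source_of_lt (show n + 1 < 3 by lia)]
          have := mul_le_mul_of_nonneg_left h0 (show 0 ≤ (L : ℝ) + n + 1 by positivity)
          linarith
        · obtain ⟨r, rfl⟩ := Nat.exists_eq_add_of_le' hn
          have hq := hQ ((i, L), r + 2 + 1) rfl (fun j hj => ih j hj) r
          simp only at hq
          rw [show r + 2 + 1 = r + 3 by ring, Params.coeff_source_add_three] at *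
          have hq' : ‖coeff r ((p i).Q (truncate (r + 3) (p i).theta))‖ * ‖(p i).a‖ ^ (r + 3) ≤
              A ^ 3 * (C * (((r : ℝ) + 1) * shiftedWeight L r)) := by
            calc _ = ‖(p i).a‖ ^ 3 * (‖coeff r ((p i).Q (truncate (r + 3) (p i).theta))‖ *
                  ‖(p i).a‖ ^ r) := by rw [pow_add]; ring
              _ ≤ _ := by gcongr
          have hc := shiftedWeight_cubic L r
          have hc' : ((L : ℝ) + r + 3) * (((r : ℝ) + 1) * shiftedWeight L r) ≤
              16 / L * shiftedWeight L (r + 3) := by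
            rw [div_mul_eq_mul_div, le_div_iff₀ (by linarith)]
            calc _ = ((L : ℝ) + r + 3) * (((r : ℝ) + 1) * (L * shiftedWeight L r)) := by ring
              _ ≤ _ := hc
          push_cast
          calc _ ≤ ((L : ℝ) + (r + 2) + 1) * ((‖coeff (r + 3) (p i).source0‖ +
                  ‖coeff r ((p i).Q (truncate (r + 3) (p i).theta))‖) * ‖(p i).a‖ ^ (r + 3)) := by
                refine mul_le_mul_of_nonneg_left ?_ (by positivity)
                exact mul_le_mul_of_nonneg_right (norm_add_le _ _) (by positivity)
            _ ≤ ((L : ℝ) + (r + 2) + 1) * (B * (B * A) ^ (r + 3) +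
                  A ^ 3 * (C * (((r : ℝ) + 1) * shiftedWeight L r))) := by
                refine mul_le_mul_of_nonneg_left ?_ (by positivity)
                rw [add_mul]
                exact add_le_add h0 hq'
            _ = ((L : ℝ) + (r + 2) + 1) * (B * (B * A) ^ (r + 3)) +
                  A ^ 3 * C * (((L : ℝ) + r + 3) * (((r : ℝ) + 1) * shiftedWeight L r)) := by ring
            _ ≤ ((L : ℝ) + (r + 2) + 1) * (B * (B * A) ^ (r + 3)) +
                  A ^ 3 * C * (16 / L * shiftedWeight L (r + 3)) := by gcongr
            _ = _ := by ring
      have hrec := norm_coeff_theta_succ_le ha hN n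
      have hlin := shiftedWeight_linear hN0 L n
      have hgeo := shiftedWeight_geom hBA (show 16 * (B * A) ≤ (L : ℝ) by linarith) n
      have hw := shiftedWeight_nonneg L (n + 1)
      set ω := shiftedWeight L (n + 1)
      have hpos : 0 < (L : ℝ) + n + 1 := by positivity
      have hsm : A' * (A ^ 3 * C * (16 / L)) ≤ U / 4 * L := by
        have h1 : 64 * (A' * A ^ 3 * C) ≤ U * L := by
          have : 64 * (A' * A ^ 3 * C / U) ≤ L := by linarith
          rw [mul_div_assoc', div_le_iff₀ hU0] at this
          linarith
        calc _ = 16 * (A' * A ^ 3 * C) / L := by ring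
          _ ≤ 16 * (A' * A ^ 3 * C) := div_le_self (by positivity) hL1
          _ ≤ _ := by linarith
      refine le_of_mul_le_mul_left ?_ hpos
      calc _ ≤ ((L : ℝ) + n + 1) * (A' *
            (‖coeff (n + 1) ((p i).source (truncate (n + 1) (p i).theta))‖ * ‖(p i).a‖ ^ (n + 1)) +
            (n + N + 3) * (U * shiftedWeight L n)) := by
            refine mul_le_mul_of_nonneg_left (hrec.trans ?_) hpos.le
            have := ih n (Nat.lt_succ_self n)
            gcongr
        _ = A' * (((L : ℝ) + n + 1) *
            (‖coeff (n + 1) ((p i).source (truncate (n + 1) (p i).theta))‖ *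
              ‖(p i).a‖ ^ (n + 1))) +
            U * (((L : ℝ) + n + 1) * ((n + N + 3) * shiftedWeight L n)) := by ring
        _ ≤ A' * (((L : ℝ) + n + 1) * (B * (B * A) ^ (n + 1)) + A ^ 3 * C * (16 / L) * ω) +
            U * (((n : ℝ) + 4 * N + 12) * ω) := by gcongr
        _ = A' * B / 4 * (((L : ℝ) + n + 1) * (4 * (B * A) ^ (n + 1))) +
            A' * (A ^ 3 * C * (16 / L)) * ω + U * (((n : ℝ) + 4 * N + 12) * ω) := by ring
        _ ≤ U / 4 * (L * ω) + U / 4 * L * ω + U * (((n : ℝ) + 4 * N + 12) * ω) := by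
            have h1 : A' * B / 4 ≤ U / 4 := by rw [hU]; linarith
            gcongr
        _ = (U * ω) * (L / 2 + n + 4 * N + 12) := by ring
        _ ≤ (U * ω) * (L + n + 1) := by
            have : 0 ≤ U * ω := by positivity
            gcongr ?_ * ?_
            linarith
        _ = _ := by ring
  -- One value of `L` has to serve for all `i` eventually along `l`.
  obtain ⟨L, hL⟩ := (eventually_swap_iff.1 hall).curry.exists
  exact ⟨L, U, hU0.le, hL⟩

/-! ### Factorial weights with a power -/

/-- The weights `k! (k + 1) ^ q`. -/
def powerWeight (q : ℝ) (k : ℕ) : ℝ := (k.factorial : ℝ) * ((k : ℝ) + 1) ^ q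

theorem powerWeight_pos (q : ℝ) (k : ℕ) : 0 < powerWeight q k := by
  unfold powerWeight
  positivity

theorem powerWeight_mono {q q' : ℝ} (h : q ≤ q') (k : ℕ) : powerWeight q k ≤ powerWeight q' k := by
  unfold powerWeight
  have : (1 : ℝ) ≤ (k : ℝ) + 1 := by simp
  gcongr

theorem rpow_le_rpow_abs {x R : ℝ} (q : ℝ) (h1 : R⁻¹ ≤ x) (h2 : x ≤ R) (hR : 1 ≤ R) :
    x ^ q ≤ R ^ |q| := by
  have hx : 0 < x := lt_of_lt_of_le (by positivity) h1
  rcases le_total 0 q with hq | hq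
  · rw [abs_of_nonneg hq]
    exact Real.rpow_le_rpow hx.le h2 hq
  · rw [abs_of_nonpos hq]
    calc x ^ q = x⁻¹ ^ (-q) := by rw [Real.inv_rpow hx.le, Real.rpow_neg hx.le, inv_inv]
      _ ≤ R ^ (-q) :=
        Real.rpow_le_rpow (by positivity) (inv_le_of_inv_le₀ (by linarith) h1) (by linarith)

theorem factorial_mul_factorial_mul_two_pow_le {i j : ℕ} (h : i ≤ j) :
    i.factorial * j.factorial * 2 ^ i ≤ (i + j).factorial := by
  induction i with
  | zero => simp
  | succ i ih =>
    have := ih (by lia)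
    calc _ = 2 * (i + 1) * (i.factorial * j.factorial * 2 ^ i) := by
          rw [Nat.factorial_succ, pow_succ]
          ring
      _ ≤ (i + j + 1) * (i + j).factorial := Nat.mul_le_mul (by lia) this
      _ = _ := by
          rw [show i + 1 + j = i + j + 1 by ring, Nat.factorial_succ]

/-- The factor `1 / 2 ^ i` comes from the binomial coefficient; it makes the convolution square of
the weights comparable with the weights, whatever the sign of `q`. -/
theorem powerWeight_mul_le (q : ℝ) {i j : ℕ} (h : i ≤ j) :
    powerWeight q i * powerWeight q j ≤
      (2 * ((i : ℝ) + 1)) ^ |q| * (1 / 2) ^ i * powerWeight q (i + j) := by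
  have hi : (0 : ℝ) ≤ i := Nat.cast_nonneg i
  have hij : (i : ℝ) ≤ j := by exact_mod_cast h
  have hn : (0 : ℝ) < (i : ℝ) + j + 1 := by positivity
  have h1 : (((i : ℝ) + 1) * ((j : ℝ) + 1) / (i + j + 1)) ^ q ≤ (2 * ((i : ℝ) + 1)) ^ |q| := by
    apply rpow_le_rpow_abs
    · rw [inv_le_iff_one_le_mul₀ (by positivity), div_mul_eq_mul_div, le_div_iff₀ hn]
      nlinarith [mul_nonneg hi (hi.trans hij)]
    · rw [div_le_iff₀ hn]
      nlinarith [mul_nonneg hi (hi.trans hij)]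
    · linarith
  have h2 : (i.factorial : ℝ) * j.factorial ≤ (1 / 2) ^ i * (i + j).factorial := by
    have h3 : (i.factorial : ℝ) * j.factorial * 2 ^ i ≤ (i + j).factorial := by
      exact_mod_cast factorial_mul_factorial_mul_two_pow_le h
    rw [one_div, inv_pow, inv_mul_eq_div, le_div_iff₀ (by positivity)]
    exact h3
  unfold powerWeight
  push_cast
  calc _ = (i.factorial : ℝ) * j.factorial *
        ((((i : ℝ) + 1) * ((j : ℝ) + 1) / (i + j + 1)) ^ q * ((i : ℝ) + j + 1) ^ q) := by
        rw [← Real.mul_rpow (by positivity) (by positivity), div_mul_cancel₀ _ hn.ne',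
          Real.mul_rpow (by positivity) (by positivity)]
        ring
    _ ≤ (1 / 2) ^ i * (i + j).factorial * ((2 * ((i : ℝ) + 1)) ^ |q| * ((i : ℝ) + j + 1) ^ q) := by
        gcongr
    _ = _ := by ring

theorem summable_rpow_mul_geometric (q : ℝ) :
    Summable fun i : ℕ => (2 * ((i : ℝ) + 1)) ^ |q| * (1 / 2 : ℝ) ^ i := by
  obtain ⟨N, hN⟩ := exists_nat_ge |q|
  have h := summable_pow_mul_geometric_of_norm_lt_one (R := ℝ) N (r := 1 / 2) (by norm_num)
  have h2 := ((summable_nat_add_iff 1).2 h).mul_left (2 ^ N * 2)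
  refine Summable.of_nonneg_of_le (fun i => by positivity) (fun i => ?_) h2
  calc (2 * ((i : ℝ) + 1)) ^ |q| * (1 / 2 : ℝ) ^ i
      ≤ (2 * ((i : ℝ) + 1)) ^ (N : ℝ) * (1 / 2) ^ i := by
        have : 1 ≤ 2 * ((i : ℝ) + 1) := by linarith [Nat.cast_nonneg (α := ℝ) i]
        gcongr
    _ = _ := by
        rw [Real.rpow_natCast, mul_pow, pow_succ]
        push_cast
        ring

theorem exists_sum_powerWeight_mul_le (q : ℝ) : ∃ K : ℝ, 0 ≤ K ∧ ∀ n,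
    ∑ x ∈ Finset.HasAntidiagonal.antidiagonal n, powerWeight q x.1 * powerWeight q x.2 ≤
      K * powerWeight q n := by
  set f : ℕ → ℝ := fun i => (2 * ((i : ℝ) + 1)) ^ |q| * (1 / 2 : ℝ) ^ i with hf
  have hf0 : ∀ i, 0 ≤ f i := fun i => by positivity
  have hs : Summable f := summable_rpow_mul_geometric q
  refine ⟨2 * ∑' i, f i, mul_nonneg zero_le_two (tsum_nonneg hf0), fun n => ?_⟩
  have e1 : ∑ x ∈ Finset.HasAntidiagonal.antidiagonal n, f x.1 =
      ∑ i ∈ Finset.range (n + 1), f i := by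
    rw [Finset.Nat.sum_antidiagonal_eq_sum_range_succ_mk]
  have e2 : ∑ x ∈ Finset.HasAntidiagonal.antidiagonal n, f x.2 =
      ∑ i ∈ Finset.range (n + 1), f i := by
    rw [← Finset.Nat.sum_antidiagonal_swap, ← e1]
    simp
  calc _ ≤ ∑ x ∈ Finset.HasAntidiagonal.antidiagonal n, (f x.1 + f x.2) * powerWeight q n := by
        refine Finset.sum_le_sum fun x hx => ?_
        rw [Finset.HasAntidiagonal.mem_antidiagonal] at hx
        have hw := (powerWeight_pos q n).le
        rcases le_total x.1 x.2 with h | h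
        · have h1 := powerWeight_mul_le q h
          rw [hx] at h1
          nlinarith [mul_nonneg (hf0 x.2) hw]
        · have h1 := powerWeight_mul_le q h
          rw [add_comm x.2 x.1, hx] at h1
          nlinarith [mul_nonneg (hf0 x.1) hw]
    _ = 2 * (∑ i ∈ Finset.range (n + 1), f i) * powerWeight q n := by
        rw [← Finset.sum_mul, Finset.sum_add_distrib, e1, e2, two_mul]
    _ ≤ _ := by
        have := hs.sum_le_tsum (Finset.range (n + 1)) fun i _ => hf0 i
        have hw := (powerWeight_pos q n).le
        gcongr

theorem exists_pow_le_powerWeight (q : ℝ) {R : ℝ} (hR : 0 ≤ R) :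
    ∃ C : ℝ, 0 ≤ C ∧ ∀ k : ℕ, R ^ k ≤ C * powerWeight q k := by
  obtain ⟨N, hN⟩ := exists_nat_ge (-q)
  -- A negative power of `k + 1` in the weight is compensated by `exp (k + 1)`, hence the
  -- radius `R * exp 1`.
  refine ⟨N.factorial * Real.exp 1 * Real.exp (R * Real.exp 1), by positivity, fun k => ?_⟩
  have hk : (1 : ℝ) ≤ (k : ℝ) + 1 := by simp
  have h1 : ((k : ℝ) + 1) ^ (-q) ≤ N.factorial * Real.exp (k + 1) := by
    calc ((k : ℝ) + 1) ^ (-q) ≤ ((k : ℝ) + 1) ^ (N : ℝ) := by gcongr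
      _ = ((k : ℝ) + 1) ^ N := Real.rpow_natCast _ _
      _ ≤ _ := by
        have := Real.pow_div_factorial_le_exp ((k : ℝ) + 1) (by positivity) N
        rwa [div_le_iff₀' (by positivity)] at this
  have h2 : (R * Real.exp 1) ^ k ≤ k.factorial * Real.exp (R * Real.exp 1) := by
    have := Real.pow_div_factorial_le_exp (R * Real.exp 1) (by positivity) k
    rwa [div_le_iff₀' (by positivity)] at this
  have h3 : ((k : ℝ) + 1) ^ (-q) * ((k : ℝ) + 1) ^ q = 1 := by
    rw [← Real.rpow_add (by positivity), neg_add_cancel, Real.rpow_zero]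
  unfold powerWeight
  calc R ^ k = R ^ k * (((k : ℝ) + 1) ^ (-q) * ((k : ℝ) + 1) ^ q) := by rw [h3, mul_one]
    _ ≤ R ^ k * (N.factorial * Real.exp (k + 1) * ((k : ℝ) + 1) ^ q) := by gcongr
    _ = N.factorial * Real.exp 1 * (R * Real.exp 1) ^ k * ((k : ℝ) + 1) ^ q := by
        rw [mul_pow, ← Real.exp_nat_mul, Real.exp_add, mul_one]
        ring
    _ ≤ N.factorial * Real.exp 1 * (k.factorial * Real.exp (R * Real.exp 1)) *
        ((k : ℝ) + 1) ^ q := by gcongr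
    _ = _ := by ring

theorem isWeight_powerWeight {l : Filter ι} {α : ι → ℝ} (hα : ∀ i, 0 ≤ α i) {A : ℝ} (hA : 0 ≤ A)
    (h : ∀ᶠ i in l, α i ≤ A) (q : ℝ) : IsWeight l α fun _ => powerWeight q where
  nonneg := hα
  weight_nonneg := fun _ k => (powerWeight_pos q k).le
  conv := by
    obtain ⟨K, hK, hc⟩ := exists_sum_powerWeight_mul_le q
    exact ⟨K, hK, Eventually.of_forall fun _ => hc⟩
  geom := by
    intro B hB
    obtain ⟨C, hC, hc⟩ := exists_pow_le_powerWeight q (R := B * A) (by positivity)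
    refine ⟨C, hC, h.mono fun i hi k => le_trans ?_ (hc k)⟩
    have := hα i
    gcongr

/-- Three powers of `x` compensate the derivative, with a gain of two powers of the order. -/
theorem add_one_mul_powerWeight_le (q : ℝ) (m : ℕ) :
    ((m : ℝ) + 1) * powerWeight q m ≤ 4 * 4 ^ |q| * powerWeight (q - 2) (m + 3) := by
  have hm : (0 : ℝ) ≤ m := Nat.cast_nonneg m
  have h1 : (((m : ℝ) + 1) / (m + 4)) ^ q ≤ 4 ^ |q| := by
    apply rpow_le_rpow_abs
    · rw [le_div_iff₀ (by positivity)]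
      linarith
    · rw [div_le_iff₀ (by positivity)]
      linarith
    · norm_num
  have h2 : ((m : ℝ) + 1) ^ q = (((m : ℝ) + 1) / (m + 4)) ^ q * ((m : ℝ) + 4) ^ q := by
    rw [← Real.mul_rpow (by positivity) (by positivity), div_mul_cancel₀ _ (by positivity)]
  have h3 : ((m : ℝ) + 4) ^ q = ((m : ℝ) + 4) ^ (q - 2) * ((m : ℝ) + 4) ^ 2 := by
    rw [← Real.rpow_natCast _ 2, ← Real.rpow_add (by positivity)]
    norm_num
  have h4 : ((m : ℝ) + 4) ^ 2 ≤ 4 * (((m : ℝ) + 3) * ((m : ℝ) + 2)) := by nlinarith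
  unfold powerWeight
  rw [Nat.factorial_succ, Nat.factorial_succ, Nat.factorial_succ]
  push_cast
  rw [show (m : ℝ) + 3 + 1 = m + 4 by ring, show (m : ℝ) + 2 + 1 = m + 3 by ring,
    show (m : ℝ) + 1 + 1 = m + 2 by ring]
  calc _ = ((m : ℝ) + 1) * m.factorial * ((((m : ℝ) + 1) / (m + 4)) ^ q *
        (((m : ℝ) + 4) ^ (q - 2) * ((m : ℝ) + 4) ^ 2)) := by rw [h2, h3]; ring
    _ ≤ ((m : ℝ) + 1) * m.factorial * (4 ^ |q| *
        (((m : ℝ) + 4) ^ (q - 2) * (4 * (((m : ℝ) + 3) * ((m : ℝ) + 2))))) := by gcongr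
    _ = _ := by ring

theorem powerWeight_sub_two_le {q q' : ℝ} (h : q ≤ q' + 1) (k : ℕ) :
    ((k : ℝ) + 1) * powerWeight (q - 2) k ≤ powerWeight q' k := by
  unfold powerWeight
  have h1 : ((k : ℝ) + 1) * ((k : ℝ) + 1) ^ (q - 2) = ((k : ℝ) + 1) ^ (q - 1) := by
    have h2 : q - 1 = 1 + (q - 2) := by ring
    rw [h2, Real.rpow_add (by positivity), Real.rpow_one]
  have h3 : ((k : ℝ) + 1) ^ (q - 1) ≤ ((k : ℝ) + 1) ^ q' :=
    Real.rpow_le_rpow_of_exponent_le (by simp) (by linarith)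
  calc _ = (k.factorial : ℝ) * (((k : ℝ) + 1) * ((k : ℝ) + 1) ^ (q - 2)) := by ring
    _ ≤ _ := by
        rw [h1]
        gcongr

theorem tendsto_mul_rpow_sub_one (q : ℝ) :
    Tendsto (fun k : ℕ => (k : ℝ) * ((1 + 1 / (k : ℝ)) ^ q - 1)) atTop (𝓝 q) := by
  have h : HasDerivAt (fun x : ℝ => x ^ q) q 1 := by
    simpa using Real.hasDerivAt_rpow_const (x := 1) (p := q) (Or.inl one_ne_zero)
  have h2 := h.tendsto_slope_zero_right
  have h3 : Tendsto (fun k : ℕ => 1 / (k : ℝ)) atTop (𝓝[>] 0) :=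
    tendsto_nhdsWithin_iff.2 ⟨tendsto_one_div_atTop_nhds_zero_nat, by
      filter_upwards [eventually_gt_atTop 0] with k hk
      simpa using hk⟩
  refine (h2.comp h3).congr fun k => ?_
  simp

theorem rpow_add_one_eq {k : ℕ} (hk : 0 < k) (q : ℝ) :
    ((k : ℝ) + 1) ^ q = (1 + 1 / (k : ℝ)) ^ q * (k : ℝ) ^ q := by
  have : (0 : ℝ) < k := by exact_mod_cast hk
  rw [← Real.mul_rpow (by positivity) this.le]
  congr 1
  field_simp

/-- Locally uniformly in `c`, the ratio `|k + c| / k` is smaller than that of `(k + 1) ^ q` when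
`re c < q`, with a margin of order `1 / k`. -/
theorem exists_norm_add_mul_rpow_le {c₀ : ℂ} {q : ℝ} (h : c₀.re < q) :
    ∃ δ : ℝ, 0 < δ ∧ ∃ k₀ : ℕ, 0 < k₀ ∧ ∀ᶠ c in 𝓝 c₀, ∀ k ≥ k₀,
      ‖(k : ℂ) + c‖ * (k : ℝ) ^ q ≤ ((k : ℝ) - δ) * ((k : ℝ) + 1) ^ q := by
  set ε := (q - c₀.re) / 5 with hε
  have hε0 : 0 < ε := by rw [hε]; linarith
  have h1 := tendsto_mul_rpow_sub_one q
  have h2 : Tendsto (fun k : ℕ => (k : ℝ) * ((1 + 1 / (k : ℝ)) ^ q - 1) - ε * (1 + 1 / (k : ℝ)) ^ q)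
      atTop (𝓝 (q - ε * 1)) := by
    refine h1.sub (Tendsto.const_mul ε ?_)
    have h3 : Tendsto (fun k : ℕ => 1 + 1 / (k : ℝ)) atTop (𝓝 (1 + 0)) :=
      tendsto_const_nhds.add tendsto_one_div_atTop_nhds_zero_nat
    simpa using h3.rpow_const (p := q) (Or.inl (by norm_num))
  have h4 := h2.eventually (eventually_gt_nhds (show c₀.re + 2 * ε < q - ε * 1 by
    rw [hε]; linarith))
  have h5 : ∀ᶠ k : ℕ in atTop, (‖c₀‖ + 1) ^ 2 / ε + ‖c₀‖ + 1 ≤ (k : ℝ) :=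
    tendsto_natCast_atTop_atTop.eventually_ge_atTop _
  obtain ⟨k₀, hk₀⟩ := eventually_atTop.1 ((h4.and h5).and (eventually_gt_atTop 0))
  refine ⟨ε, hε0, k₀, (hk₀ k₀ le_rfl).2, ?_⟩
  have h6 : ∀ᶠ c in 𝓝 c₀, c.re < c₀.re + ε :=
    (Complex.continuous_re.tendsto c₀).eventually (eventually_lt_nhds (by linarith))
  have h7 : ∀ᶠ c in 𝓝 c₀, ‖c‖ < ‖c₀‖ + 1 :=
    (continuous_norm.tendsto c₀).eventually (eventually_lt_nhds (by linarith))
  filter_upwards [h6, h7] with c h6 h7 k hk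
  obtain ⟨⟨h4, h5⟩, hk0⟩ := hk₀ k hk
  have hk0' : (0 : ℝ) < k := by exact_mod_cast hk0
  have hre : |c.re| ≤ ‖c‖ := Complex.abs_re_le_norm c
  have him : |c.im| ≤ ‖c‖ := Complex.abs_im_le_norm c
  have hre' := neg_abs_le c.re
  have hdiv : (‖c₀‖ + 1) ^ 2 / ε ≤ k + c.re := by linarith
  have hpos : 0 ≤ (‖c₀‖ + 1) ^ 2 / ε := by positivity
  have hnorm : ‖(k : ℂ) + c‖ ≤ k + c.re + ε := by
    have h8 : (‖c₀‖ + 1) ^ 2 ≤ (k + c.re) * ε := by rwa [div_le_iff₀ hε0] at hdiv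
    have h9 : c.im ^ 2 ≤ (‖c₀‖ + 1) ^ 2 := by
      rw [← sq_abs]
      gcongr
      linarith
    rw [Complex.norm_eq_sqrt_sq_add_sq]
    refine Real.sqrt_le_iff.2 ⟨by linarith, ?_⟩
    simp only [Complex.add_re, Complex.natCast_re, Complex.add_im, Complex.natCast_im, zero_add]
    nlinarith
  rw [rpow_add_one_eq hk0, ← mul_assoc]
  refine mul_le_mul_of_nonneg_right ?_ (by positivity)
  linarith

/-- Locally uniformly in `c`, the ratio `|k + c| / k` is at least that of `(k + 1) ^ q` when
`q < re c`. -/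
theorem exists_mul_rpow_le_norm_add {c₀ : ℂ} {q : ℝ} (h : q < c₀.re) :
    ∃ k₀ : ℕ, 0 < k₀ ∧ ∀ᶠ c in 𝓝 c₀, ∀ k ≥ k₀,
      (k : ℝ) * ((k : ℝ) + 1) ^ q ≤ ‖(k : ℂ) + c‖ * (k : ℝ) ^ q := by
  set ε := (c₀.re - q) / 2 with hε
  have hε0 : 0 < ε := by rw [hε]; linarith
  have h1 := (tendsto_mul_rpow_sub_one q).eventually
    (eventually_lt_nhds (show q < q + ε by linarith))
  obtain ⟨k₀, hk₀⟩ := eventually_atTop.1 (h1.and (eventually_gt_atTop 0))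
  refine ⟨k₀, (hk₀ k₀ le_rfl).2, ?_⟩
  have h6 : ∀ᶠ c in 𝓝 c₀, c₀.re - ε < c.re :=
    (Complex.continuous_re.tendsto c₀).eventually (eventually_gt_nhds (by linarith))
  filter_upwards [h6] with c h6 k hk
  obtain ⟨h4, hk0⟩ := hk₀ k hk
  have hnorm : (k : ℝ) + c.re ≤ ‖(k : ℂ) + c‖ := by
    simpa using Complex.re_le_norm ((k : ℂ) + c)
  rw [rpow_add_one_eq hk0, ← mul_assoc]
  refine mul_le_mul_of_nonneg_right ?_ (by positivity)
  linarith

/-! ### Growth of `Θ`, convergence and holomorphy of `S_∞` -/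

/-- The source gains two powers of the order over the solution. -/
theorem exists_norm_g_le {l : Filter ι} {p : ι → Params ℂ} (hp : ScalarsIn (GeoBound l) p)
    {A : ℝ} (hA0 : 0 ≤ A) (hA : ∀ᶠ i in l, ‖(p i).a‖ ≤ A) {q : ℝ}
    (hT : WeightBound l (fun i => ‖(p i).a‖) (fun _ => powerWeight q) fun i => (p i).theta) :
    ∃ C : ℝ, 0 ≤ C ∧ ∀ᶠ i in l, ∀ k, ‖(p i).g k‖ * ‖(p i).a‖ ^ k ≤ C * powerWeight (q - 2) k := by
  have hn : ∀ i, 0 ≤ ‖(p i).a‖ := fun i => norm_nonneg _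
  obtain ⟨C1, hC1, h1⟩ := norm_coeff_Q_le (isWeight_powerWeight hn hA0 hA q) hp hT
  obtain ⟨C0, hC0, h0⟩ := (isWeight_powerWeight hn hA0 hA (q - 2)).of_geoBound
    (hp.source0 (geoBound_coeffClass l))
  set D := A ^ 3 * C1 * (4 * 4 ^ |q|) with hD
  have hD0 : 0 ≤ D := by positivity
  refine ⟨C0 + D, by positivity, ?_⟩
  filter_upwards [h0, h1, hA] with i h0 h1 hA k
  have hw := powerWeight_pos (q - 2) k
  rcases lt_or_ge k 3 with hk | hk
  · rw [Params.g, (p i).coeff_source_of_lt hk]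
    nlinarith [h0 k, mul_nonneg hD0 hw.le]
  · obtain ⟨m, rfl⟩ := Nat.exists_eq_add_of_le' hk
    rw [Params.g, Params.coeff_source_add_three]
    have h2 : ‖coeff m ((p i).Q (p i).theta)‖ * ‖(p i).a‖ ^ (m + 3) ≤
        D * powerWeight (q - 2) (m + 3) := by
      calc _ = ‖(p i).a‖ ^ 3 * (‖coeff m ((p i).Q (p i).theta)‖ * ‖(p i).a‖ ^ m) := by
            rw [pow_add]; ring
        _ ≤ A ^ 3 * (C1 * (((m : ℝ) + 1) * powerWeight q m)) := by
            have := h1 m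
            gcongr
        _ ≤ A ^ 3 * (C1 * (4 * 4 ^ |q| * powerWeight (q - 2) (m + 3))) := by
            have := add_one_mul_powerWeight_le q m
            gcongr
        _ = _ := by rw [hD]; ring
    calc _ ≤ (‖coeff (m + 3) (p i).source0‖ + ‖coeff m ((p i).Q (p i).theta)‖) *
          ‖(p i).a‖ ^ (m + 3) := mul_le_mul_of_nonneg_right (norm_add_le _ _) (by positivity)
      _ ≤ _ := by
          have := h0 (m + 3)
          rw [add_mul, add_mul]
          exact add_le_add this h2

theorem exists_powerWeight_le (q q' : ℝ) (n : ℕ) :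
    ∃ C : ℝ, 0 ≤ C ∧ ∀ k ≤ n, powerWeight q k ≤ C * powerWeight q' k := by
  refine ⟨∑ k ∈ Finset.range (n + 1), powerWeight q k / powerWeight q' k,
    Finset.sum_nonneg fun k _ => div_nonneg (powerWeight_pos _ _).le (powerWeight_pos _ _).le,
    fun k hk => ?_⟩
  rw [← div_le_iff₀ (powerWeight_pos _ _)]
  exact Finset.single_le_sum (f := fun k => powerWeight q k / powerWeight q' k)
    (fun k _ => div_nonneg (powerWeight_pos _ _).le (powerWeight_pos _ _).le)
    (Finset.mem_range.2 (Nat.lt_succ_of_le hk))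

/-- The exponent of the bound on the coefficients of `Θ` can be lowered by `1`, as long as it stays
above the exponent `re ν + 2` of the solutions of the homogeneous recursion. -/
theorem weightBound_theta_of_le {l : Filter ι} {p : ι → Params ℂ} (hp : ScalarsIn (GeoBound l) p)
    {A A' : ℝ} (hA0 : 0 ≤ A) (hA : ∀ᶠ i in l, ‖(p i).a‖ ≤ A) (hA'0 : 0 ≤ A')
    (hA' : ∀ᶠ i in l, ‖(p i).a⁻¹‖ ≤ A') (ha : ∀ᶠ i in l, (p i).a ≠ 0) {ν : ℂ}
    (hν : Tendsto (fun i => (p i).nu) l (𝓝 ν)) {q q' : ℝ} (hq : q ≤ q' + 1) (hq' : ν.re + 2 < q')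
    (hT : WeightBound l (fun i => ‖(p i).a‖) (fun _ => powerWeight q) fun i => (p i).theta) :
    WeightBound l (fun i => ‖(p i).a‖) (fun _ => powerWeight q') fun i => (p i).theta := by
  obtain ⟨C2, hC2, hg⟩ := exists_norm_g_le hp hA0 hA hT
  obtain ⟨C, hC, hθ⟩ := hT
  obtain ⟨δ, hδ, k₀, hk₀, hr⟩ := exists_norm_add_mul_rpow_le (c₀ := ν + 2) (q := q') (by simpa)
  have hr' := (hν.add_const 2).eventually hr
  obtain ⟨C3, hC3, h3⟩ := exists_powerWeight_le q q' k₀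
  -- The first summand takes care of the orders up to `k₀`; the second makes `A' * C2 ≤ U * δ`, so
  -- that the margin `δ` in the linear part of the recursion absorbs the source.
  set U := C * C3 + A' * C2 / δ with hU
  have hU0 : 0 ≤ U := by positivity
  refine ⟨U, hU0, ?_⟩
  filter_upwards [hg, hθ, hr', hA', ha] with i hg hθ hr hA' ha k
  have hsmall : ∀ k ≤ k₀, ‖coeff k (p i).theta‖ * ‖(p i).a‖ ^ k ≤ U * powerWeight q' k := by
    intro k hk
    calc _ ≤ C * powerWeight q k := hθ k
      _ ≤ C * (C3 * powerWeight q' k) := mul_le_mul_of_nonneg_left (h3 k hk) hC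
      _ = C * C3 * powerWeight q' k := by ring
      _ ≤ _ := by
          refine mul_le_mul_of_nonneg_right ?_ (powerWeight_pos _ _).le
          rw [hU]
          have : 0 ≤ A' * C2 / δ := by positivity
          linarith
  induction k with
  | zero => exact hsmall 0 (Nat.zero_le _)
  | succ n ih =>
    rcases Nat.lt_or_ge k₀ (n + 1) with hlt | hle
    swap
    · exact hsmall _ hle
    have h0 : ‖(p i).a⁻¹‖ * ‖(p i).a‖ = 1 := by rw [← norm_mul, inv_mul_cancel₀ ha, norm_one]
    have hw := powerWeight_pos q' (n + 1)
    have hn : (0 : ℝ) < (n : ℝ) + 1 := by positivity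
    have hlin : ‖(n : ℂ) + (p i).nu + 3‖ * powerWeight q' n * ((n : ℝ) + 1) ≤
        ((n : ℝ) + 1 - δ) * powerWeight q' (n + 1) := by
      have := hr (n + 1) hlt.le
      unfold powerWeight
      rw [Nat.factorial_succ]
      push_cast at this ⊢
      rw [show (n : ℂ) + 1 + ((p i).nu + 2) = n + (p i).nu + 3 by ring] at this
      calc _ = (((n : ℝ) + 1) * n.factorial) * (‖(n : ℂ) + (p i).nu + 3‖ * ((n : ℝ) + 1) ^ q') := by
            ring
        _ ≤ (((n : ℝ) + 1) * n.factorial) * (((n : ℝ) + 1 - δ) * ((n : ℝ) + 1 + 1) ^ q') := by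
            gcongr
        _ = _ := by ring
    have hgw : ‖(p i).g (n + 1)‖ * ‖(p i).a‖ ^ (n + 1) * ((n : ℝ) + 1) ≤
        C2 * powerWeight q' (n + 1) := by
      have h1 := powerWeight_sub_two_le hq (n + 1)
      have h2 := powerWeight_pos (q - 2) (n + 1)
      push_cast at h1
      calc _ ≤ C2 * powerWeight (q - 2) (n + 1) * ((n : ℝ) + 1 + 1) := by
            refine mul_le_mul (hg _) (by linarith) hn.le (by positivity)
        _ = C2 * (((n : ℝ) + 1 + 1) * powerWeight (q - 2) (n + 1)) := by ring
        _ ≤ _ := mul_le_mul_of_nonneg_left h1 hC2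
    rw [Params.coeff_theta_succ', norm_mul]
    refine le_of_mul_le_mul_right ?_ hn
    calc _ ≤ ‖(p i).a⁻¹‖ * (‖(p i).g (n + 1)‖ +
            ‖(n : ℂ) + (p i).nu + 3‖ * ‖coeff n (p i).theta‖) * ‖(p i).a‖ ^ (n + 1) *
            ((n : ℝ) + 1) := by
          gcongr
          exact (norm_sub_le _ _).trans_eq (by rw [norm_mul])
      _ = ‖(p i).a⁻¹‖ * (‖(p i).g (n + 1)‖ * ‖(p i).a‖ ^ (n + 1) * ((n : ℝ) + 1)) +
            (‖(p i).a⁻¹‖ * ‖(p i).a‖) * (‖(n : ℂ) + (p i).nu + 3‖ *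
              (‖coeff n (p i).theta‖ * ‖(p i).a‖ ^ n) * ((n : ℝ) + 1)) := by
          rw [pow_succ]
          ring
      _ ≤ A' * (C2 * powerWeight q' (n + 1)) +
            1 * (‖(n : ℂ) + (p i).nu + 3‖ * (U * powerWeight q' n) * ((n : ℝ) + 1)) := by
          rw [h0]
          gcongr
      _ = A' * C2 * powerWeight q' (n + 1) +
            U * (‖(n : ℂ) + (p i).nu + 3‖ * powerWeight q' n * ((n : ℝ) + 1)) := by ring
      _ ≤ A' * C2 * powerWeight q' (n + 1) +
            U * (((n : ℝ) + 1 - δ) * powerWeight q' (n + 1)) := by gcongr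
      _ ≤ U * δ * powerWeight q' (n + 1) +
            U * (((n : ℝ) + 1 - δ) * powerWeight q' (n + 1)) := by
          have : A' * C2 ≤ U * δ := by
            rw [hU, add_mul, div_mul_cancel₀ _ hδ.ne']
            have : 0 ≤ C * C3 * δ := by positivity
            linarith
          gcongr
      _ = _ := by ring

theorem ascFactorial_le_factorial_mul_pow (L k : ℕ) :
    (L + 1).ascFactorial k ≤ k.factorial * (k + 1) ^ L := by
  induction L with
  | zero => simp [Nat.one_ascFactorial]
  | succ L ih =>
    refine Nat.le_of_mul_le_mul_left ?_ (Nat.succ_pos L)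
    calc _ = (L + 1 + k) * (L + 1).ascFactorial k := Nat.succ_ascFactorial (L + 1) k
      _ ≤ ((L + 1) * (k + 1)) * (k.factorial * (k + 1) ^ L) := Nat.mul_le_mul (by nlinarith) ih
      _ = _ := by
          rw [pow_succ, Nat.succ_eq_add_one]
          ring

theorem shiftedWeight_le_powerWeight (L k : ℕ) :
    shiftedWeight L k ≤ powerWeight (L : ℝ) k := by
  have h : ((L + 1).ascFactorial k : ℝ) ≤ k.factorial * ((k : ℝ) + 1) ^ L := by
    exact_mod_cast ascFactorial_le_factorial_mul_pow L k
  unfold shiftedWeight powerWeight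
  rw [Real.rpow_natCast]
  exact (div_le_self (by positivity) (one_le_pow₀ (by simp))).trans h

/-- Near a point where the coefficients are continuous, the coefficients of `Θ` grow like
`k! (k + 1) ^ q / |a| ^ k` at most, for every `q > re ν + 2`. -/
theorem weightBound_theta {l : Filter ι} {p : ι → Params ℂ} (hp : ScalarsIn (GeoBound l) p)
    {A A' : ℝ} (hA0 : 0 ≤ A) (hA : ∀ᶠ i in l, ‖(p i).a‖ ≤ A) (hA'0 : 0 ≤ A')
    (hA' : ∀ᶠ i in l, ‖(p i).a⁻¹‖ ≤ A') (ha : ∀ᶠ i in l, (p i).a ≠ 0) {ν : ℂ}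
    (hν : Tendsto (fun i => (p i).nu) l (𝓝 ν)) {q : ℝ} (hq : ν.re + 2 < q) :
    WeightBound l (fun i => ‖(p i).a‖) (fun _ => powerWeight q) fun i => (p i).theta := by
  have hN : ∀ᶠ i in l, ‖(p i).nu‖ ≤ ‖ν‖ + 1 :=
    (hν.norm.eventually (eventually_lt_nhds (by linarith))).mono fun i hi => hi.le
  -- The shifted weights give some exponent `L`, possibly large; it is lowered by `1` at a time.
  obtain ⟨L, U, hU, h⟩ := exists_norm_coeff_theta_le hp ha hA hA' hN (by positivity) hA0 hA'0
  obtain ⟨n, hn⟩ := exists_nat_ge ((L : ℝ) - q)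
  have hstart : WeightBound l (fun i => ‖(p i).a‖) (fun _ => powerWeight (q + n))
      fun i => (p i).theta := by
    refine ⟨U, hU, h.mono fun i hi k => (hi k).trans (mul_le_mul_of_nonneg_left ?_ hU)⟩
    exact (shiftedWeight_le_powerWeight L k).trans (powerWeight_mono (by linarith) k)
  clear hn
  induction n with
  | zero => simpa using hstart
  | succ n ih =>
    refine ih (weightBound_theta_of_le hp hA0 hA hA'0 hA' ha hν ?_ ?_ hstart)
    · push_cast
      linarith
    · have : (0 : ℝ) ≤ n := Nat.cast_nonneg n
      linarith

/-- Locally uniformly in `ν`, the values `1 / Γ(ν + j + 3)` are at most of the size of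
`1 / (j! (j + 1) ^ q)` for every `q < re ν + 2`. -/
theorem exists_powerWeight_mul_norm_inv_Gamma_le {ν₀ : ℂ} {q : ℝ} (hq : q < ν₀.re + 2) :
    ∃ C : ℝ, 0 ≤ C ∧ ∀ᶠ ν in 𝓝 ν₀, ∀ j : ℕ,
      powerWeight q j * ‖(Complex.Gamma (ν + j + 3))⁻¹‖ ≤ C := by
  obtain ⟨k₀, hk₀, hr⟩ := exists_mul_rpow_le_norm_add (c₀ := ν₀ + 2) (q := q) (by simpa)
  have hc : ∀ j : ℕ, Continuous fun ν : ℂ =>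
      powerWeight q j * ‖(Complex.Gamma (ν + j + 3))⁻¹‖ := fun j =>
    continuous_const.mul (Complex.differentiable_one_div_Gamma.continuous.comp
      (by fun_prop : Continuous fun ν : ℂ => ν + j + 3)).norm
  set f : ℕ → ℝ := fun j => powerWeight q j * ‖(Complex.Gamma (ν₀ + j + 3))⁻¹‖ + 1
  have hf : ∀ j, 0 ≤ f j := fun j => by
    have := powerWeight_pos q j
    positivity
  refine ⟨∑ j ∈ Finset.range (k₀ + 1), f j, Finset.sum_nonneg fun j _ => hf j, ?_⟩
  have hsmall : ∀ᶠ ν in 𝓝 ν₀, ∀ j ∈ Finset.range (k₀ + 1),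
      powerWeight q j * ‖(Complex.Gamma (ν + j + 3))⁻¹‖ < f j := by
    rw [Filter.eventually_all_finset]
    intro j _
    exact ((hc j).tendsto ν₀).eventually (eventually_lt_nhds (by simp [f]))
  have hr' := ((continuous_add_const (2 : ℂ)).tendsto ν₀).eventually hr
  filter_upwards [hsmall, hr'] with ν hs hr j
  have hs' : ∀ j ≤ k₀, powerWeight q j * ‖(Complex.Gamma (ν + j + 3))⁻¹‖ ≤
      ∑ j ∈ Finset.range (k₀ + 1), f j := fun j hj =>
    (hs j (Finset.mem_range.2 (Nat.lt_succ_of_le hj))).le.trans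
      (Finset.single_le_sum (fun j _ => hf j) (Finset.mem_range.2 (Nat.lt_succ_of_le hj)))
  induction j with
  | zero => exact hs' 0 (Nat.zero_le _)
  | succ j ih =>
    rcases Nat.lt_or_ge k₀ (j + 1) with hlt | hle
    swap
    · exact hs' _ hle
    refine le_trans ?_ ih
    have h1 := hr (j + 1) hlt.le
    have e : ((j + 1 : ℕ) : ℂ) + (ν + 2) = ν + j + 3 := by push_cast; ring
    rw [e] at h1
    push_cast at h1
    -- The functional equation of `Γ` requires this; it follows from the lower bound `h1`.
    have hne : ν + j + 3 ≠ 0 := by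
      intro h0
      rw [h0, norm_zero, zero_mul] at h1
      have : 0 < ((j : ℝ) + 1) * ((j : ℝ) + 1 + 1) ^ q := by positivity
      linarith
    have hG : Complex.Gamma (ν + (j + 1 : ℕ) + 3) = (ν + j + 3) * Complex.Gamma (ν + j + 3) := by
      rw [← Complex.Gamma_add_one _ hne]
      congr 1
      push_cast
      ring
    rw [hG, mul_inv, norm_mul, ← mul_assoc]
    refine mul_le_mul_of_nonneg_right ?_ (norm_nonneg _)
    rw [norm_inv, ← div_eq_mul_inv, div_le_iff₀ (norm_pos_iff.2 hne)]
    unfold powerWeight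
    rw [Nat.factorial_succ]
    push_cast
    calc _ = (j.factorial : ℝ) * (((j : ℝ) + 1) * ((j : ℝ) + 1 + 1) ^ q) := by ring
      _ ≤ (j.factorial : ℝ) * (‖ν + j + 3‖ * ((j : ℝ) + 1) ^ q) := by gcongr
      _ = _ := by ring

/-- The general term of `S_∞` is `O((j + 1) ^ (-3 / 2))`, locally uniformly in the parameter. -/
theorem exists_norm_termC_le {p : ℂ → Params ℂ} {z₀ : ℂ} (hp : ScalarsIn (HolAt z₀) p)
    (ha : (p z₀).a ≠ 0) : ∃ C : ℝ, ∀ᶠ z in 𝓝 z₀, ∀ j : ℕ,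
      ‖termC (p z) j‖ ≤ C * ((j : ℝ) + 1) ^ (-(3 / 2) : ℝ) := by
  have hcont : ∀ {c : ℂ → ℂ}, HolAt z₀ (fun z => C (c z)) → ContinuousAt c z₀ := fun h => by
    simpa using (h 0).continuousAt
  have hbdd : ∀ {c : ℂ → ℂ}, ContinuousAt c z₀ → ∀ᶠ z in 𝓝 z₀, ‖c z‖ ≤ ‖c z₀‖ + 1 := fun h =>
    (h.norm.eventually (eventually_lt_nhds (lt_add_one _))).mono fun _ h => h.le
  have hgeo : ∀ {c : ℂ → ℂ}, HolAt z₀ (fun z => C (c z)) → GeoBound (𝓝 z₀) fun z => C (c z) :=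
    fun h => GeoBound.C ⟨_, hbdd (hcont h)⟩
  have hg : ScalarsIn (GeoBound (𝓝 z₀)) p :=
    ⟨hgeo hp.D11, hgeo hp.D02, hgeo hp.D30, hgeo hp.D21, hgeo hp.D12, hgeo hp.D03, hgeo hp.E11,
      hgeo hp.E02, hgeo hp.E30, hgeo hp.E21, hgeo hp.E12, hgeo hp.E03, hgeo hp.a, hgeo hp.nu⟩
  have hac := hcont hp.a
  have hA := hbdd hac
  have hA' : ∀ᶠ z in 𝓝 z₀, ‖(p z).a⁻¹‖ ≤ ‖(p z₀).a⁻¹‖ + 1 := hbdd (hac.inv₀ ha)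
  have hne := hac.eventually_ne ha
  have hν : Tendsto (fun z => (p z).nu) (𝓝 z₀) (𝓝 (p z₀).nu) := hcont hp.nu
  -- With `s = re ν + 2`, the bounds for `g` and for `1 / Γ` lose `1 / 4` each, out of the gain
  -- of `2` in the exponent.
  have hT := weightBound_theta hg (by positivity) hA (by positivity) hA' hne hν
    (q := (p z₀).nu.re + 2 + 1 / 4) (by linarith)
  obtain ⟨C1, hC1, h1⟩ := exists_norm_g_le hg (by positivity) hA hT
  obtain ⟨C2, hC2, h2⟩ := exists_powerWeight_mul_norm_inv_Gamma_le
    (ν₀ := (p z₀).nu) (q := (p z₀).nu.re + 2 - 1 / 4) (by linarith)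
  refine ⟨(‖(p z₀).a⁻¹‖ + 1) * C1 * C2, ?_⟩
  filter_upwards [h1, hν.eventually h2, hA'] with z h1 h2 hA' j
  set s : ℝ := (p z₀).nu.re + 2 with hs
  have hw := powerWeight_pos (s - 1 / 4) j
  have hsplit : powerWeight (s + 1 / 4 - 2) j =
      powerWeight (s - 1 / 4) j * ((j : ℝ) + 1) ^ (-(3 / 2) : ℝ) := by
    unfold powerWeight
    rw [mul_assoc, ← Real.rpow_add (by positivity)]
    congr 2
    ring
  have hterm : ‖termC (p z) j‖ = ‖(p z).a⁻¹‖ * (‖(p z).a‖ ^ j * ‖(p z).g j‖ *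
      ‖(Complex.Gamma ((p z).nu + j + 3))⁻¹‖) := by
    simp only [termC, div_eq_mul_inv, norm_mul, norm_pow, norm_neg, norm_one, one_pow,
      one_mul]
  rw [hterm]
  calc _ = ‖(p z).a⁻¹‖ * ((‖(p z).g j‖ * ‖(p z).a‖ ^ j) *
        ‖(Complex.Gamma ((p z).nu + j + 3))⁻¹‖) := by ring
    _ ≤ (‖(p z₀).a⁻¹‖ + 1) * ((C1 * powerWeight (s + 1 / 4 - 2) j) *
        ‖(Complex.Gamma ((p z).nu + j + 3))⁻¹‖) := by
        have := h1 j
        gcongr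
    _ = (‖(p z₀).a⁻¹‖ + 1) * C1 * (powerWeight (s - 1 / 4) j *
        ‖(Complex.Gamma ((p z).nu + j + 3))⁻¹‖) * ((j : ℝ) + 1) ^ (-(3 / 2) : ℝ) := by
        rw [hsplit]
        ring
    _ ≤ _ := by
        have := h2 j
        gcongr

theorem summable_add_one_rpow : Summable fun j : ℕ => ((j : ℝ) + 1) ^ (-(3 / 2) : ℝ) := by
  have h := (summable_nat_add_iff 1).2
    (Real.summable_nat_rpow.2 (show (-(3 / 2) : ℝ) < -1 by norm_num))
  simpa using h

/-- If the renormalized coefficients are holomorphic on an open set where `a` does not vanish, then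
the series defining `S_∞` converges there to a holomorphic function. -/
theorem summable_and_differentiableOn {p : ℂ → Params ℂ} {Ω : Set ℂ} (hΩ : IsOpen Ω)
    (hp : ∀ z ∈ Ω, ScalarsIn (HolAt z) p) (ha : ∀ z ∈ Ω, (p z).a ≠ 0) :
    (∀ z ∈ Ω, Summable (termC (p z))) ∧
      DifferentiableOn ℂ (fun z => ∑' j, termC (p z) j) Ω := by
  have hterm : ∀ j, ∀ z ∈ Ω, DifferentiableAt ℂ (fun z => termC (p z) j) z := by
    intro j z hz
    have hcoe : ∀ {c : ℂ → ℂ}, HolAt z (fun w => C (c w)) → DifferentiableAt ℂ c z := fun h => by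
      simpa using h 0
    have haz := hcoe (hp z hz).a
    have hg := differentiableAt_g (hp z hz) (haz.fun_inv (ha z hz)) j
    have hG : DifferentiableAt ℂ (fun w => (Complex.Gamma ((p w).nu + j + 3))⁻¹) z :=
      (Complex.differentiable_one_div_Gamma _).comp z
        (f := fun w => (p w).nu + j + 3) (((hcoe (hp z hz).nu).add_const _).add_const _)
    simp only [termC, div_eq_mul_inv, one_mul]
    exact (haz.fun_inv (ha z hz)).fun_mul
      ((((differentiableAt_const _).fun_mul (haz.fun_pow j)).fun_mul hg).fun_mul hG)
  constructor
  · intro z hz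
    obtain ⟨C, hC⟩ := exists_norm_termC_le (hp z hz) (ha z hz)
    exact Summable.of_norm_bounded (summable_add_one_rpow.mul_left C) hC.self_of_nhds
  · intro z hz
    obtain ⟨C, hC⟩ := exists_norm_termC_le (hp z hz) (ha z hz)
    obtain ⟨V, hV, hVo, hzV⟩ := eventually_nhds_iff.1 (hC.and (hΩ.eventually_mem hz))
    refine ((Complex.differentiableOn_tsum_of_summable_norm (summable_add_one_rpow.mul_left C)
      (fun j w hw => (hterm j w (hV w hw).2).differentiableWithinAt) hVo
      fun j w hw => (hV w hw).1 j).differentiableAt (hVo.mem_nhds hzV)).differentiableWithinAt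

/-! ### Nondegenerate parameters -/

/-- The quantities by which the definitions of the renormalized coefficients divide are nonzero;
`et20` is included because it is a factor of `ψ̃`, by which `E₃₀` is divided. -/
structure Params.Nondegenerate {𝕜 : Type} [Field 𝕜] (p : Params 𝕜) : Prop where
  l : p.l ≠ 0
  slope : p.cp - p.cm ≠ 0
  lam : p.lam ≠ 0
  mu : p.mu ≠ 0
  dt20 : p.dt20 ≠ 0
  et20 : p.et20 ≠ 0

namespace Params.Nondegenerate

theorem a_ne_zero {𝕜 : Type} [Field 𝕜] {p : Params 𝕜} (hp : p.Nondegenerate) : p.a ≠ 0 :=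
  div_ne_zero hp.lam hp.mu

theorem psiInf_ne_zero {𝕜 : Type} [Field 𝕜] {p : Params 𝕜} (hp : p.Nondegenerate) :
    p.psiInf ≠ 0 :=
  div_ne_zero (neg_ne_zero.2 (mul_ne_zero hp.et20 hp.mu)) (mul_ne_zero hp.dt20 hp.lam)

end Params.Nondegenerate

/-- The parameters depend on a complex variable in a differentiable way at `z`. -/
structure DifferentiableParamsAt (p : ℂ → Params ℂ) (z : ℂ) : Prop where
  d : DifferentiableAt ℂ (fun z => (p z).d) z
  l : DifferentiableAt ℂ (fun z => (p z).l) z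
  r : DifferentiableAt ℂ (fun z => (p z).r) z
  sig : DifferentiableAt ℂ (fun z => (p z).sig) z
  cp : DifferentiableAt ℂ (fun z => (p z).cp) z
  cm : DifferentiableAt ℂ (fun z => (p z).cm) z
  lam : DifferentiableAt ℂ (fun z => (p z).lam) z
  mu : DifferentiableAt ℂ (fun z => (p z).mu) z

/-- The renormalized coefficients are rational in the parameters, with denominators that are
products of the quantities in `Params.Nondegenerate`. -/
theorem scalarsIn_holAt {p : ℂ → Params ℂ} {z : ℂ} (hp : DifferentiableParamsAt p z)
    (hz : (p z).Nondegenerate) : ScalarsIn (HolAt z) p := by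
  obtain ⟨hd, hl, hr, hsig, hcp, hcm, hlam, hmu⟩ := hp
  have l0 := hz.l
  have s0 := hz.slope
  have lam0 := hz.lam
  have mu0 := hz.mu
  have dt0 := hz.dt20
  have psi0 := hz.psiInf_ne_zero
  have h1 : -(p z).mu * ((p z).cp - (p z).cm) ≠ 0 := mul_ne_zero (neg_ne_zero.2 mu0) s0
  have h2 : ((p z).cp - (p z).cm) * -(p z).lam ≠ 0 := mul_ne_zero s0 (neg_ne_zero.2 lam0)
  have h3 : ((p z).cp - (p z).cm) * -(p z).lam * (p z).psiInf ≠ 0 := mul_ne_zero h2 psi0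
  have h4 : (p z).dt20 * (p z).lam ≠ 0 := mul_ne_zero dt0 lam0
  have e20 : DifferentiableAt ℂ (fun z => (p z).e20) z := by
    unfold Params.e20; fun_prop (disch := assumption)
  have e11 : DifferentiableAt ℂ (fun z => (p z).e11) z := by
    unfold Params.e11 Params.w2; fun_prop (disch := assumption)
  have e02 : DifferentiableAt ℂ (fun z => (p z).e02) z := by
    unfold Params.e02; fun_prop
  have e21 : DifferentiableAt ℂ (fun z => (p z).e21) z := by
    unfold Params.e21; fun_prop (disch := assumption)
  have d20 : DifferentiableAt ℂ (fun z => (p z).d20) z := by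
    unfold Params.d20 Params.w2; fun_prop
  have d11 : DifferentiableAt ℂ (fun z => (p z).d11) z := by
    unfold Params.d11; fun_prop
  have d02 : DifferentiableAt ℂ (fun z => (p z).d02) z := by
    unfold Params.d02 Params.w2; fun_prop
  have hdt20 : DifferentiableAt ℂ (fun z => (p z).dt20) z := by
    unfold Params.dt20 Params.dt Params.A20 Params.B20; fun_prop
  have het20 : DifferentiableAt ℂ (fun z => (p z).et20) z := by
    unfold Params.et20 Params.et Params.A20 Params.B20; fun_prop
  have hw : DifferentiableAt ℂ (fun z => (p z).wInf) z := by
    unfold Params.wInf; fun_prop (disch := assumption)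
  have hpsi : DifferentiableAt ℂ (fun z => (p z).psiInf) z := by
    unfold Params.psiInf; fun_prop (disch := assumption)
  have hD11 : DifferentiableAt ℂ (fun z => (p z).D11) z := by
    unfold Params.D11 Params.dt Params.A11 Params.B11; fun_prop (disch := assumption)
  have hD30 : DifferentiableAt ℂ (fun z => (p z).D30) z := by
    unfold Params.D30 Params.dt Params.A30 Params.B30; fun_prop (disch := assumption)
  have hE11 : DifferentiableAt ℂ (fun z => (p z).E11) z := by
    unfold Params.E11 Params.et Params.A11 Params.B11; fun_prop (disch := assumption)
  have ha : DifferentiableAt ℂ (fun z => (p z).a) z := by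
    unfold Params.a; fun_prop (disch := assumption)
  refine ⟨HolAt.C hD11, HolAt.C ?_, HolAt.C hD30, HolAt.C ?_, HolAt.C ?_, HolAt.C ?_,
    HolAt.C hE11, HolAt.C ?_, HolAt.C ?_, HolAt.C ?_, HolAt.C ?_, HolAt.C ?_, HolAt.C ha,
    HolAt.C ?_⟩
  · unfold Params.D02 Params.dt Params.A02 Params.B02; fun_prop (disch := assumption)
  · unfold Params.D21 Params.dt Params.A21 Params.B21; fun_prop (disch := assumption)
  · unfold Params.D12 Params.dt Params.A12 Params.B12; fun_prop (disch := assumption)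
  · unfold Params.D03 Params.dt Params.A03 Params.B03; fun_prop (disch := assumption)
  · unfold Params.E02 Params.et Params.A02 Params.B02; fun_prop (disch := assumption)
  · unfold Params.E30 Params.et Params.A30 Params.B30; fun_prop (disch := assumption)
  · unfold Params.E21 Params.et Params.A21 Params.B21; fun_prop (disch := assumption)
  · unfold Params.E12 Params.et Params.A12 Params.B12; fun_prop (disch := assumption)
  · unfold Params.E03 Params.et Params.A03 Params.B03; fun_prop (disch := assumption)
  · unfold Params.nu; fun_prop

/-! ### Change of field -/

section Map

variable {𝕜 𝕃 : Type} [Field 𝕜] [Field 𝕃] (φ : 𝕜 →+* 𝕃)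

/-- The image of the parameters under a homomorphism of fields. -/
def Params.map (p : Params 𝕜) : Params 𝕃 where
  d := φ p.d
  l := φ p.l
  r := φ p.r
  sig := φ p.sig
  cp := φ p.cp
  cm := φ p.cm
  lam := φ p.lam
  mu := φ p.mu

theorem map_powerSeries_inv {f : PowerSeries 𝕜} (h : constantCoeff f = 1) :
    PowerSeries.map φ f⁻¹ = (PowerSeries.map φ f)⁻¹ := by
  have h1 : constantCoeff (PowerSeries.map φ f) ≠ 0 := by
    rw [← coeff_zero_eq_constantCoeff_apply, coeff_map, coeff_zero_eq_constantCoeff_apply, h]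
    simp
  rw [PowerSeries.eq_inv_iff_mul_eq_one h1, ← map_mul, PowerSeries.inv_mul_cancel _ (by simp [h]),
    map_one]

theorem map_powerSeries_derivative (f : PowerSeries 𝕜) :
    PowerSeries.map φ (derivative 𝕜 f) = derivative 𝕃 (PowerSeries.map φ f) := by
  ext k
  simp [coeff_derivative]

namespace Params

variable (p : Params 𝕜)

theorem map_d : (p.map φ).d = φ p.d := rfl

theorem map_l : (p.map φ).l = φ p.l := rfl

theorem map_r : (p.map φ).r = φ p.r := rfl

theorem map_sig : (p.map φ).sig = φ p.sig := rfl

theorem map_cp : (p.map φ).cp = φ p.cp := rfl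

theorem map_cm : (p.map φ).cm = φ p.cm := rfl

theorem map_lam : (p.map φ).lam = φ p.lam := rfl

theorem map_mu : (p.map φ).mu = φ p.mu := rfl

theorem map_w2 : (p.map φ).w2 = φ p.w2 := by
  simp only [w2, map_sig, map_sub, map_one]

theorem map_d20 : (p.map φ).d20 = φ p.d20 := by
  simp only [d20, map_w2, map_r, map_add, map_sub, map_mul, map_one, map_ofNat]

theorem map_d11 : (p.map φ).d11 = φ p.d11 := by
  simp only [d11, map_d, map_sig, map_mul, map_neg, map_ofNat]

theorem map_d02 : (p.map φ).d02 = φ p.d02 := by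
  simp only [d02, map_l, map_r, map_d, map_w2, map_sub, map_mul, map_one]

theorem map_e20 : (p.map φ).e20 = φ p.e20 := by
  simp only [e20, map_sig, map_l, map_d, map_add, map_sub, map_mul, map_div₀, map_one]

theorem map_e11 : (p.map φ).e11 = φ p.e11 := by
  simp only [e11, map_w2, map_l, map_d, map_r, map_add, map_sub, map_mul, map_div₀, map_one,
    map_ofNat]

theorem map_e02 : (p.map φ).e02 = φ p.e02 := by
  simp only [e02, map_sig, map_mul, map_neg, map_ofNat]

theorem map_e21 : (p.map φ).e21 = φ p.e21 := by
  simp only [e21, map_l, map_d, map_add, map_sub, map_div₀, map_one]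

theorem map_dt20 : (p.map φ).dt20 = φ p.dt20 := by
  simp only [dt20, dt, A20, B20, map_d20, map_d11, map_d02, map_e20, map_e11, map_e02, map_cm,
    map_cp, map_add, map_mul, map_neg, map_pow]

theorem map_et20 : (p.map φ).et20 = φ p.et20 := by
  simp only [et20, et, A20, B20, map_d20, map_d11, map_d02, map_e20, map_e11, map_e02, map_cm,
    map_add, map_sub, map_mul, map_pow]

theorem map_wInf : (p.map φ).wInf = φ p.wInf := by
  simp only [wInf, map_cp, map_cm, map_mu, map_dt20, map_sub, map_mul, map_div₀]

theorem map_psiInf : (p.map φ).psiInf = φ p.psiInf := by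
  simp only [psiInf, map_et20, map_mu, map_dt20, map_lam, map_mul, map_neg, map_div₀]

theorem map_D11 : (p.map φ).D11 = φ p.D11 := by
  simp only [D11, dt, A11, B11, map_cp, map_cm, map_psiInf, map_wInf, map_mu, map_d20, map_d11,
    map_d02, map_e20, map_e11, map_e02, map_add, map_sub, map_mul, map_neg, map_div₀, map_ofNat]

theorem map_D02 : (p.map φ).D02 = φ p.D02 := by
  simp only [D02, dt, A02, B02, map_cp, map_cm, map_psiInf, map_wInf, map_mu, map_d20, map_d11,
    map_d02, map_e20, map_e11, map_e02, map_add, map_sub, map_mul, map_neg, map_div₀, map_pow]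

theorem map_D30 : (p.map φ).D30 = φ p.D30 := by
  simp only [D30, dt, A30, B30, map_e21, map_cp, map_cm, map_wInf, map_mu, map_d, map_add, map_sub,
    map_mul, map_neg, map_div₀, map_pow, map_one]

theorem map_D21 : (p.map φ).D21 = φ p.D21 := by
  simp only [D21, dt, A21, B21, map_e21, map_cp, map_cm, map_psiInf, map_wInf, map_mu, map_d,
    map_add, map_sub, map_mul, map_neg, map_div₀, map_pow, map_ofNat]

theorem map_D12 : (p.map φ).D12 = φ p.D12 := by
  simp only [D12, dt, A12, B12, map_e21, map_cp, map_cm, map_psiInf, map_wInf, map_mu, map_d,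
    map_add, map_sub, map_mul, map_neg, map_div₀, map_pow, map_ofNat]

theorem map_D03 : (p.map φ).D03 = φ p.D03 := by
  simp only [D03, dt, A03, B03, map_e21, map_cp, map_cm, map_psiInf, map_wInf, map_mu, map_d,
    map_add, map_sub, map_mul, map_neg, map_div₀, map_pow, map_one]

theorem map_E11 : (p.map φ).E11 = φ p.E11 := by
  simp only [E11, et, A11, B11, map_cp, map_cm, map_wInf, map_lam, map_d20, map_d11, map_d02,
    map_e20, map_e11, map_e02, map_add, map_sub, map_mul, map_neg, map_div₀, map_ofNat]

theorem map_E02 : (p.map φ).E02 = φ p.E02 := by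
  simp only [E02, et, A02, B02, map_cp, map_cm, map_psiInf, map_wInf, map_lam, map_d20, map_d11,
    map_d02, map_e20, map_e11, map_e02, map_add, map_sub, map_mul, map_neg, map_div₀, map_pow]

theorem map_E30 : (p.map φ).E30 = φ p.E30 := by
  simp only [E30, et, A30, B30, map_e21, map_cp, map_cm, map_psiInf, map_wInf, map_lam, map_d,
    map_sub, map_mul, map_neg, map_div₀, map_pow, map_one]

theorem map_E21 : (p.map φ).E21 = φ p.E21 := by
  simp only [E21, et, A21, B21, map_e21, map_cp, map_cm, map_wInf, map_lam, map_d, map_add, map_sub,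
    map_mul, map_neg, map_div₀, map_pow, map_ofNat]

theorem map_E12 : (p.map φ).E12 = φ p.E12 := by
  simp only [E12, et, A12, B12, map_e21, map_cp, map_cm, map_psiInf, map_wInf, map_lam, map_d,
    map_add, map_sub, map_mul, map_neg, map_div₀, map_pow, map_ofNat]

theorem map_E03 : (p.map φ).E03 = φ p.E03 := by
  simp only [E03, et, A03, B03, map_e21, map_cp, map_cm, map_psiInf, map_wInf, map_lam, map_d,
    map_sub, map_mul, map_neg, map_div₀, map_pow, map_one]

theorem map_a : (p.map φ).a = φ p.a := by
  simp only [a, map_lam, map_mu, map_div₀]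

theorem map_nu : (p.map φ).nu = φ p.nu := by
  simp only [nu, map_a, map_D11, map_D30, map_E11, map_add, map_sub, map_mul, map_neg]

theorem map_H1 : (p.map φ).H1 = PowerSeries.map φ p.H1 := by
  simp only [H1, map_E11, map_E30, map_E02, map_E21, map_E12, map_E03, map_add, map_sub, map_mul,
    map_neg, map_pow, PowerSeries.map_C, PowerSeries.map_X]

theorem map_H2 : (p.map φ).H2 = PowerSeries.map φ p.H2 := by
  simp only [H2, map_D11, map_D30, map_D02, map_D21, map_D12, map_D03, map_add, map_sub, map_mul,
    map_pow, PowerSeries.map_C, PowerSeries.map_X]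

theorem map_G1 : (p.map φ).G1 = PowerSeries.map φ p.G1 := by
  simp only [G1, map_E11, map_E02, map_E21, map_E12, map_E03, map_add, map_sub, map_mul, map_pow,
    map_ofNat, PowerSeries.map_C, PowerSeries.map_X]

theorem map_G2 : (p.map φ).G2 = PowerSeries.map φ p.G2 := by
  simp only [G2, map_D11, map_D02, map_D21, map_D12, map_D03, map_add, map_sub, map_mul, map_neg,
    map_pow, map_ofNat, PowerSeries.map_C, PowerSeries.map_X]

theorem map_M11 : (p.map φ).M11 = PowerSeries.map φ p.M11 := by
  simp only [M11, map_E02, map_E12, map_E03, map_add, map_sub, map_mul, map_neg, map_pow, map_ofNat,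
    PowerSeries.map_C, PowerSeries.map_X]

theorem map_M12 : (p.map φ).M12 = PowerSeries.map φ p.M12 := by
  simp only [M12, map_E03, map_mul, map_neg, map_pow, PowerSeries.map_C, PowerSeries.map_X]

theorem map_M21 : (p.map φ).M21 = PowerSeries.map φ p.M21 := by
  simp only [M21, map_D02, map_D12, map_D03, map_add, map_sub, map_mul, map_pow, map_ofNat,
    PowerSeries.map_C, PowerSeries.map_X]

theorem map_M22 : (p.map φ).M22 = PowerSeries.map φ p.M22 := by
  simp only [M22, map_D03, map_mul, map_pow, PowerSeries.map_C, PowerSeries.map_X]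

theorem map_xiNum : (p.map φ).xiNum = PowerSeries.map φ p.xiNum := by
  have h : (1 + (p.map φ).H2)⁻¹ = PowerSeries.map φ (1 + p.H2)⁻¹ := by
    rw [map_powerSeries_inv φ p.constantCoeff_one_add_H2, map_add, map_one, map_H2]
  simp only [xiNum, h, map_a, map_E11, map_D11, map_D30, map_G1, map_G2, map_add, map_sub, map_mul,
    map_one, map_ofNat, PowerSeries.map_C, PowerSeries.map_X]

theorem map_xi : (p.map φ).xi = PowerSeries.map φ p.xi := by
  ext n
  simp only [xi, map_sub, coeff_mk, coeff_map, map_xiNum, PowerSeries.map_C, map_a, map_E11,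
    map_D11, map_D30, map_mul, map_add]

theorem map_mCoeff (n : ℕ) : (p.map φ).mCoeff n = φ (p.mCoeff n) := by
  induction n using Nat.strong_induction_on with
  | _ n ih =>
    rcases n with _ | n
    · simp [mCoeff]
    · rw [mCoeff, mCoeff, map_div₀, map_neg, map_sum, map_add, map_natCast, map_one]
      congr 2
      refine Finset.sum_congr rfl fun i _ => ?_
      rw [map_mul, ih _ i.2, map_xi, coeff_map]

theorem map_M : (p.map φ).M = PowerSeries.map φ p.M := by
  ext n
  rw [coeff_map, M, M, coeff_mk, coeff_mk, map_mCoeff]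

theorem map_F (Ψ : PowerSeries 𝕜) :
    (p.map φ).F (PowerSeries.map φ Ψ) = PowerSeries.map φ (p.F Ψ) := by
  simp only [F, N1divX, N2, ← map_powerSeries_derivative, map_a, map_G2, map_M11, map_M12, map_M21,
    map_M22, map_add, map_sub, map_mul, map_neg, map_pow, map_ofNat, PowerSeries.map_C,
    PowerSeries.map_X]

theorem map_source (T : PowerSeries 𝕜) :
    (p.map φ).source (PowerSeries.map φ T) = PowerSeries.map φ (p.source T) := by
  have h : PowerSeries.X * (p.map φ).M * PowerSeries.map φ T =
      PowerSeries.map φ (PowerSeries.X * p.M * T) := by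
    rw [map_mul, map_mul, PowerSeries.map_X, map_M]
  rw [source, source, h, map_F, map_mul, map_powerSeries_inv φ p.constantCoeff_M_mul]
  simp only [F0, map_M, map_a, map_H1, map_H2, map_add, map_sub, map_mul, map_neg, map_one,
    map_ofNat, PowerSeries.map_C]

theorem map_step (T : PowerSeries 𝕜) :
    (p.map φ).step (PowerSeries.map φ T) = PowerSeries.map φ (p.step T) := by
  simp only [step, map_source, ← map_powerSeries_derivative, map_a, map_nu, map_add, map_sub,
    map_mul, map_pow, map_inv₀, map_ofNat, PowerSeries.map_C, PowerSeries.map_X]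

theorem map_theta : (p.map φ).theta = PowerSeries.map φ p.theta := by
  have h : ∀ n, (p.map φ).step^[n] 0 = PowerSeries.map φ (p.step^[n] 0) := by
    intro n
    induction n with
    | zero => simp
    | succ n ih => rw [Function.iterate_succ_apply', Function.iterate_succ_apply', ih, map_step]
  ext k
  rw [coeff_map, theta, theta, coeff_mk, coeff_mk, h, coeff_map]

theorem map_g (k : ℕ) : (p.map φ).g k = φ (p.g k) := by
  rw [g, g, map_theta, map_source, coeff_map]

end Params

end Map

theorem termC_map_ofReal (p : Params ℝ) (j : ℕ) :
    termC (p.map Complex.ofRealHom) j = (termR p j : ℂ) := by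
  rw [termC, termR, Params.map_a, Params.map_nu, Params.map_g]
  simp only [Complex.ofRealHom_eq_coe]
  push_cast
  rw [← Complex.Gamma_ofReal]
  push_cast
  rfl

theorem starC_ofReal (d : ℕ) (l : ℝ) : starC d l = (starR d l).map Complex.ofRealHom := by
  simp [starC, starR, starParams, Params.map]

theorem plusC_ofReal (d : ℕ) {l : ℝ} (hl : 0 ≤ l) :
    plusC d l = (plusR d l).map Complex.ofRealHom := by
  have h1 : (l : ℂ) ^ (1 / 2 : ℂ) = ((√l : ℝ) : ℂ) := by
    rw [Real.sqrt_eq_rpow, Complex.ofReal_cpow hl]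
    norm_num
  have h2 : (l : ℂ) ^ (1 / 4 : ℂ) = ((l ^ (1 / 4 : ℝ) : ℝ) : ℂ) := by
    rw [Complex.ofReal_cpow hl]
    norm_num
  rw [plusC, h1, h2]
  simp only [plusR, plusParams, Params.map, Complex.ofRealHom_eq_coe]
  push_cast
  rfl

/-- The sums over `ℝ` and over `ℂ` agree at real parameters. -/
theorem summable_and_tsum_of_complex {p : Params ℝ} {q : Params ℂ}
    (hq : q = p.map Complex.ofRealHom) (h : Summable (termC q)) :
    Summable (termR p) ∧ ∑' j, termC q j = ((∑' j, termR p j : ℝ) : ℂ) := by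
  have e : termC q = fun j => (termR p j : ℂ) := funext fun j => by rw [hq, termC_map_ofReal]
  rw [e] at h ⊢
  exact ⟨Complex.summable_ofReal.1 h, (Complex.ofReal_tsum _).symm⟩

/-! ### The two families -/

theorem starParams_dt20 {q z : ℂ} (h0 : z ≠ 0) (h1 : z + q ≠ 0)
    (h2 : q ^ 2 * (q - 1) + z * (q + 1) ≠ 0) :
    (starParams (q ^ 2) q z).dt20 = 4 * q ^ 2 * z * (q - 1) * (z + q ^ 2) * (z - q ^ 2) /
      ((z + q) * (q ^ 2 * (q - 1) + z * (q + 1)) ^ 2) := by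
  simp only [starParams, Params.dt20, Params.dt, Params.A20, Params.B20, Params.d20, Params.d11,
    Params.d02, Params.e20, Params.e11, Params.e02, Params.w2]
  field_simp
  ring

theorem starParams_et20 {q z : ℂ} (h0 : z ≠ 0) (h1 : z + q ≠ 0)
    (h2 : q ^ 2 * (q - 1) + z * (q + 1) ≠ 0) :
    (starParams (q ^ 2) q z).et20 = q * z * (q - 1) * (z + q ^ 2) * (q + 1) *
      (q ^ 3 * (q - 1) * (3 * q - 2) + 2 * q * (q + 1) ^ 2 * z - (q - 1) * z ^ 2) /
      ((z + q) * (q ^ 2 * (q - 1) + z * (q + 1)) ^ 3) := by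
  simp only [starParams, Params.et20, Params.et, Params.A20, Params.B20, Params.d20, Params.d11,
    Params.d02, Params.e20, Params.e11, Params.e02, Params.w2]
  field_simp
  ring

theorem plusParams_dt20 {d m s t : ℂ} (h0 : s ≠ 0) (h1 : 1 + s ≠ 0) :
    (plusParams d m (s ^ 2) s t).dt20 = (d - 1) * (d - s ^ 2) / (s * (1 + s) ^ 2) := by
  simp only [plusParams, Params.dt20, Params.dt, Params.A20, Params.B20, Params.d20, Params.d11,
    Params.d02, Params.e20, Params.e11, Params.e02, Params.w2]
  field_simp
  ring

theorem plusParams_et20 {d m s t : ℂ} (h0 : s ≠ 0) (h1 : 1 + s ≠ 0) :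
    (plusParams d m (s ^ 2) s t).et20 = (d - 1) * (s ^ 2 + 1) / (s ^ 2 * (1 + s)) := by
  simp only [plusParams, Params.et20, Params.et, Params.A20, Params.B20, Params.d20, Params.d11,
    Params.d02, Params.e20, Params.e11, Params.e02, Params.w2]
  field_simp
  ring

/-- The product of the factors of the denominators and of the quantities that have to be nonzero
along the first family, with `q = √d`. -/
def starDenom (q z : ℂ) : ℂ :=
  z * (z + q) * (q ^ 2 * (q - 1) + z * (q + 1)) * (q * (q ^ 2 - q + 2) + z * (q + 1)) *
    (z + q ^ 2) * (z - q ^ 2) *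
    (q ^ 3 * (q - 1) * (3 * q - 2) + 2 * q * (q + 1) ^ 2 * z - (q - 1) * z ^ 2)

theorem starParams_nondegenerate {q z : ℂ} (hq0 : q ≠ 0) (hq1 : q - 1 ≠ 0) (hq2 : q + 1 ≠ 0)
    (h : starDenom q z ≠ 0) : (starParams (q ^ 2) q z).Nondegenerate := by
  simp only [starDenom, mul_ne_zero_iff] at h
  obtain ⟨⟨⟨⟨⟨⟨h0, h1⟩, h2⟩, h3⟩, h4⟩, h5⟩, h6⟩ := h
  have four0 : (4 : ℂ) ≠ 0 := by norm_num
  refine ⟨h0, ?_, ?_, ?_, ?_, ?_⟩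
  · have e : (starParams (q ^ 2) q z).cp - (starParams (q ^ 2) q z).cm =
        z * (q * (q ^ 2 - q + 2) + z * (q + 1)) / (q ^ 2 * (q - 1) + z * (q + 1)) := by
      simp only [starParams]
      field_simp
      ring
    rw [e]
    exact div_ne_zero (mul_ne_zero h0 h3) h2
  · have e : (starParams (q ^ 2) q z).lam =
        -(q * (q * (q ^ 2 - q + 2) + z * (q + 1))) / (z + q) ^ 2 := by
      simp only [starParams]
      congr 1
      ring
    rw [e]
    exact div_ne_zero (neg_ne_zero.2 (mul_ne_zero hq0 h3)) (pow_ne_zero _ h1)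
  · have e : (starParams (q ^ 2) q z).mu =
        -(4 * q ^ 2) / (q * (q ^ 2 - q + 2) + z * (q + 1)) := by
      simp only [starParams]
      congr 1
      ring
    rw [e]
    exact div_ne_zero (neg_ne_zero.2 (mul_ne_zero four0 (pow_ne_zero _ hq0))) h3
  · rw [starParams_dt20 h0 h1 h2]
    exact div_ne_zero (mul_ne_zero (mul_ne_zero (mul_ne_zero (mul_ne_zero (mul_ne_zero four0
      (pow_ne_zero _ hq0)) h0) hq1) h4) h5) (mul_ne_zero h1 (pow_ne_zero _ h2))
  · rw [starParams_et20 h0 h1 h2]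
    exact div_ne_zero (mul_ne_zero (mul_ne_zero (mul_ne_zero (mul_ne_zero (mul_ne_zero hq0 h0) hq1)
      h4) hq2) h6) (mul_ne_zero h1 (pow_ne_zero _ h2))

theorem starParams_differentiable {q z : ℂ} (h : starDenom q z ≠ 0) :
    DifferentiableParamsAt (starParams (q ^ 2) q) z := by
  simp only [starDenom, mul_ne_zero_iff] at h
  obtain ⟨⟨⟨⟨⟨⟨h0, h1⟩, h2⟩, h3⟩, h4⟩, h5⟩, h6⟩ := h
  have h1' : (z + q) ^ 2 ≠ 0 := pow_ne_zero _ h1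
  have h3' : -q ^ 2 + q ^ 2 * q + z + q * (2 + z) ≠ 0 := by
    convert h3 using 1
    ring
  constructor <;> simp only [starParams] <;> fun_prop (disch := assumption)

theorem plusParams_nondegenerate {d m s t : ℂ} (hd : d - 1 ≠ 0) (hm : m ≠ 0) (h0 : s ≠ 0)
    (ht : t ≠ 0) (h1 : 1 + s ≠ 0) (h2 : s ^ 2 + (d + 1) * s + 1 ≠ 0) (h3 : s ^ 2 - d ≠ 0)
    (h4 : s ^ 2 + 1 ≠ 0) : (plusParams d m (s ^ 2) s t).Nondegenerate := by
  have h2' : 1 + (d + 1) * s + s ^ 2 ≠ 0 := by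
    convert h2 using 1
    ring
  refine ⟨pow_ne_zero _ h0, ?_, ?_, ?_, ?_, ?_⟩
  · have e : (plusParams d m (s ^ 2) s t).cp - (plusParams d m (s ^ 2) s t).cm =
        (s ^ 2 + (d + 1) * s + 1) / (1 + s) := by
      simp only [plusParams]
      field_simp
      ring
    rw [e]
    exact div_ne_zero h2 h1
  · exact div_ne_zero (neg_ne_zero.2 (mul_ne_zero two_ne_zero h2)) (pow_ne_zero _ h1)
  · exact div_ne_zero (neg_ne_zero.2 (mul_ne_zero (mul_ne_zero two_ne_zero hm) h3))
      (mul_ne_zero (mul_ne_zero h1 ht) h2')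
  · rw [plusParams_dt20 h0 h1]
    refine div_ne_zero (mul_ne_zero hd ?_) (mul_ne_zero h0 (pow_ne_zero _ h1))
    rw [← neg_sub]
    exact neg_ne_zero.2 h3
  · rw [plusParams_et20 h0 h1]
    exact div_ne_zero (mul_ne_zero hd h4) (mul_ne_zero (pow_ne_zero _ h0) h1)

theorem cpow_half_sq {z : ℂ} : (z ^ (1 / 2 : ℂ)) ^ 2 = z := by
  simp

theorem re_cpow_half_pos {z : ℂ} (hz : z ∈ Complex.slitPlane) : 0 < (z ^ (1 / 2 : ℂ)).re := by
  have h0 := Complex.slitPlane_ne_zero hz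
  have h1 := (Complex.mem_slitPlane_iff_arg.1 hz).1
  have h2 := Complex.neg_pi_lt_arg z
  have h3 := lt_of_le_of_ne (Complex.arg_le_pi z) h1
  rw [Complex.cpow_def_of_ne_zero h0, Complex.exp_re]
  refine mul_pos (Real.exp_pos _) (Real.cos_pos_of_mem_Ioo ?_)
  have e : (Complex.log z * (1 / 2)).im = z.arg / 2 := by
    rw [← Complex.log_im, show Complex.log z * (1 / 2) = ((1 / 2 : ℝ) : ℂ) * Complex.log z by
      push_cast; ring, Complex.im_ofReal_mul]
    ring
  rw [e]
  constructor <;> linarith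

theorem quadratic_ne_zero_of_re_pos {d : ℝ} (hd : 0 ≤ d) {s : ℂ} (hs : 0 < s.re) :
    s ^ 2 + ((d : ℂ) + 1) * s + 1 ≠ 0 := by
  intro h
  have h1 := congrArg Complex.re h
  have h2 := congrArg Complex.im h
  simp [pow_two] at h1 h2
  have h3 : s.im = 0 := by
    have : s.im * (2 * s.re + d + 1) = 0 := by linarith
    rcases mul_eq_zero.1 this with h | h
    · exact h
    · exfalso; linarith
  rw [h3] at h1
  nlinarith [mul_nonneg hd hs.le]

/-- Along the first family, `S_∞` is holomorphic where `starDenom` does not vanish, and this set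
contains the interval `(0, d)`. -/
theorem exists_star_extension {d : ℕ} (hd : 2 ≤ d) :
    ∃ Ω : Set ℂ, IsOpen Ω ∧ (∀ l ∈ Set.Ioo 0 (d : ℝ), (l : ℂ) ∈ Ω) ∧
      (∀ l ∈ Set.Ioo 0 (d : ℝ), Summable (termR (starR d l))) ∧
      (∀ z ∈ Ω, Summable (termC (starC d z))) ∧
      DifferentiableOn ℂ (SStarC d) Ω ∧
      ∀ l ∈ Set.Ioo 0 (d : ℝ), SStarC d l = (SStar d l : ℂ) := by
  set q : ℝ := √(d : ℝ) with hq
  have hd' : (2 : ℝ) ≤ d := by exact_mod_cast hd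
  have hqd : q ^ 2 = d := Real.sq_sqrt (by linarith)
  have hq1 : 1 < q := by
    rw [hq, Real.lt_sqrt zero_le_one]
    linarith
  have hc0 : (q : ℂ) ≠ 0 := by exact_mod_cast (by linarith : q ≠ 0)
  have hc1 : (q : ℂ) - 1 ≠ 0 := by exact_mod_cast (by linarith : q - 1 ≠ 0)
  have hc2 : (q : ℂ) + 1 ≠ 0 := by exact_mod_cast (by linarith : q + 1 ≠ 0)
  have hp : starC d = starParams ((q : ℂ) ^ 2) q := by
    funext z
    rw [starC, ← Complex.ofReal_pow, hqd, Complex.ofReal_natCast]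
  set Ω : Set ℂ := {z | starDenom q z ≠ 0} with hΩ
  have hopen : IsOpen Ω :=
    isOpen_ne_fun (by unfold starDenom; fun_prop) continuous_const
  have hmem : ∀ l ∈ Set.Ioo 0 (d : ℝ), (l : ℂ) ∈ Ω := by
    rintro l ⟨h0, h1⟩
    rw [← hqd] at h1
    have hq0 : 0 < q - 1 := by linarith
    have f1 : 0 < q ^ 2 * (q - 1) + l * (q + 1) := by positivity
    have f2 : 0 < q * (q ^ 2 - q + 2) + l * (q + 1) := by
      have : 0 < q ^ 2 - q + 2 := by nlinarith
      positivity
    have f3 : l - q ^ 2 ≠ 0 := by linarith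
    -- The roots in `l` of this quadratic factor lie outside `[0, q ^ 2]`.
    have f4 : 0 < q ^ 3 * (q - 1) * (3 * q - 2) + 2 * q * (q + 1) ^ 2 * l - (q - 1) * l ^ 2 := by
      have g1 : 0 < q ^ 3 * (q - 1) * (3 * q - 2) := by
        have : 0 < 3 * q - 2 := by linarith
        positivity
      have g2 : (q - 1) * l ^ 2 ≤ (q - 1) * q ^ 2 * l := by
        have := mul_le_mul_of_nonneg_left h1.le (mul_nonneg hq0.le h0.le)
        nlinarith
      have g3 : (q - 1) * q ^ 2 * l ≤ 2 * q * (q + 1) ^ 2 * l := by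
        refine mul_le_mul_of_nonneg_right ?_ h0.le
        nlinarith [mul_pos (by linarith : 0 < q) (by linarith : 0 < q),
          mul_pos (mul_pos (by linarith : 0 < q) (by linarith : 0 < q)) (by linarith : 0 < q)]
      linarith
    have key : l * (l + q) * (q ^ 2 * (q - 1) + l * (q + 1)) *
        (q * (q ^ 2 - q + 2) + l * (q + 1)) * (l + q ^ 2) * (l - q ^ 2) *
        (q ^ 3 * (q - 1) * (3 * q - 2) + 2 * q * (q + 1) ^ 2 * l - (q - 1) * l ^ 2) ≠ 0 := by
      have h5 : 0 < l + q := by linarith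
      have h6 : 0 < l + q ^ 2 := by positivity
      exact mul_ne_zero (mul_ne_zero (by positivity) f3) f4.ne'
    have : starDenom q l ≠ 0 := by
      unfold starDenom
      exact_mod_cast key
    exact this
  obtain ⟨hs, hdiff⟩ := summable_and_differentiableOn (p := starC d) hopen
    (fun z hz => by
      rw [hp]
      exact scalarsIn_holAt (starParams_differentiable hz)
        (starParams_nondegenerate hc0 hc1 hc2 hz))
    (fun z hz => by
      rw [hp]
      exact (starParams_nondegenerate hc0 hc1 hc2 hz).a_ne_zero)
  have hreal := fun l hl => summable_and_tsum_of_complex (starC_ofReal d l) (hs _ (hmem l hl))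
  exact ⟨Ω, hopen, hmem, fun l hl => (hreal l hl).1, hs, hdiff, fun l hl => (hreal l hl).2⟩

/-- Along the second family, `S_∞` is holomorphic on the slit plane deprived of `d`, where `μ₊`
vanishes. -/
theorem plus_extension {d : ℕ} (hd : 2 ≤ d) {Ω : Set ℂ} (hΩ : Ω = Complex.slitPlane ∩ {(d : ℂ)}ᶜ) :
    IsOpen Ω ∧ (∀ l : ℝ, 0 < l → l ≠ d → (l : ℂ) ∈ Ω) ∧
      (∀ l : ℝ, 0 < l → l ≠ d → Summable (termR (plusR d l))) ∧
      (∀ z ∈ Ω, Summable (termC (plusC d z))) ∧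
      DifferentiableOn ℂ (SPlusC d) Ω ∧
      ∀ l : ℝ, 0 < l → l ≠ d → SPlusC d l = (SPlus d l : ℂ) := by
  have hd' : (2 : ℝ) ≤ d := by exact_mod_cast hd
  have hopen : IsOpen Ω := by
    rw [hΩ]
    exact Complex.isOpen_slitPlane.inter isOpen_compl_singleton
  have hmem : ∀ l : ℝ, 0 < l → l ≠ d → (l : ℂ) ∈ Ω := by
    intro l h0 h1
    rw [hΩ]
    refine ⟨Complex.ofReal_mem_slitPlane.2 h0, ?_⟩
    rw [Set.mem_compl_singleton_iff]
    exact_mod_cast h1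
  have hc1 : (d : ℂ) - 1 ≠ 0 := by
    have : (d : ℝ) - 1 ≠ 0 := by linarith
    exact_mod_cast this
  have hm : ((√((d : ℝ) - 1) : ℝ) : ℂ) ≠ 0 := by
    have : √((d : ℝ) - 1) ≠ 0 := (Real.sqrt_pos.2 (by linarith)).ne'
    exact_mod_cast this
  have hfacts : ∀ z ∈ Ω, z ∈ Complex.slitPlane ∧ z ≠ 0 ∧ z ^ (1 / 2 : ℂ) ≠ 0 ∧
      z ^ (1 / 4 : ℂ) ≠ 0 ∧ 1 + z ^ (1 / 2 : ℂ) ≠ 0 ∧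
      (z ^ (1 / 2 : ℂ)) ^ 2 + ((d : ℂ) + 1) * z ^ (1 / 2 : ℂ) + 1 ≠ 0 ∧
      z - d ≠ 0 ∧ z + 1 ≠ 0 := by
    intro z hz
    rw [hΩ] at hz
    have hre := re_cpow_half_pos hz.1
    have h0 := Complex.slitPlane_ne_zero hz.1
    refine ⟨hz.1, h0, fun h => ?_, ?_, fun h => ?_, ?_, sub_ne_zero.2 hz.2, fun h => ?_⟩
    · rw [h] at hre
      simp at hre
    · rw [Complex.cpow_def_of_ne_zero h0]
      exact Complex.exp_ne_zero _
    · have := congrArg Complex.re h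
      simp only [Complex.add_re, Complex.one_re, Complex.zero_re] at this
      linarith
    · have := quadratic_ne_zero_of_re_pos (d := (d : ℝ)) (by linarith) hre
      exact_mod_cast this
    · rw [eq_neg_of_add_eq_zero_left h] at hz
      have hz1 := hz.1
      norm_num [Complex.mem_slitPlane_iff] at hz1
  have hnd : ∀ z ∈ Ω, (plusC d z).Nondegenerate := by
    intro z hz
    obtain ⟨hs, h0, h1, h2, h3, h4, h5, h6⟩ := hfacts z hz
    have e := cpow_half_sq (z := z)
    have := plusParams_nondegenerate (t := z ^ (1 / 4 : ℂ)) hc1 hm h1 h2 h3 h4 (by rwa [e])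
      (by rwa [e])
    rwa [e] at this
  have hdp : ∀ z ∈ Ω, DifferentiableParamsAt (plusC d) z := by
    intro z hz
    obtain ⟨hs, h0, h1, h2, h3, h4, h5, h6⟩ := hfacts z hz
    rw [cpow_half_sq] at h4
    have k1 : (1 + z ^ (1 / 2 : ℂ)) ^ 2 ≠ 0 := pow_ne_zero _ h3
    have k2 : (1 + z ^ (1 / 2 : ℂ)) ^ 3 ≠ 0 := pow_ne_zero _ h3
    have k3 : (1 + z ^ (1 / 2 : ℂ)) * z ^ (1 / 4 : ℂ) *
        (1 + ((d : ℂ) + 1) * z ^ (1 / 2 : ℂ) + z) ≠ 0 := by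
      refine mul_ne_zero (mul_ne_zero h3 h2) ?_
      convert h4 using 1
      ring
    have ds : DifferentiableAt ℂ (fun z : ℂ => z ^ (1 / 2 : ℂ)) z :=
      differentiableAt_id.cpow_const hs
    have dt : DifferentiableAt ℂ (fun z : ℂ => z ^ (1 / 4 : ℂ)) z :=
      differentiableAt_id.cpow_const hs
    constructor <;> simp only [plusC, plusParams] <;> fun_prop (disch := assumption)
  obtain ⟨hs, hdiff⟩ := summable_and_differentiableOn hopen
    (fun z hz => scalarsIn_holAt (hdp z hz) (hnd z hz)) (fun z hz => (hnd z hz).a_ne_zero)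
  have hreal := fun (l : ℝ) (h0 : 0 < l) (h1 : l ≠ d) =>
    summable_and_tsum_of_complex (plusC_ofReal d h0.le) (hs _ (hmem l h0 h1))
  exact ⟨hopen, hmem, fun l h0 h1 => (hreal l h0 h1).1, hs, hdiff, fun l h0 h1 => (hreal l h0 h1).2⟩

/-- The two sides of `d` on the positive real axis are joined by way of the upper half plane. -/
theorem exists_connectedComponentIn_slitPlane {d : ℝ} (hd : 0 < d) {Ω : Set ℂ}
    (hΩ : Ω = Complex.slitPlane ∩ {(d : ℂ)}ᶜ) :
    ∃ z₀ ∈ Ω, ∀ l : ℝ, 0 < l → l ≠ d → (l : ℂ) ∈ connectedComponentIn Ω z₀ := by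
  set A : Set ℂ := {z | 0 < z.re} ∩ {z | z.re < d}
  set B : Set ℂ := {z | 0 < z.im}
  set D : Set ℂ := {z | d < z.re}
  have hA : IsPreconnected A :=
    ((convex_halfSpace_re_gt 0).inter (convex_halfSpace_re_lt d)).isPreconnected
  have hB : IsPreconnected B := (convex_halfSpace_im_gt 0).isPreconnected
  have hD : IsPreconnected D := (convex_halfSpace_re_gt d).isPreconnected
  have hAB : IsPreconnected (A ∪ B) :=
    IsPreconnected.union (⟨d / 2, 1⟩ : ℂ) ⟨half_pos hd, half_lt_self hd⟩ (zero_lt_one' ℝ) hA hB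
  have hS : IsPreconnected (A ∪ B ∪ D) :=
    IsPreconnected.union (⟨d + 1, 1⟩ : ℂ) (Or.inr (zero_lt_one' ℝ)) (lt_add_one d) hAB hD
  have hsub : A ∪ B ∪ D ⊆ Ω := by
    rw [hΩ]
    rintro z ((⟨h1, h2⟩ | h) | h)
    · refine ⟨Complex.mem_slitPlane_iff.2 (Or.inl h1), ?_⟩
      rintro rfl
      simp at h2
    · refine ⟨Complex.mem_slitPlane_iff.2 (Or.inr (ne_of_gt h)), ?_⟩
      rintro rfl
      simp [B] at h
    · refine ⟨Complex.mem_slitPlane_iff.2 (Or.inl (hd.trans h)), ?_⟩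
      rintro rfl
      simp [D] at h
  have hI : Complex.I ∈ A ∪ B ∪ D := Or.inl (Or.inr (by simp [B]))
  refine ⟨Complex.I, hsub hI, fun l h0 h1 => hS.subset_connectedComponentIn hI hsub ?_⟩
  rcases lt_or_gt_of_ne h1 with h | h
  · exact Or.inl (Or.inl ⟨by simpa using h0, by simpa using h⟩)
  · exact Or.inr (by simpa [D] using h)

end

end Implosion

theorem lemma1p4 :
    (∀ d : ℕ, 4 ≤ d →
      ∃ Ω : Set ℂ, IsOpen Ω ∧ (∀ l ∈ Implosion.OStar d, (l : ℂ) ∈ Ω) ∧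
        (∀ l ∈ Implosion.OStar d, Summable (Implosion.termR (Implosion.starR d l))) ∧
        (∀ z ∈ Ω, Summable (Implosion.termC (Implosion.starC d z))) ∧
        DifferentiableOn ℂ (Implosion.SStarC d) Ω ∧
        ∀ l ∈ Implosion.OStar d, Implosion.SStarC d l = (Implosion.SStar d l : ℂ)) ∧
    (∀ d : ℕ, 4 ≤ d →
      ∃ Ω : Set ℂ, IsOpen Ω ∧ (∀ l ∈ Set.Ioi (d : ℝ), (l : ℂ) ∈ Ω) ∧
        (∀ l ∈ Set.Ioi (d : ℝ), Summable (Implosion.termR (Implosion.plusR d l))) ∧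
        (∀ z ∈ Ω, Summable (Implosion.termC (Implosion.plusC d z))) ∧
        DifferentiableOn ℂ (Implosion.SPlusC d) Ω ∧
        ∀ l ∈ Set.Ioi (d : ℝ), Implosion.SPlusC d l = (Implosion.SPlus d l : ℂ)) ∧
    (∀ d : ℕ, d = 2 ∨ d = 3 →
      ∃ Ω : Set ℂ, IsOpen Ω ∧ (∀ l ∈ Set.Ioo 0 (d : ℝ), (l : ℂ) ∈ Ω) ∧
        (∀ l ∈ Set.Ioo 0 (d : ℝ), Summable (Implosion.termR (Implosion.starR d l))) ∧
        (∀ z ∈ Ω, Summable (Implosion.termC (Implosion.starC d z))) ∧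
        DifferentiableOn ℂ (Implosion.SStarC d) Ω ∧
        ∀ l ∈ Set.Ioo 0 (d : ℝ), Implosion.SStarC d l = (Implosion.SStar d l : ℂ)) ∧
    (∀ d : ℕ, d = 2 ∨ d = 3 →
      ∃ Ω : Set ℂ, IsOpen Ω ∧ (∀ l : ℝ, 0 < l → l ≠ d → (l : ℂ) ∈ Ω) ∧
        (∀ l : ℝ, 0 < l → l ≠ d → Summable (Implosion.termR (Implosion.plusR d l))) ∧
        (∀ z ∈ Ω, Summable (Implosion.termC (Implosion.plusC d z))) ∧
        DifferentiableOn ℂ (Implosion.SPlusC d) Ω ∧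
        (∀ l : ℝ, 0 < l → l ≠ d → Implosion.SPlusC d l = (Implosion.SPlus d l : ℂ)) ∧
        ∃ z₀ ∈ Ω, ∀ l : ℝ, 0 < l → l ≠ d → (l : ℂ) ∈ connectedComponentIn Ω z₀) := by
  refine ⟨fun d hd => ?_, fun d hd => ?_, fun d hd => ?_, fun d hd => ?_⟩
  · obtain ⟨Ω, h1, h2, h3, h4, h5, h6⟩ := Implosion.exists_star_extension (d := d) (by lia)
    exact ⟨Ω, h1, fun l hl => h2 l hl.1, fun l hl => h3 l hl.1, h4, h5, fun l hl => h6 l hl.1⟩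
  · obtain ⟨h1, h2, h3, h4, h5, h6⟩ := Implosion.plus_extension (d := d) (by lia) rfl
    have hpos : ∀ l ∈ Set.Ioi (d : ℝ), 0 < l ∧ l ≠ d := fun l hl =>
      ⟨(Nat.cast_nonneg d).trans_lt hl, ne_of_gt hl⟩
    exact ⟨_, h1, fun l hl => h2 l (hpos l hl).1 (hpos l hl).2,
      fun l hl => h3 l (hpos l hl).1 (hpos l hl).2, h4, h5,
      fun l hl => h6 l (hpos l hl).1 (hpos l hl).2⟩
  · exact Implosion.exists_star_extension (d := d) (by lia)
  · obtain ⟨h1, h2, h3, h4, h5, h6⟩ := Implosion.plus_extension (d := d) (by lia) rfl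
    have hd0 : (0 : ℝ) < d := by
      have : 0 < d := by lia
      exact_mod_cast this
    exact ⟨_, h1, h2, h3, h4, h5, h6,
      Implosion.exists_connectedComponentIn_slitPlane hd0 (by simp)⟩
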